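/- **Setting.** Fix integers $1\le q\le p$, $R\ge 0$, a quantile level $\tau\in(0,1)$, and $0=b_0<b_1<\dots<b_{R+1}=1$. Let $\{\eta_i\}_{i\in\mathbb Z}$ and $\{\zeta_i\}_{i\in\mathbb Z}$ be two i.i.d. sequences, independent of each other, $\mathcal F_k=(\eta_k,\eta_{k-1},\dots)$, $\mathcal G_k=(\zeta_k,\zeta_{k-1},\dots)$; let $\mathcal F_k^*,\mathcal G_k^*$ be the same histories with $\eta_0,\zeta_0$ replaced by independent copies $\eta_0^*,\zeta_0^*$. For measurable filters $D_r,H_r$ ($0\le r\le R$) with values in $\mathbb R$ and $\mathbb R^p$, and $t_i=i/n$, let $$y_i=x_i^\top\beta_0+\epsilon_i,\quad x_i=H_r(t_i,\mathcal F_{i-1},\mathcal G_i),\quad \epsilon_i=D_r(t_i,\mathcal F_i,\mathcal G_i)\quad (b_r<t_i\le b_{r+1}),\quad 1\le i\le n,$$ where the $\tau$-th conditional quantile of $\epsilon_i$ given $x_i$ is $0$, and $\beta_0\in Q=\{\beta\in\mathbb R^p:\beta_1,\dots,\beta_q\ge 0\}$. Let $\rho_\tau(u)=u(\tau-I(u<0))$,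 $\psi_\tau(u)=\tau-I(u<0)$, and let $\tilde\beta_n$ and $\hat\beta_n$ be any minimizers of $\sum_{i=1}^n\rho_\tau(y_i-x_i^\top\beta)$ over $\beta\in\mathbb R^p$ and over $\beta\in Q$, respectively. Write $F_r^{(l)}(t,x\mid\mathcal F_{k-1},\mathcal G_k)=\frac{\partial^l}{\partial x^l}P(D_r(t,\mathcal F_k,\mathcal G_k)\le x\mid\mathcal F_{k-1},\mathcal G_k)$, $f_r=F_r^{(1)}$, and $$G_n=\sum_{i=1}^n x_i\psi_\tau(\epsilon_i),\qquad K_n=\sum_{i=1}^n E\{f_r(t_i,0\mid\mathcal F_{i-1},\mathcal G_i)\,x_ix_i^\top\}.$$ For positive definite $\Sigma$ let $\mathcal P_{Q,\Sigma}(x)=\arg\min_{\beta\in Q}(\beta-x)^\top\Sigma(\beta-x)$. Let $|\cdot|$ be the Euclidean norm, $\|\cdot\|_v=(E|\cdot|^v)^{1/v}$, and $\lambda_1$ the smallest eigenvalue of a symmetric matrix. **Conditions.** Constants $M<\infty$, $\chi\in(0,1)$, $c,\epsilon,\kappa>0$ may differ from line to line; bounds hold uniformly over $0\le r\le R$ and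 $t,t_1,t_2\in(b_r,b_{r+1})$, $t_1<t_2$; bounds on random quantities that are not norms hold almost surely. (C1) $\|\{H_r(t_1,\mathcal F_{-1},\mathcal G_0)-H_r(t_2,\mathcal F_{-1},\mathcal G_0)\}/(t_1-t_2)\|_4\le M$; $\sup_{r,t}\|H_r(t,\mathcal F_{k-1},\mathcal G_k)-H_r(t,\mathcal F^*_{k-1},\mathcal G^*_k)\|_4=O(\chi^k)$; and $\max_{1\le i\le n}\|x_i\|_{4+\kappa}\le M$ for all $n$. (C2) $\|\{D_r(t_1,\mathcal F_0,\mathcal G_0)-D_r(t_2,\mathcal F_0,\mathcal G_0)\}/(t_1-t_2)\|_4\le M$; almost surely, the derivatives $F_r^{(l)}(t,x\mid\mathcal F_{-1},\mathcal G_0)$ exist for all $l\le p$ and $x\in\mathbb R$; and for some $c>0$ and every $0\le l\le p$, $$\sup_{r,t,|u|<c}\|F_r^{(l)}(t,H_r(t,\mathcal F_{k-1},\mathcal G_k)^\top u\mid\mathcal F_{k-1},\mathcal G_k)-F_r^{(l)}(t,H_r(t,\mathcal F_{k-1}^*,\mathcal G_k^*)^\top u\mid\mathcal F_{k-1}^*,\mathcal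 G_k^*)\|_4=O(\chi^k).$$ (C3) $|f_r(t,x\mid\mathcal F_{-1},\mathcal G_0)|\ge\epsilon$ for $|x|<c$ and $\le M$ for all $x\in\mathbb R$; $|f_r(t,x_1\mid\mathcal F_{-1},\mathcal G_0)-f_r(t,x_2\mid\mathcal F_{-1},\mathcal G_0)|\le M|x_1-x_2|$ for $-c<x_1<x_2<c$; and $\|\{f_r(t_1,0\mid\mathcal F_{-1},\mathcal G_0)-f_r(t_2,0\mid\mathcal F_{-1},\mathcal G_0)\}/(t_1-t_2)\|_2\le M$. (C4) $\lambda_1\big(E\{H_r(t,\mathcal F_{-1},\mathcal G_0)H_r(t,\mathcal F_{-1},\mathcal G_0)^\top\}\big)\ge\epsilon$. (C5) $\lambda_1(\Omega(t))\ge\epsilon$ for all $0<t\le 1$, where $\Omega(t)=\sum_{i\in\mathbb Z}\mathrm{cov}\{H_r(t,\mathcal F_{-1},\mathcal G_0)\psi_\tau(D_r(t,\mathcal F_0,\mathcal G_0)),\,H_r(t,\mathcal F_{i-1},\mathcal G_i)\psi_\tau(D_r(t,\mathcal F_i,\mathcal G_i))\}$ for $b_r<t\le b_{r+1}$. **Proposition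 A1.** Under (C1)–(C5), as $n\to\infty$: (i) $|\tilde\beta_n-\beta_0|=o_p(n^{-1/2}\log n)$ and $|\hat\beta_n-\beta_0|=o_p(n^{-1/2}\log n)$; (ii) $K_n$ is positive definite for all large $n$, and $(\tilde\beta_n-\beta_0)-K_n^{-1}G_n=o_p(n^{-1/2})$; (iii) with $\hat\gamma_n=\mathcal P_{Q,K_n/n}(\tilde\beta_n)$, $|\hat\beta_n-\hat\gamma_n|=o_p(n^{-1/2})$. -/

import Mathlib

open MeasureTheory ProbabilityTheory Filter Topology
open scoped ENNReal NNReal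

/-! ### Check function, metric projection, stochastic order -/

/-- The check function `ρ_τ(u) = u (τ - 1{u < 0})`. -/
noncomputable def checkFun (τ u : ℝ) : ℝ := u * (τ - if u < 0 then 1 else 0)

/-- `ψ_τ(u) = τ - 1{u < 0}`. -/
noncomputable def checkDeriv (τ u : ℝ) : ℝ := τ - if u < 0 then 1 else 0

/-- The constraint set `Q = {β ∈ ℝ^p : β_1 ≥ 0, …, β_q ≥ 0}` (coordinates are counted from `0`
in `Fin p`). -/
def constraintSet (p q : ℕ) : Set (EuclideanSpace ℝ (Fin p)) :=
  {β | ∀ j : Fin p, (j : ℕ) < q → 0 ≤ β j}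

/-- The quadratic form `v ↦ vᵀ S v`. -/
noncomputable def quadForm {p : ℕ} (S : Matrix (Fin p) (Fin p) ℝ)
    (v : EuclideanSpace ℝ (Fin p)) : ℝ :=
  inner ℝ v (Matrix.toEuclideanLin S v)

/-- The metric projection `P_{Q,S}(x) = argmin_{β ∈ Q} (β - x)ᵀ S (β - x)`. If `Q` is nonempty,
closed and convex and `S` is positive definite, the minimizer exists and is unique. -/
noncomputable def metricProj {p : ℕ} (Q : Set (EuclideanSpace ℝ (Fin p)))
    (S : Matrix (Fin p) (Fin p) ℝ) (x : EuclideanSpace ℝ (Fin p)) : EuclideanSpace ℝ (Fin p) :=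
  Classical.epsilon fun z => z ∈ Q ∧ IsMinOn (fun β => quadForm S (β - x)) Q z

/-- The smallest eigenvalue `λ₁(A)` of a real symmetric matrix. -/
noncomputable def smallestEigenvalue {p : ℕ} (A : Matrix (Fin p) (Fin p) ℝ) : ℝ :=
  sInf (spectrum ℝ A)

/-- `X_n = o_p(a_n)`, for random vectors `X_n` and a nonnegative rate `a_n`. -/
def IsLittleOp {Ω E : Type*} [MeasurableSpace Ω] [Norm E] (P : Measure Ω)
    (X : ℕ → Ω → E) (a : ℕ → ℝ) : Prop :=
  ∀ δ : ℝ, 0 < δ → Tendsto (fun n => P {ω | δ * a n < ‖X n ω‖}) atTop (𝓝 0)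

/-- `Δ(k) = O(χ^k)` as `k → ∞`, for some `χ ∈ (0,1)`. -/
def GeometricDecay (Δ : ℕ → ℝ≥0∞) : Prop :=
  ∃ χ : ℝ, 0 < χ ∧ χ < 1 ∧ ∃ C : ℝ≥0, ∀ᶠ k in atTop, Δ k ≤ C * ENNReal.ofReal (χ ^ k)

/-! ### Input sequences -/

/-- The history `(X_k, X_{k-1}, X_{k-2}, …)` of a two-sided sequence. -/
def history {Ω S : Type*} (X : ℤ → Ω → S) (k : ℤ) (ω : Ω) : ℕ → S :=
  fun j => X (k - j) ω

/-- The history `(X_k, …, X_1, X_0^*, X_{-1}, …)` in which the input at time `0` is replaced by an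
independent copy. It lives on `Ω × Ω` with the product measure: the inputs are read off the first
coordinate, and the copy `X_0^*` is `X_0` read off the second coordinate. -/
def historyStar {Ω S : Type*} (X : ℤ → Ω → S) (k : ℤ) (w : Ω × Ω) : ℕ → S :=
  fun j => if k - (j : ℤ) = 0 then X 0 w.2 else X (k - j) w.1

/-- The sequence `(e, a_0, a_1, …)`. -/
def consSeq {S : Type*} (e : S) (a : ℕ → S) : ℕ → S
  | 0 => e
  | j + 1 => a j

/-- `F_k` is obtained from `F_{k-1}` by adding the input at time `k`. -/
theorem consSeq_history {Ω S : Type*} (X : ℤ → Ω → S) (k : ℤ) (ω : Ω) :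
    consSeq (X k ω) (history X (k - 1) ω) = history X k ω := by
  funext j
  cases j with
  | zero => simp [consSeq, history]
  | succ j =>
    simp only [consSeq, history]
    congr 1
    push_cast
    ring

/-- The filters, break points and inputs of piecewise locally stationary predictors
`x_i = H_r(i/n, F_{i-1}, G_i)` and errors `ε_i = D_r(i/n, F_i, G_i)`, `b_r < i/n ≤ b_{r+1}`, where
`F_k = (η_k, η_{k-1}, …)` and `G_k = (ζ_k, ζ_{k-1}, …)`. -/
structure PLSProcess (Ω A B : Type*) [MeasurableSpace Ω] [MeasurableSpace A] [MeasurableSpace B]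
    (P : Measure Ω) (p R : ℕ) where
  /-- The inputs `η_i`. -/
  η : ℤ → Ω → A
  /-- The inputs `ζ_i`. -/
  ζ : ℤ → Ω → B
  /-- The break points `b_0, …, b_{R+1}`. -/
  b : Fin (R + 2) → ℝ
  /-- The filters of the errors. -/
  D : Fin (R + 1) → ℝ → (ℕ → A) → (ℕ → B) → ℝ
  /-- The filters of the predictors. -/
  H : Fin (R + 1) → ℝ → (ℕ → A) → (ℕ → B) → EuclideanSpace ℝ (Fin p)
  measurable_η : ∀ i, Measurable (η i)
  measurable_ζ : ∀ i, Measurable (ζ i)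
  iIndepFun_η : iIndepFun η P
  iIndepFun_ζ : iIndepFun ζ P
  identDistrib_η : ∀ i, IdentDistrib (η i) (η 0) P P
  identDistrib_ζ : ∀ i, IdentDistrib (ζ i) (ζ 0) P P
  indepFun_η_ζ : IndepFun (fun ω i => η i ω) (fun ω i => ζ i ω) P
  strictMono_b : StrictMono b
  b_zero : b 0 = 0
  b_last : b (Fin.last (R + 1)) = 1
  measurable_D : ∀ r t, Measurable fun z : (ℕ → A) × (ℕ → B) => D r t z.1 z.2
  measurable_H : ∀ r t, Measurable fun z : (ℕ → A) × (ℕ → B) => H r t z.1 z.2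

namespace PLSProcess

variable {Ω A B : Type*} [MeasurableSpace Ω] [MeasurableSpace A] [MeasurableSpace B]
  {P : Measure Ω} {p R : ℕ}

/-- The open segment `(b_r, b_{r+1})`. -/
def openSeg (m : PLSProcess Ω A B P p R) (r : Fin (R + 1)) : Set ℝ :=
  Set.Ioo (m.b r.castSucc) (m.b r.succ)

/-- The index `r` of the segment `(b_r, b_{r+1}]` that contains `t`, for `0 < t ≤ 1`. -/
noncomputable def seg (m : PLSProcess Ω A B P p R) (t : ℝ) : Fin (R + 1) :=
  Classical.epsilon fun r => m.b r.castSucc < t ∧ t ≤ m.b r.succ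

/-- Every `t ∈ (0, 1]` lies in the segment that `seg` selects. -/
theorem seg_spec (m : PLSProcess Ω A B P p R) {t : ℝ} (h0 : 0 < t) (h1 : t ≤ 1) :
    m.b (m.seg t).castSucc < t ∧ t ≤ m.b (m.seg t).succ := by
  refine Classical.epsilon_spec (p := fun r : Fin (R + 1) => m.b r.castSucc < t ∧ t ≤ m.b r.succ) ?_
  by_contra hcon
  push Not at hcon
  have key : ∀ i : Fin (R + 2), m.b i < t := fun i => by
    induction i using Fin.induction with
    | zero => rw [m.b_zero]; exact h0
    | succ i ih => exact hcon i ih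
  have := key (Fin.last (R + 1))
  rw [m.b_last] at this
  linarith

/-- `D_r(t, F_k, G_k)`. -/
def err (m : PLSProcess Ω A B P p R) (r : Fin (R + 1)) (t : ℝ) (k : ℤ) (ω : Ω) : ℝ :=
  m.D r t (history m.η k ω) (history m.ζ k ω)

/-- `H_r(t, F_{k-1}, G_k)`. -/
def pred (m : PLSProcess Ω A B P p R) (r : Fin (R + 1)) (t : ℝ) (k : ℤ) (ω : Ω) :
    EuclideanSpace ℝ (Fin p) :=
  m.H r t (history m.η (k - 1) ω) (history m.ζ k ω)

/-- `H_r(t, F_{k-1}^*, G_k^*)`. -/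
def predStar (m : PLSProcess Ω A B P p R) (r : Fin (R + 1)) (t : ℝ) (k : ℤ) (w : Ω × Ω) :
    EuclideanSpace ℝ (Fin p) :=
  m.H r t (historyStar m.η (k - 1) w) (historyStar m.ζ k w)

/-- The conditional distribution function `P(D_r(t, F_k, G_k) ≤ x | F_{k-1} = a, G_k = g)`. As `η_k`
is independent of `(F_{k-1}, G_k)`, it is obtained by integrating out the input `η_k`. -/
noncomputable def condDistFun (m : PLSProcess Ω A B P p R) (r : Fin (R + 1)) (t : ℝ)
    (a : ℕ → A) (g : ℕ → B) (x : ℝ) : ℝ :=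
  (P.map (m.η 0)).real {e | m.D r t (consSeq e a) g ≤ x}

/-- `F_r^{(l)}(t, x | F_{k-1} = a, G_k = g)`, the `l`-th derivative in `x` of the conditional
distribution function. -/
noncomputable def condDeriv (m : PLSProcess Ω A B P p R) (l : ℕ) (r : Fin (R + 1)) (t : ℝ)
    (a : ℕ → A) (g : ℕ → B) (x : ℝ) : ℝ :=
  iteratedDeriv l (m.condDistFun r t a g) x

/-- The conditional density `f_r(t, x | F_{k-1}, G_k)`. -/
noncomputable def condDens (m : PLSProcess Ω A B P p R) (r : Fin (R + 1)) (t x : ℝ) (k : ℤ)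
    (ω : Ω) : ℝ :=
  m.condDeriv 1 r t (history m.η (k - 1) ω) (history m.ζ k ω) x

/-! ### The sample -/

/-- The predictor `x_i` in a sample of size `n`. -/
noncomputable def x (m : PLSProcess Ω A B P p R) (n i : ℕ) (ω : Ω) : EuclideanSpace ℝ (Fin p) :=
  m.pred (m.seg ((i : ℝ) / n)) ((i : ℝ) / n) i ω

/-- The error `ε_{i,τ}` in a sample of size `n`. -/
noncomputable def ε (m : PLSProcess Ω A B P p R) (n i : ℕ) (ω : Ω) : ℝ :=
  m.err (m.seg ((i : ℝ) / n)) ((i : ℝ) / n) i ω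

/-- The response `y_i = x_iᵀ β₀ + ε_{i,τ}` in a sample of size `n`. -/
noncomputable def y (m : PLSProcess Ω A B P p R) (β₀ : EuclideanSpace ℝ (Fin p)) (n i : ℕ)
    (ω : Ω) : ℝ :=
  inner ℝ (m.x n i ω) β₀ + m.ε n i ω

/-- The objective function `∑_{i=1}^n ρ_τ(y_i - x_iᵀ β)`. -/
noncomputable def loss (m : PLSProcess Ω A B P p R) (τ : ℝ) (β₀ : EuclideanSpace ℝ (Fin p)) (n : ℕ)
    (ω : Ω) (β : EuclideanSpace ℝ (Fin p)) : ℝ :=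
  ∑ i ∈ Finset.Icc 1 n, checkFun τ (m.y β₀ n i ω - inner ℝ (m.x n i ω) β)

/-- `G_n = ∑_{i=1}^n x_i ψ_τ(ε_{i,τ})`. -/
noncomputable def G (m : PLSProcess Ω A B P p R) (τ : ℝ) (n : ℕ) (ω : Ω) :
    EuclideanSpace ℝ (Fin p) :=
  ∑ i ∈ Finset.Icc 1 n, checkDeriv τ (m.ε n i ω) • m.x n i ω

/-- `K_n = ∑_{i=1}^n E(f_r(i/n, 0 | F_{i-1}, G_i) x_i x_iᵀ)`. -/
noncomputable def K (m : PLSProcess Ω A B P p R) (n : ℕ) : Matrix (Fin p) (Fin p) ℝ :=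
  Matrix.of fun j l => ∑ i ∈ Finset.Icc 1 n,
    ∫ ω, m.condDens (m.seg ((i : ℝ) / n)) ((i : ℝ) / n) 0 i ω * (m.x n i ω j * m.x n i ω l) ∂P

/-- The `τ`-th conditional quantile of `ε_{i,τ}` given `x_i` is `0`, for all `1 ≤ i ≤ n`. -/
def CondQuantileZero (m : PLSProcess Ω A B P p R) (τ : ℝ) : Prop :=
  ∀ n i : ℕ, 1 ≤ i → i ≤ n →
    (∀ᵐ ω ∂P, (P⟦{ω' | m.ε n i ω' < 0} | MeasurableSpace.comap (m.x n i) inferInstance⟧) ω ≤ τ) ∧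
    (∀ᵐ ω ∂P, τ ≤ (P⟦{ω' | m.ε n i ω' ≤ 0} | MeasurableSpace.comap (m.x n i) inferInstance⟧) ω)

/-! ### Dependence measures, long-run covariance and regularity conditions -/

/-- The dependence measure `Δ_v(H, k)` of the predictors. -/
noncomputable def depMeasureH (m : PLSProcess Ω A B P p R) (v : ℝ≥0∞) (k : ℕ) : ℝ≥0∞ :=
  ⨆ (r : Fin (R + 1)) (t ∈ m.openSeg r),
    eLpNorm (fun w : Ω × Ω => m.pred r t k w.1 - m.predStar r t k w) v (P.prod P)

/-- The dependence measure of `F_r^{(l)}(t, H_r(t, F_{k-1}, G_k)ᵀ u | F_{k-1}, G_k)` in the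
`L_v` norm, uniformly in `|u| < c`. -/
noncomputable def depMeasureF (m : PLSProcess Ω A B P p R) (l : ℕ) (c : ℝ) (v : ℝ≥0∞) (k : ℕ) :
    ℝ≥0∞ :=
  ⨆ (r : Fin (R + 1)) (t ∈ m.openSeg r) (u : EuclideanSpace ℝ (Fin p)) (_ : ‖u‖ < c),
    eLpNorm (fun w : Ω × Ω =>
      m.condDeriv l r t (history m.η (k - 1) w.1) (history m.ζ k w.1)
        (inner ℝ (m.pred r t k w.1) u)
      - m.condDeriv l r t (historyStar m.η (k - 1) w) (historyStar m.ζ k w)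
        (inner ℝ (m.predStar r t k w) u)) v (P.prod P)

/-- The long-run covariance matrix
`Ω(t) = ∑_{i ∈ ℤ} cov{H_r(t, F_{-1}, G_0) ψ_τ(D_r(t, F_0, G_0)),
H_r(t, F_{i-1}, G_i) ψ_τ(D_r(t, F_i, G_i))}`, `b_r < t ≤ b_{r+1}`. -/
noncomputable def longRunCov (m : PLSProcess Ω A B P p R) (τ t : ℝ) : Matrix (Fin p) (Fin p) ℝ :=
  Matrix.of fun j l => ∑' i : ℤ,
    cov[fun ω => m.pred (m.seg t) t 0 ω j * checkDeriv τ (m.err (m.seg t) t 0 ω),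
      fun ω => m.pred (m.seg t) t i ω l * checkDeriv τ (m.err (m.seg t) t i ω); P]

/-- (C1): the predictors are piecewise stochastic Lipschitz continuous in `L_4`, have geometrically
decaying dependence, and uniformly bounded moments of an order above `4`. -/
def C1 (m : PLSProcess Ω A B P p R) : Prop :=
  (∃ M : ℝ≥0, ∀ r, ∀ t₁ ∈ m.openSeg r, ∀ t₂ ∈ m.openSeg r, t₁ < t₂ →
    eLpNorm (fun ω => (t₁ - t₂)⁻¹ • (m.pred r t₁ 0 ω - m.pred r t₂ 0 ω)) 4 P ≤ M) ∧
  GeometricDecay (m.depMeasureH 4) ∧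
  (∃ κ : ℝ, 0 < κ ∧ ∃ M : ℝ≥0, ∀ n i : ℕ, 1 ≤ i → i ≤ n →
    eLpNorm (m.x n i) (ENNReal.ofReal (4 + κ)) P ≤ M)

/-- (C2): the errors are piecewise stochastic Lipschitz continuous in `L_4`, and the conditional
distribution function of the error has derivatives up to order `p`, which have geometrically
decaying dependence. -/
def C2 (m : PLSProcess Ω A B P p R) : Prop :=
  (∃ M : ℝ≥0, ∀ r, ∀ t₁ ∈ m.openSeg r, ∀ t₂ ∈ m.openSeg r, t₁ < t₂ →
    eLpNorm (fun ω => (t₁ - t₂)⁻¹ • (m.err r t₁ 0 ω - m.err r t₂ 0 ω)) 4 P ≤ M) ∧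
  (∀ r, ∀ t ∈ m.openSeg r, ∀ᵐ ω ∂P, ∀ l < p,
    Differentiable ℝ (m.condDeriv l r t (history m.η (-1) ω) (history m.ζ 0 ω))) ∧
  (∃ c : ℝ, 0 < c ∧ ∀ l ≤ p, GeometricDecay (m.depMeasureF l c 4))

/-- (C3): the conditional density of the error is bounded, bounded away from zero and Lipschitz
continuous near zero, and its value at zero is piecewise stochastic Lipschitz continuous in `L_2`. -/
def C3 (m : PLSProcess Ω A B P p R) : Prop :=
  ∃ c ε₀ M : ℝ, 0 < c ∧ 0 < ε₀ ∧
    (∀ r, ∀ t ∈ m.openSeg r, ∀ᵐ ω ∂P,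
      (∀ x : ℝ, |x| < c → ε₀ ≤ |m.condDens r t x 0 ω|) ∧
      (∀ x : ℝ, |m.condDens r t x 0 ω| ≤ M) ∧
      (∀ x₁ x₂ : ℝ, -c < x₁ → x₁ < x₂ → x₂ < c →
        |(m.condDens r t x₁ 0 ω - m.condDens r t x₂ 0 ω) / (x₁ - x₂)| ≤ M)) ∧
    (∀ r, ∀ t₁ ∈ m.openSeg r, ∀ t₂ ∈ m.openSeg r, t₁ < t₂ →
      eLpNorm (fun ω => (m.condDens r t₁ 0 0 ω - m.condDens r t₂ 0 0 ω) / (t₁ - t₂)) 2 P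
        ≤ ENNReal.ofReal M)

/-- (C4): the smallest eigenvalue of `E(H_r(t, F_{-1}, G_0) H_r(t, F_{-1}, G_0)ᵀ)` is bounded away
from zero. -/
def C4 (m : PLSProcess Ω A B P p R) : Prop :=
  ∃ ε₀ : ℝ, 0 < ε₀ ∧ ∀ r, ∀ t ∈ m.openSeg r,
    ε₀ ≤ smallestEigenvalue
      (Matrix.of fun j l : Fin p => ∫ ω, m.pred r t 0 ω j * m.pred r t 0 ω l ∂P)

/-- (C5): the smallest eigenvalue of the long-run covariance matrix is bounded away from zero. -/
def C5 (m : PLSProcess Ω A B P p R) (τ : ℝ) : Prop :=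
  ∃ ε₀ : ℝ, 0 < ε₀ ∧ ∀ t : ℝ, 0 < t → t ≤ 1 → ε₀ ≤ smallestEigenvalue (m.longRunCov τ t)

end PLSProcess

/-!
Put `u = √n (β - β₀)` and let `W_n = n^{-1/2} G_n`. Knight's identity (`loss_sub_loss`) writes the
increment of the objective function as `Ψ_n(u) - ⟨W_n, u⟩`, where `Ψ_n` (`knightSum`) is a sum of
nonnegative remainders. Both estimators minimize this convex function of `u`, over the whole space
and over the rescaled constraint set. The theorem follows once `Ψ_n(u)` is shown to be uniformly
close, on balls, to the deterministic form `uᵀ (K_n / n) u / 2`: the unconstrained minimizer of the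
quadratic approximation is `√n K_n⁻¹ G_n`, the constrained one is a metric projection, and a convex
function that is uniformly close to a strongly convex quadratic has its minimizer close by
(`norm_sub_le_of_isMinOn`). Metric projections are Lipschitz continuous
(`norm_sub_le_of_isMinOn_quadForm`), so that `√n K_n⁻¹ G_n` may be replaced by `√n (β̃ - β₀)` as the
projected point.

The probabilistic part rests on one variance bound (`eLpNorm_sum_sub_integral_sq_le`): a sum of
functions `g_i(F_{i-1}, G_i)` of the history has variance of order `n` as soon as replacing the input
at time `0` changes `g_i` at lag `k` by a summable amount in `L²`. It is the Efron–Stein inequality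
for a product measure over `ℤ`. The remaining randomness, that of the input `η_i` given the past, is
handled by orthogonality of martingale differences (`integral_sq_sum_eq`).

* The score splits into a martingale part and `x_i (τ - F(0 | past))`, which is centred as `0` is the
  conditional quantile. Hence `W_n` is bounded in mean (`RegularDesign.exists_eLpNorm_score_le`).
* Knight's remainder splits into a martingale part, a conditional mean that the expansion of the
  conditional distribution function at `0` makes quadratic, and the curvature
  `f(0 | past) (x_iᵀ u)²`, to which the variance bound applies after truncation of `x_iᵀ u`
  (`eLpNorm_sum_knightRem_sub_le`).
* A change of `u` alters a remainder only if the error is of order `|x_i| / √n`, which makes the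
  Lipschitz constant of `Ψ_n` bounded in mean (`RegularDesign.exists_eLpNorm_lipSum_le`) and
  upgrades pointwise to uniform convergence.

The conditions are imposed inside the open segments between the break points. At most one observation
falls on each break point; there only the moment bound is available, and these observations are
negligible (`eLpNorm_sum_breakIdx_le`, `exists_abs_sum_breakIdx_quadForm_le`).
-/

/-! ### The Efron–Stein inequality for infinite products -/

theorem eLpNorm_two_sq {α : Type*} [MeasurableSpace α] {μ : Measure α} {f : α → ℝ}
    (hf : MemLp f 2 μ) : eLpNorm f 2 μ ^ 2 = ENNReal.ofReal (∫ x, f x ^ 2 ∂μ) := by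
  have hnn : 0 ≤ ∫ x, f x ^ 2 ∂μ := integral_nonneg fun w => sq_nonneg _
  rw [hf.eLpNorm_eq_integral_rpow_norm two_ne_zero ENNReal.ofNat_ne_top,
    ← ENNReal.ofReal_pow (by positivity)]
  congr 1
  simp only [ENNReal.toReal_ofNat, Real.norm_eq_abs, Real.rpow_ofNat, sq_abs]
  rw [← Real.rpow_natCast, ← Real.rpow_mul hnn]
  simp

/-- Two independent families of independent variables, independent of each other, pair up to a family
of independent variables. -/
theorem ProbabilityTheory.iIndepFun.prodMk_of_indepFun {Ω ι A B : Type*} [MeasurableSpace Ω]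
    [MeasurableSpace A] [MeasurableSpace B] {P : Measure Ω} [IsProbabilityMeasure P]
    {X : ι → Ω → A} {Y : ι → Ω → B}
    (mX : ∀ i, Measurable (X i)) (mY : ∀ i, Measurable (Y i)) (hX : iIndepFun X P)
    (hY : iIndepFun Y P) (hXY : IndepFun (fun ω i => X i ω) (fun ω i => Y i ω) P) :
    iIndepFun (fun i ω => (X i ω, Y i ω)) P := by
  classical
  let π : ι → Set (Set Ω) := fun i =>
    {s | ∃ a b, MeasurableSet a ∧ MeasurableSet b ∧ s = (X i ⁻¹' a) ∩ (Y i ⁻¹' b)}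
  have hm : ∀ i, Measurable (fun ω => (X i ω, Y i ω)) := fun i => (mX i).prodMk (mY i)
  rw [iIndepFun_iff_iIndep]
  refine iIndepSets.iIndep (fun i => (hm i).comap_le) π ?_ ?_ ?_
  · rintro i _ ⟨a, b, ha, hb, rfl⟩ _ ⟨a', b', ha', hb', rfl⟩ _
    exact ⟨a ∩ a', b ∩ b', ha.inter ha', hb.inter hb', by ext; simp; tauto⟩
  · intro i
    have h1 : (Prod.instMeasurableSpace : MeasurableSpace (A × B))
        = MeasurableSpace.generateFrom (Set.image2 (· ×ˢ ·) {s | MeasurableSet s}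
          {t | MeasurableSet t}) := generateFrom_prod.symm
    rw [h1, MeasurableSpace.comap_generateFrom]
    congr 1
    ext s
    constructor
    · rintro ⟨_, ⟨a, ha, b, hb, rfl⟩, rfl⟩
      exact ⟨a, b, ha, hb, by ext; simp⟩
    · rintro ⟨a, b, ha, hb, rfl⟩
      exact ⟨a ×ˢ b, ⟨a, ha, b, hb, rfl⟩, by ext; simp⟩
  · rw [iIndepSets_iff]
    intro s f hf
    choose! a b ha hb hab using hf
    have e1 : ⋂ i ∈ s, f i = ((fun ω i => X i ω) ⁻¹' (Set.pi s a)) ∩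
        ((fun ω i => Y i ω) ⁻¹' (Set.pi s b)) := by
      ext ω
      simp only [Set.mem_iInter, Set.mem_inter_iff, Set.mem_preimage, Set.mem_pi, Finset.mem_coe]
      constructor
      · intro h
        exact ⟨fun i hi => by have := h i hi; rw [hab i hi] at this; exact this.1,
          fun i hi => by have := h i hi; rw [hab i hi] at this; exact this.2⟩
      · rintro ⟨h, h'⟩ i hi
        rw [hab i hi]
        exact ⟨h i hi, h' i hi⟩
    have e2 : ((fun ω i => X i ω) ⁻¹' (Set.pi s a)) = ⋂ i ∈ s, X i ⁻¹' a i := by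
      ext; simp
    have e3 : ((fun ω i => Y i ω) ⁻¹' (Set.pi s b)) = ⋂ i ∈ s, Y i ⁻¹' b i := by
      ext; simp
    rw [e1, hXY.measure_inter_preimage_eq_mul _ _
      (MeasurableSet.pi s.countable_toSet fun i hi => ha i hi)
      (MeasurableSet.pi s.countable_toSet fun i hi => hb i hi), e2, e3,
      hX.meas_biInter (fun i hi => ⟨a i, ha i hi, rfl⟩),
      hY.meas_biInter (fun i hi => ⟨b i, hb i hi, rfl⟩), ← Finset.prod_mul_distrib]
    refine Finset.prod_congr rfl fun i hi => ?_
    rw [hab i hi]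
    have hi' : IndepFun (X i) (Y i) P :=
      hXY.comp (measurable_pi_apply i) (measurable_pi_apply i)
    rw [hi'.measure_inter_preimage_eq_mul _ _ (ha i hi) (hb i hi)]

section EfronStein

/-- Exchange the two components of a sequence of pairs at the indices in `I`. -/
def swapOn {ι E : Type*} [DecidableEq ι] (I : Finset ι) (w : ι → E × E) : ι → E × E :=
  fun i => if i ∈ I then (w i).swap else w i

theorem swapOn_swapOn {ι E : Type*} [DecidableEq ι] (I J : Finset ι) (w : ι → E × E) :
    swapOn I (swapOn J w) = swapOn (symmDiff I J) w := by
  funext i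
  simp only [swapOn, Finset.mem_symmDiff]
  by_cases h1 : i ∈ I <;> by_cases h2 : i ∈ J <;> simp [h1, h2]

theorem measurePreserving_fst_infinitePi {ι E : Type*} [MeasurableSpace E] (ν : Measure E)
    [IsProbabilityMeasure ν] :
    MeasurePreserving (fun (w : ι → E × E) i => (w i).1)
      (Measure.infinitePi fun _ : ι => ν.prod ν) (Measure.infinitePi fun _ : ι => ν) := by
  refine ⟨by fun_prop, ?_⟩
  rw [Measure.infinitePi_map_pi (fun _ : ι => ν.prod ν) (f := fun _ => Prod.fst)
    (fun _ => measurable_fst)]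
  congr 1
  funext i
  exact measurePreserving_fst.map_eq

theorem measurePreserving_snd_infinitePi {ι E : Type*} [MeasurableSpace E] (ν : Measure E)
    [IsProbabilityMeasure ν] :
    MeasurePreserving (fun (w : ι → E × E) i => (w i).2)
      (Measure.infinitePi fun _ : ι => ν.prod ν) (Measure.infinitePi fun _ : ι => ν) := by
  refine ⟨by fun_prop, ?_⟩
  rw [Measure.infinitePi_map_pi (fun _ : ι => ν.prod ν) (f := fun _ => Prod.snd)
    (fun _ => measurable_snd)]
  congr 1
  funext i
  exact measurePreserving_snd.map_eq

variable {ι E : Type*} [DecidableEq ι] [MeasurableSpace E]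

theorem measurable_swapOn (I : Finset ι) : Measurable (swapOn (E := E) I) := by
  refine measurable_pi_lambda _ fun i => ?_
  unfold swapOn
  split_ifs
  · exact measurable_swap.comp (measurable_pi_apply i)
  · exact measurable_pi_apply i

theorem measurePreserving_swapOn (ν : Measure E) [IsProbabilityMeasure ν] (I : Finset ι) :
    MeasurePreserving (swapOn I) (Measure.infinitePi fun _ : ι => ν.prod ν)
      (Measure.infinitePi fun _ : ι => ν.prod ν) := by
  refine ⟨measurable_swapOn I, ?_⟩
  have := Measure.infinitePi_map_pi (fun _ : ι => ν.prod ν)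
    (f := fun i => if i ∈ I then Prod.swap else id)
    (fun i => by split_ifs; exacts [measurable_swap, measurable_id])
  have e : (fun (x : ι → E × E) i => (if i ∈ I then Prod.swap else id) (x i)) = swapOn I := by
    funext x i
    simp only [swapOn]
    split_ifs <;> rfl
  rw [e] at this
  rw [this]
  congr 1
  funext i
  split_ifs
  · exact Measure.prod_swap
  · exact Measure.map_id

/-- Chatterjee's form of the Efron–Stein argument: resampling the coordinates in `I` one after the
other, each step costs at most the squared effect of resampling that coordinate alone, because
exchanging the two copies of a coordinate preserves the law. -/
theorem integral_sq_sub_swapOn_le (ν : Measure E) [IsProbabilityMeasure ν]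
    {f : (ι → E × E) → ℝ} (hf : MemLp f 2 (Measure.infinitePi fun _ : ι => ν.prod ν))
    (I : Finset ι) :
    ∫ w, (f w - f (swapOn I w)) ^ 2 ∂(Measure.infinitePi fun _ : ι => ν.prod ν)
      ≤ ∑ k ∈ I, ∫ w, (f w - f (swapOn {k} w)) ^ 2 ∂(Measure.infinitePi fun _ : ι => ν.prod ν) := by
  set Q := Measure.infinitePi fun _ : ι => ν.prod ν
  have hs : ∀ J : Finset ι, MemLp (fun w => f (swapOn J w)) 2 Q := fun J =>
    hf.comp_measurePreserving (measurePreserving_swapOn ν J)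
  have h0 : ∀ w : ι → E × E, swapOn ∅ w = w := fun w => by funext i; simp [swapOn]
  have hint : ∀ J K : Finset ι, Integrable (fun w => f (swapOn J w) * f (swapOn K w)) Q :=
    fun J K => (hs J).integrable_mul (hs K)
  have hinv : ∀ J K L : Finset ι, ∫ w, f (swapOn (symmDiff J L) w) * f (swapOn (symmDiff K L) w) ∂Q
      = ∫ w, f (swapOn J w) * f (swapOn K w) ∂Q := by
    intro J K L
    have hae : AEStronglyMeasurable (fun w => f (swapOn J w) * f (swapOn K w))
      (Measure.map (swapOn L) Q) := by
        rw [(measurePreserving_swapOn ν L).map_eq]; exact (hint J K).aestronglyMeasurable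
    have := integral_map (μ := Q) (measurable_swapOn L).aemeasurable hae
    rw [(measurePreserving_swapOn ν L).map_eq] at this
    rw [this]
    simp only [swapOn_swapOn]
  have hsq : ∀ J K : Finset ι, ∫ w, (f (swapOn J w) - f (swapOn K w)) ^ 2 ∂Q
      = 2 * (∫ w, f w * f w ∂Q - ∫ w, f (swapOn J w) * f (swapOn K w) ∂Q) := by
    intro J K
    have hJ : ∀ J, ∫ w, f (swapOn J w) * f (swapOn J w) ∂Q = ∫ w, f w * f w ∂Q := by
      intro J
      have := hinv ∅ ∅ J
      have e : symmDiff ∅ J = J := bot_symmDiff J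
      rw [e] at this
      simpa only [h0] using this
    have e : ∀ w, (f (swapOn J w) - f (swapOn K w)) ^ 2 = f (swapOn J w) * f (swapOn J w)
        + f (swapOn K w) * f (swapOn K w) - 2 * (f (swapOn J w) * f (swapOn K w)) := fun w => by ring
    simp_rw [e]
    rw [integral_sub ((hint J J).fun_add (hint K K)) ((hint J K).const_mul 2),
      integral_add (hint J J) (hint K K), integral_const_mul, hJ, hJ]
    ring
  have key : ∀ (J : Finset ι) (k : ι), k ∉ J →
      2 * (∫ w, f w * f (swapOn J w) ∂Q - ∫ w, f w * f (swapOn (insert k J) w) ∂Q)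
        ≤ ∫ w, (f w - f (swapOn {k} w)) ^ 2 ∂Q := by
    intro J k hk
    have d1 : symmDiff J {k} = insert k J := by
      ext i; simp only [Finset.mem_symmDiff, Finset.mem_singleton, Finset.mem_insert]
      by_cases hi : i = k
      · subst hi; simp [hk]
      · simp [hi]
    have d2 : symmDiff (insert k J) {k} = J := by rw [← d1]; simp
    have d3 : symmDiff ∅ ({k} : Finset ι) = {k} := by simp
    have d4 : symmDiff {k} J = insert k J := by rw [symmDiff_comm, d1]
    have a1 := hinv ∅ J {k}
    have a2 := hinv ∅ (insert k J) {k}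
    have a3 := hinv ∅ {k} J
    rw [d1, d3] at a1
    rw [d2, d3] at a2
    rw [d4] at a3
    simp only [Finset.bot_eq_empty.symm, bot_symmDiff] at a3
    simp only [Finset.bot_eq_empty] at a3
    simp only [h0] at a1 a2 a3
    have b1 := hsq ∅ {k}
    have b2 := hsq J (insert k J)
    simp only [h0] at b1
    have i0 := hint ∅ J
    have i1 := hint ∅ (insert k J)
    simp only [h0] at i0 i1
    have c1 : ∫ w, (f w - f (swapOn {k} w)) * (f (swapOn J w) - f (swapOn (insert k J) w)) ∂Q
        = 2 * (∫ w, f w * f (swapOn J w) ∂Q - ∫ w, f w * f (swapOn (insert k J) w) ∂Q) := by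
      have e : ∀ w, (f w - f (swapOn {k} w)) * (f (swapOn J w) - f (swapOn (insert k J) w))
        = (f w * f (swapOn J w) + f (swapOn {k} w) * f (swapOn (insert k J) w))
          - (f w * f (swapOn (insert k J) w) + f (swapOn {k} w) * f (swapOn J w)) :=
        fun w => by ring
      simp_rw [e]
      rw [integral_sub (i0.fun_add (hint _ _)) (i1.fun_add (hint _ _)), integral_add i0 (hint _ _),
        integral_add i1 (hint _ _), a1, a2]
      ring
    rw [← c1]
    have n1 : Integrable (fun w => (f w - f (swapOn {k} w)) ^ 2) Q := (hf.sub (hs {k})).integrable_sq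
    have n2 : Integrable (fun w => (f (swapOn J w) - f (swapOn (insert k J) w)) ^ 2) Q :=
      ((hs J).sub (hs _)).integrable_sq
    calc _ ≤ ∫ w, (1 / 2 : ℝ) * ((f w - f (swapOn {k} w)) ^ 2
          + (f (swapOn J w) - f (swapOn (insert k J) w)) ^ 2) ∂Q := by
          refine integral_mono ((hf.sub (hs {k})).integrable_mul ((hs J).sub (hs _)))
            ((n1.add n2).const_mul _) fun w => ?_
          nlinarith [sq_nonneg ((f w - f (swapOn {k} w))
            - (f (swapOn J w) - f (swapOn (insert k J) w)))]
      _ = ∫ w, (f w - f (swapOn {k} w)) ^ 2 ∂Q := by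
          rw [integral_const_mul, integral_add n1 n2, b1, b2, a3]; ring
  induction I using Finset.induction_on with
  | empty => simp [h0]
  | insert k J hk ih =>
    rw [Finset.sum_insert hk]
    have h1 := hsq ∅ J
    have h2 := hsq ∅ (insert k J)
    simp only [h0] at h1 h2
    have := key J k hk
    linarith

/-- **Efron–Stein inequality** for functions of infinitely many independent variables: the effect of
resampling all the variables is at most the sum of the effects of resampling one of them. -/
theorem lintegral_sq_sub_le_tsum [Countable ι] (ν : Measure E) [IsProbabilityMeasure ν]
    {s : (ι → E) → ℝ} (hs : MemLp s 2 (Measure.infinitePi fun _ : ι => ν)) :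
    eLpNorm (fun w : ι → E × E => s (fun i => (w i).1) - s (fun i => (w i).2)) 2
        (Measure.infinitePi fun _ : ι => ν.prod ν) ^ 2
      ≤ ∑' k, eLpNorm (fun w : ι → E × E =>
          s (fun i => (w i).1) - s (Function.update (fun i => (w i).1) k (w k).2)) 2
        (Measure.infinitePi fun _ : ι => ν.prod ν) ^ 2 := by
  set Q := Measure.infinitePi fun _ : ι => ν.prod ν with hQ
  set π := Measure.infinitePi fun _ : ι => ν with hπ
  set f : (ι → E × E) → ℝ := fun w => s (fun i => (w i).1) with hfdef
  have hf : MemLp f 2 Q := hs.comp_measurePreserving (measurePreserving_fst_infinitePi ν)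
  have hfs : ∀ I, MemLp (fun w => f (swapOn I w)) 2 Q := fun I =>
    hf.comp_measurePreserving (measurePreserving_swapOn ν I)
  have hsnd : MemLp (fun w : ι → E × E => s (fun i => (w i).2)) 2 Q :=
    hs.comp_measurePreserving (measurePreserving_snd_infinitePi ν)
  have hupd : ∀ (k : ι) (w : ι → E × E),
      s (Function.update (fun i => (w i).1) k (w k).2) = f (swapOn {k} w) := by
    intro k w
    simp only [hfdef]
    congr 1
    funext i
    by_cases hi : i = k
    · subst hi; simp [swapOn]
    · simp [swapOn, hi]
  simp_rw [hupd]
  set δ := fun k => eLpNorm (fun w => f w - f (swapOn {k} w)) 2 Q ^ 2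
  have hfin : ∀ I : Finset ι, eLpNorm (fun w => f w - f (swapOn I w)) 2 Q ^ 2 ≤ ∑' k, δ k := by
    intro I
    refine le_trans ?_ (ENNReal.sum_le_tsum I)
    have h1 := integral_sq_sub_swapOn_le ν hf I
    rw [eLpNorm_two_sq (f := fun w => f w - f (swapOn I w)) (hf.sub (hfs I))]
    refine (ENNReal.ofReal_le_ofReal h1).trans ?_
    rw [ENNReal.ofReal_sum_of_nonneg fun k _ => integral_nonneg fun w => sq_nonneg _]
    refine Finset.sum_le_sum fun k _ => ?_
    simp only [δ]
    rw [eLpNorm_two_sq (f := fun w => f w - f (swapOn {k} w)) (hf.sub (hfs {k}))]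
  obtain ⟨I, hI, hIu⟩ : ∃ I : ℕ → Finset ι, Monotone I ∧ ∀ i, ∃ n, i ∈ I n := by
    rcases isEmpty_or_nonempty ι with h | h
    · exact ⟨fun _ => ∅, monotone_const, fun i => (h.false i).elim⟩
    · obtain ⟨e, he⟩ := exists_surjective_nat ι
      refine ⟨fun n => (Finset.range (n + 1)).image e, fun a b hab => ?_, fun i => ?_⟩
      · exact Finset.image_subset_image (Finset.range_mono (by omega))
      · obtain ⟨n, rfl⟩ := he i
        exact ⟨n, Finset.mem_image_of_mem _ (by simp)⟩
  let ℱ : Filtration ℕ (MeasurableSpace.pi (X := fun _ : ι => E)) :=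
    ⟨fun n => Filtration.piFinset (X := fun _ : ι => E) (I n),
      fun a b hab => Filtration.piFinset.mono (hI hab), fun n => Filtration.piFinset.le _⟩
  have hsup : ⨆ n, ℱ n = MeasurableSpace.pi (X := fun _ : ι => E) := by
    refine le_antisymm (iSup_le fun n => ℱ.le n) ?_
    refine iSup_le fun i => ?_
    obtain ⟨n, hn⟩ := hIu i
    refine le_trans ?_ (le_iSup _ n)
    rintro _ ⟨t, ht, rfl⟩
    exact ⟨(fun x : I n → E => x ⟨i, hn⟩) ⁻¹' t, measurable_pi_apply _ ht, rfl⟩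
  -- Lévy's upward theorem: `s` is the limit of functions of finitely many coordinates
  have hlim : Tendsto (fun n => eLpNorm (π[s | ℱ n] - s) 1 π) atTop (𝓝 0) := by
    have hs' : Integrable s π := hs.integrable (by norm_num)
    have h := tendsto_eLpNorm_condExp (μ := π) (ℱ := ℱ) s
    refine h.congr fun n => eLpNorm_congr_ae ?_
    have : π[s | ⨆ n, ℱ n] =ᵐ[π] s := by
      rw [hsup]
      exact condExp_of_aestronglyMeasurable' le_rfl hs.1 hs'
    filter_upwards [this] with x hx
    simp [hx]
  have hlim2 : Tendsto (fun n => eLpNorm ((fun w => f (swapOn (I n) w))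
      - fun w : ι → E × E => s (fun i => (w i).2)) 1 Q) atTop (𝓝 0) := by
    have h2 : Tendsto (fun n => eLpNorm (π[s | ℱ n] - s) 1 π + eLpNorm (π[s | ℱ n] - s) 1 π)
      atTop (𝓝 0) := by simpa using hlim.add hlim
    refine tendsto_of_tendsto_of_tendsto_of_le_of_le tendsto_const_nhds h2 (fun n => zero_le)
      fun n => ?_
    have hgm : AEStronglyMeasurable (π[s | ℱ n] - s) π :=
      (stronglyMeasurable_condExp.mono (ℱ.le n)).aestronglyMeasurable.sub hs.1
    have hm1 : MeasurePreserving (fun (w : ι → E × E) i => (swapOn (I n) w i).1) Q π :=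
      (measurePreserving_fst_infinitePi ν).comp (measurePreserving_swapOn ν (I n))
    have hm2 := measurePreserving_snd_infinitePi (ι := ι) ν
    have hdep : ∀ w : ι → E × E, (π[s | ℱ n]) (fun i => (swapOn (I n) w i).1)
        = (π[s | ℱ n]) (fun i => (w i).2) := by
      intro w
      have hd : DependsOn (π[s | ℱ n]) (I n : Set ι) :=
        StronglyMeasurable.dependsOn_of_piFinset (f := π[s | ℱ n]) stronglyMeasurable_condExp
      refine hd fun i hi => ?_
      have : i ∈ I n := hi
      simp [swapOn, this]
    have e : ((fun w => f (swapOn (I n) w)) - fun w : ι → E × E => s (fun i => (w i).2))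
        = (π[s | ℱ n] - s) ∘ (fun w : ι → E × E => fun i => (w i).2)
          - (π[s | ℱ n] - s) ∘ (fun w : ι → E × E => fun i => (swapOn (I n) w i).1) := by
      funext w
      simp only [Pi.sub_apply, Function.comp_apply, hdep, hfdef]
      ring
    rw [e]
    refine (eLpNorm_sub_le (hgm.comp_measurePreserving hm2) (hgm.comp_measurePreserving hm1)
      le_rfl).trans ?_
    rw [eLpNorm_comp_measurePreserving hgm hm2, eLpNorm_comp_measurePreserving hgm hm1]
  have hmeas := tendstoInMeasure_of_tendsto_eLpNorm one_ne_zero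
    (fun n => (hfs (I n)).1) hsnd.1 hlim2
  -- Exchanging more and more variables tends to exchanging all; the bound survives by Fatou.
  obtain ⟨ns, _, hns⟩ := hmeas.exists_seq_tendsto_ae
  have hfatou := Lp.eLpNorm_lim_le_liminf_eLpNorm (p := 2) (μ := Q)
    (f := fun n => fun w => f w - f (swapOn (I (ns n)) w))
    (fun n => (hf.sub (hfs _)).1) (fun w => f w - s (fun i => (w i).2))
    (hns.mono fun w hw => tendsto_const_nhds.sub hw)
  have hroot : ∀ I : Finset ι, eLpNorm (fun w => f w - f (swapOn I w)) 2 Q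
      ≤ (∑' k, δ k) ^ (1 / 2 : ℝ) := by
    intro I
    rw [← ENNReal.rpow_le_rpow_iff (z := 2) (by norm_num), ← ENNReal.rpow_mul]
    simpa using hfin I
  have h3 : eLpNorm (fun w => f w - s (fun i => (w i).2)) 2 Q ≤ (∑' k, δ k) ^ (1 / 2 : ℝ) := by
    refine hfatou.trans (liminf_le_of_le (by isBoundedDefault) fun b hb => ?_)
    obtain ⟨n, hn⟩ := hb.exists
    exact hn.trans (hroot _)
  rw [← ENNReal.rpow_le_rpow_iff (z := 2) (by norm_num), ← ENNReal.rpow_mul] at h3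
  simpa using h3

end EfronStein

/-! ### The input process: stationarity, independence and a variance bound -/

namespace PLSProcess

/-- The pair of histories `(F_{k-1}, G_k)`, read off a two-sided sequence of joint inputs. -/
def pastOf {A B : Type*} (k : ℤ) (x : ℤ → A × B) : (ℕ → A) × (ℕ → B) :=
  (fun j => (x (k - 1 - j)).1, fun j => (x (k - j)).2)

theorem pastOf_shift {A B : Type*} (i k : ℤ) (x : ℤ → A × B) :
    pastOf (i - k) (fun l => x (l + k)) = pastOf i x := by
  have h1 : ∀ j : ℕ, i - k - 1 - (j : ℤ) + k = i - 1 - j := fun j => by ring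
  have h2 : ∀ j : ℕ, i - k - (j : ℤ) + k = i - j := fun j => by ring
  simp only [pastOf, h1, h2]

variable {Ω A B : Type*} [MeasurableSpace Ω] [MeasurableSpace A] [MeasurableSpace B]
  {P : Measure Ω} {p R : ℕ}

/-- The joint input `(η_k, ζ_k)` at time `k`. -/
def input (m : PLSProcess Ω A B P p R) (k : ℤ) (ω : Ω) : A × B := (m.η k ω, m.ζ k ω)

/-- The pair of histories `(F_{k-1}, G_k)`. -/
def past (m : PLSProcess Ω A B P p R) (k : ℤ) (ω : Ω) : (ℕ → A) × (ℕ → B) :=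
  (history m.η (k - 1) ω, history m.ζ k ω)

/-- The pair of histories `(F_{k-1}^*, G_k^*)`. -/
def pastStar (m : PLSProcess Ω A B P p R) (k : ℤ) (w : Ω × Ω) : (ℕ → A) × (ℕ → B) :=
  (historyStar m.η (k - 1) w, historyStar m.ζ k w)

theorem measurable_pastOf (k : ℤ) : Measurable (pastOf (A := A) (B := B) k) := by
  unfold pastOf; fun_prop

theorem measurable_input (m : PLSProcess Ω A B P p R) (k : ℤ) : Measurable (m.input k) :=
  (m.measurable_η k).prodMk (m.measurable_ζ k)

/-- The coupled past is the past of the input sequence whose entry at time `0` is exchanged. -/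
theorem pastStar_eq (m : PLSProcess Ω A B P p R) (k : ℤ) (w : Ω × Ω) :
    m.pastStar k w
      = pastOf k (Function.update (fun j => m.input j w.1) 0 (m.input 0 w.2)) := by
  refine Prod.ext ?_ ?_ <;> funext j
  · by_cases h : k - 1 - (j : ℤ) = 0
    · simp [pastStar, historyStar, pastOf, h, input]
    · simp [pastStar, historyStar, pastOf, h, input]
  · by_cases h : k - (j : ℤ) = 0
    · simp [pastStar, historyStar, pastOf, h, input]
    · simp [pastStar, historyStar, pastOf, h, input]

theorem measurable_past (m : PLSProcess Ω A B P p R) (k : ℤ) : Measurable (m.past k) :=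
  (measurable_pastOf k).comp (measurable_pi_lambda _ fun j => m.measurable_input j)

theorem measurePreserving_shift {E : Type*} [MeasurableSpace E] (ν : Measure E)
    [IsProbabilityMeasure ν] (k : ℤ) :
    MeasurePreserving (fun (x : ℤ → E) l => x (l + k)) (Measure.infinitePi fun _ => ν)
      (Measure.infinitePi fun _ => ν) :=
  ⟨by fun_prop, Measure.map_infinitePi_infinitePi_of_inj (P := fun _ : ℤ => ν)
    (add_left_injective k)⟩

variable [IsProbabilityMeasure P]

theorem map_input (m : PLSProcess Ω A B P p R) (k : ℤ) : P.map (m.input k) = P.map (m.input 0) := by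
  have h : ∀ k, P.map (m.input k) = (P.map (m.η 0)).prod (P.map (m.ζ 0)) := by
    intro k
    have hi : IndepFun (m.η k) (m.ζ k) P :=
      m.indepFun_η_ζ.comp (measurable_pi_apply k) (measurable_pi_apply k)
    have := (indepFun_iff_map_prod_eq_prod_map_map (m.measurable_η k).aemeasurable
      (m.measurable_ζ k).aemeasurable).1 hi
    rw [← (m.identDistrib_η k).map_eq, ← (m.identDistrib_ζ k).map_eq]
    exact this
  rw [h k, h 0]

theorem measurePreserving_input (m : PLSProcess Ω A B P p R) :
    MeasurePreserving (fun ω j => m.input j ω) P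
      (Measure.infinitePi fun _ : ℤ => P.map (m.input 0)) := by
  refine ⟨measurable_pi_lambda _ fun j => m.measurable_input j, ?_⟩
  have hi : iIndepFun m.input P := iIndepFun.prodMk_of_indepFun m.measurable_η m.measurable_ζ
    m.iIndepFun_η m.iIndepFun_ζ m.indepFun_η_ζ
  rw [(iIndepFun_iff_map_fun_eq_infinitePi_map m.measurable_input).1 hi]
  congr 1
  funext k
  exact m.map_input k

/-- Under `P.prod P` the input sequence and its copy form a sequence of independent pairs, which is
the setting of the Efron–Stein inequality. -/
theorem measurePreserving_input_pair (m : PLSProcess Ω A B P p R) :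
    MeasurePreserving (fun (w : Ω × Ω) j => (m.input j w.1, m.input j w.2)) (P.prod P)
      (Measure.infinitePi fun _ : ℤ => (P.map (m.input 0)).prod (P.map (m.input 0))) := by
  have hmeas : ∀ j, Measurable fun w : Ω × Ω => (m.input j w.1, m.input j w.2) := fun j =>
    ((m.measurable_input j).comp measurable_fst).prodMk ((m.measurable_input j).comp measurable_snd)
  refine ⟨measurable_pi_lambda _ hmeas, ?_⟩
  have hi : iIndepFun m.input P := iIndepFun.prodMk_of_indepFun m.measurable_η m.measurable_ζ
    m.iIndepFun_η m.iIndepFun_ζ m.indepFun_η_ζ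
  have hfun := (iIndepFun_iff_map_fun_eq_infinitePi_map m.measurable_input).1 hi
  have h1 : iIndepFun (fun j (w : Ω × Ω) => m.input j w.1) (P.prod P) := by
    rw [iIndepFun_iff_map_fun_eq_infinitePi_map (X := fun j (w : Ω × Ω) => m.input j w.1)
      fun j => (m.measurable_input j).comp measurable_fst]
    have := (m.measurePreserving_input.comp (measurePreserving_fst (μ := P) (ν := P))).map_eq
    refine Eq.trans this ?_
    congr 1
    funext j
    rw [← m.map_input j]
    exact ((⟨m.measurable_input j, rfl⟩ : MeasurePreserving (m.input j) P (P.map (m.input j))).comp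
      (measurePreserving_fst (μ := P) (ν := P))).map_eq.symm
  have h2 : iIndepFun (fun j (w : Ω × Ω) => m.input j w.2) (P.prod P) := by
    rw [iIndepFun_iff_map_fun_eq_infinitePi_map (X := fun j (w : Ω × Ω) => m.input j w.2)
      fun j => (m.measurable_input j).comp measurable_snd]
    have := (m.measurePreserving_input.comp (measurePreserving_snd (μ := P) (ν := P))).map_eq
    refine Eq.trans this ?_
    congr 1
    funext j
    rw [← m.map_input j]
    exact ((⟨m.measurable_input j, rfl⟩ : MeasurePreserving (m.input j) P (P.map (m.input j))).comp
      (measurePreserving_snd (μ := P) (ν := P))).map_eq.symm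
  have h3 : IndepFun (fun (w : Ω × Ω) j => m.input j w.1) (fun (w : Ω × Ω) j => m.input j w.2)
      (P.prod P) :=
    indepFun_prod (measurable_pi_lambda _ fun j => m.measurable_input j)
      (measurable_pi_lambda _ fun j => m.measurable_input j)
  have h4 := iIndepFun.prodMk_of_indepFun (fun j => (m.measurable_input j).comp measurable_fst)
    (fun j => (m.measurable_input j).comp measurable_snd) h1 h2 h3
  refine ((iIndepFun_iff_map_fun_eq_infinitePi_map hmeas).1 h4).trans ?_
  congr 1
  funext j
  rw [← m.map_input j]
  exact (Measure.map_prod_map P P (m.measurable_input j) (m.measurable_input j)).symm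

/-- Stationarity of the histories. -/
theorem map_past (m : PLSProcess Ω A B P p R) (k : ℤ) : P.map (m.past k) = P.map (m.past 0) := by
  have : IsProbabilityMeasure (P.map (m.input 0)) :=
    Measure.isProbabilityMeasure_map (m.measurable_input 0).aemeasurable
  have h : ∀ k, P.map (m.past k)
      = (Measure.infinitePi fun _ : ℤ => P.map (m.input 0)).map (pastOf k) := by
    intro k
    rw [← m.measurePreserving_input.map_eq,
      Measure.map_map (measurable_pastOf k) m.measurePreserving_input.measurable]
    rfl
  rw [h k, h 0, ← (measurePreserving_shift (P.map (m.input 0)) k).map_eq,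
    Measure.map_map (measurable_pastOf 0) (measurePreserving_shift (P.map (m.input 0)) k).measurable,
    (measurePreserving_shift (P.map (m.input 0)) k).map_eq]
  congr 1
  funext x
  simpa using (pastOf_shift k k x).symm

theorem measurePreserving_past (m : PLSProcess Ω A B P p R) (k : ℤ) :
    MeasurePreserving (m.past k) P (P.map (m.past 0)) :=
  ⟨m.measurable_past k, m.map_past k⟩

/-- The coupled past has the law of the past. -/
theorem measurePreserving_pastStar (m : PLSProcess Ω A B P p R) (k : ℤ) :
    MeasurePreserving (m.pastStar k) (P.prod P) (P.map (m.past 0)) := by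
  have : IsProbabilityMeasure (P.map (m.input 0)) :=
    Measure.isProbabilityMeasure_map (m.measurable_input 0).aemeasurable
  have h1 := ((measurePreserving_fst_infinitePi (P.map (m.input 0))).comp
    (measurePreserving_swapOn (P.map (m.input 0)) {(0 : ℤ)})).comp m.measurePreserving_input_pair
  have h2 : MeasurePreserving (pastOf k) (Measure.infinitePi fun _ : ℤ => P.map (m.input 0))
      (P.map (m.past 0)) := by
    refine ⟨measurable_pastOf k, ?_⟩
    rw [← m.map_past k, ← m.measurePreserving_input.map_eq,
      Measure.map_map (measurable_pastOf k) m.measurePreserving_input.measurable]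
    rfl
  have h3 := h2.comp h1
  convert h3 using 1
  funext w
  rw [m.pastStar_eq]
  simp only [Function.comp_apply]
  congr 1
  funext i
  by_cases hi : i = 0
  · subst hi; simp [swapOn]
  · simp [swapOn, hi]

/-- The input `η_k` is independent of `(F_{k-1}, G_k)`. -/
theorem measurePreserving_η_past (m : PLSProcess Ω A B P p R) (k : ℤ) :
    MeasurePreserving (fun ω => (m.η k ω, m.past k ω)) P
      ((P.map (m.η 0)).prod (P.map (m.past 0))) := by
  refine ⟨(m.measurable_η k).prodMk (m.measurable_past k), ?_⟩
  have mF : ∀ k, Measurable (history m.η k) := fun k =>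
    measurable_pi_lambda _ fun j => m.measurable_η _
  have mG : ∀ k, Measurable (history m.ζ k) := fun k =>
    measurable_pi_lambda _ fun j => m.measurable_ζ _
  have i1 : IndepFun (m.η k) (history m.η (k - 1)) P := by
    have hind := (iIndepFun_iff_iIndep _ _ _).1 m.iIndepFun_η
    have := indep_iSup_of_disjoint (fun i => (m.measurable_η i).comap_le) hind
      (S := {k}) (T := {i | i < k}) (by simp)
    rw [IndepFun_iff_Indep]
    refine indep_of_indep_of_le_left (indep_of_indep_of_le_right this ?_) (by simp)
    refine Measurable.comap_le ?_
    refine @measurable_pi_lambda Ω ℕ (fun _ => A)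
      (⨆ i ∈ {i | i < k}, MeasurableSpace.comap (m.η i) inferInstance) _ _ fun j => ?_
    have hj : k - 1 - (j : ℤ) ∈ {i | i < k} := by simp; omega
    exact (comap_measurable (m.η (k - 1 - j))).mono
      (le_iSup₂_of_le (f := fun i (_ : i ∈ {i | i < k}) => MeasurableSpace.comap (m.η i) _)
        _ hj le_rfl) le_rfl
  have i2 : IndepFun (fun ω => (m.η k ω, history m.η (k - 1) ω)) (history m.ζ k) P :=
    m.indepFun_η_ζ.comp (φ := fun x : ℤ → A => (x k, fun j : ℕ => x (k - 1 - j)))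
      (ψ := fun (x : ℤ → B) (j : ℕ) => x (k - j)) (by fun_prop) (by fun_prop)
  have i3 : IndepFun (history m.η (k - 1)) (history m.ζ k) P :=
    m.indepFun_η_ζ.comp (φ := fun (x : ℤ → A) (j : ℕ) => x (k - 1 - j))
      (ψ := fun (x : ℤ → B) (j : ℕ) => x (k - j)) (by fun_prop) (by fun_prop)
  have e1 := (indepFun_iff_map_prod_eq_prod_map_map (m.measurable_η k).aemeasurable
    (mF (k - 1)).aemeasurable).1 i1
  have e2 := (indepFun_iff_map_prod_eq_prod_map_map
    ((m.measurable_η k).prodMk (mF (k - 1))).aemeasurable (mG k).aemeasurable).1 i2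
  have e3 := (indepFun_iff_map_prod_eq_prod_map_map (mF (k - 1)).aemeasurable
    (mG k).aemeasurable).1 i3
  have : IsProbabilityMeasure (P.map (m.η k)) :=
    Measure.isProbabilityMeasure_map (m.measurable_η k).aemeasurable
  have : IsProbabilityMeasure (P.map (history m.η (k - 1))) :=
    Measure.isProbabilityMeasure_map (mF _).aemeasurable
  have : IsProbabilityMeasure (P.map (history m.ζ k)) :=
    Measure.isProbabilityMeasure_map (mG _).aemeasurable
  rw [← m.map_past k, ← (m.identDistrib_η k).map_eq]
  have e4 : P.map (m.past k) = _ := e3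
  rw [e4, ← Measure.prodAssoc_prod, ← e1, ← e2, Measure.map_map (by fun_prop)
    (((m.measurable_η k).prodMk (mF (k - 1))).prodMk (mG k))]
  rfl

/-- The sum of the effects of the input at time `k` on the variables at times `i ∈ s`, summed in
square over `k`. -/
theorem tsum_sq_sum_le (a : ℕ → ℝ≥0∞) (s : Finset ℕ) :
    ∑' k : ℤ, (∑ i ∈ s, if k ≤ (i : ℤ) then a ((i : ℤ) - k).toNat else 0) ^ 2
      ≤ s.card * (∑' j, a j) ^ 2 := by
  set S := ∑' j, a j
  have h1 : ∀ k : ℤ, ∑ i ∈ s, (if k ≤ (i : ℤ) then a ((i : ℤ) - k).toNat else 0) ≤ S := by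
    intro k
    rw [← Finset.sum_filter, ← Finset.sum_image (f := a) (g := fun i : ℕ => ((i : ℤ) - k).toNat)]
    · exact ENNReal.sum_le_tsum _
    · intro x hx y hy hxy
      simp only [Finset.coe_filter, Set.mem_ofPred_eq] at hx hy
      have hxy' : ((x : ℤ) - k).toNat = ((y : ℤ) - k).toNat := hxy
      omega
  have h2 : ∀ i : ℕ, ∑' k : ℤ, (if k ≤ (i : ℤ) then a ((i : ℤ) - k).toNat else 0) = S := by
    intro i
    rw [← (Equiv.subLeft (i : ℤ)).tsum_eq]
    have : ∀ c : ℤ, (if (Equiv.subLeft (i : ℤ)) c ≤ (i : ℤ)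
        then a ((i : ℤ) - (Equiv.subLeft (i : ℤ)) c).toNat else 0)
        = if 0 ≤ c then a c.toNat else 0 := by
      intro c
      simp only [Equiv.subLeft_apply, sub_sub_cancel]
      congr 1
      simp
    simp_rw [this]
    rw [← (Nat.cast_injective (R := ℤ)).tsum_eq (f := fun c : ℤ => if 0 ≤ c then a c.toNat else 0)]
    · simp [S]
    · intro c hc
      have : 0 ≤ c := by
        by_contra h
        simp [h] at hc
      exact ⟨c.toNat, by simp [this]⟩
  calc _ ≤ ∑' k : ℤ, S * ∑ i ∈ s, (if k ≤ (i : ℤ) then a ((i : ℤ) - k).toNat else 0) := by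
        refine ENNReal.tsum_le_tsum fun k => ?_
        rw [sq]
        gcongr
        exact h1 k
    _ = S * ∑ i ∈ s, ∑' k : ℤ, (if k ≤ (i : ℤ) then a ((i : ℤ) - k).toNat else 0) := by
        rw [ENNReal.tsum_mul_left, Summable.tsum_finsetSum fun _ _ => ENNReal.summable]
    _ = _ := by
        simp_rw [h2]
        rw [Finset.sum_const, nsmul_eq_mul]; ring

/-- **Variance bound under short-range dependence.** If the effect of the input at time `0` on the
`i`-th function evaluated at time `k` is at most `a k` in `L²`, then the variance of the sum of `N`
terms is at most `N (∑ a)²`. -/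
theorem eLpNorm_sum_sub_integral_sq_le (m : PLSProcess Ω A B P p R)
    {g : ℕ → (ℕ → A) × (ℕ → B) → ℝ} {s : Finset ℕ} (hgm : ∀ i ∈ s, Measurable (g i))
    (hg : ∀ i ∈ s, MemLp (g i) 2 (P.map (m.past 0)))
    {a : ℕ → ℝ≥0∞} (ha : ∀ i ∈ s, ∀ k : ℕ,
      eLpNorm (fun w => g i (m.past k w.1) - g i (m.pastStar k w)) 2 (P.prod P) ≤ a k) :
    eLpNorm (fun ω => ∑ i ∈ s, g i (m.past i ω) - ∫ ω', ∑ i ∈ s, g i (m.past i ω') ∂P) 2 P ^ 2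
      ≤ s.card * (∑' k, a k) ^ 2 := by
  set ν := P.map (m.input 0) with hν
  have hνp : IsProbabilityMeasure ν :=
    Measure.isProbabilityMeasure_map (m.measurable_input 0).aemeasurable
  set Q := Measure.infinitePi fun _ : ℤ => ν.prod ν with hQ
  set S : Ω → ℝ := fun ω => ∑ i ∈ s, g i (m.past i ω) with hS
  set f : (ℤ → A × B) → ℝ := fun x => ∑ i ∈ s, g i (pastOf i x) with hf
  have mpo : ∀ k : ℤ, MeasurePreserving (pastOf k) (Measure.infinitePi fun _ : ℤ => ν)
      (P.map (m.past 0)) := by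
    intro k
    refine ⟨measurable_pastOf k, ?_⟩
    rw [← m.map_past k, ← m.measurePreserving_input.map_eq,
      Measure.map_map (measurable_pastOf k) m.measurePreserving_input.measurable]
    rfl
  have hSL : MemLp S 2 P := memLp_finsetSum _ fun i hi =>
    (hg i hi).comp_measurePreserving (m.measurePreserving_past i)
  have hfL : MemLp f 2 (Measure.infinitePi fun _ : ℤ => ν) := memLp_finsetSum _ fun i hi =>
    (hg i hi).comp_measurePreserving (mpo i)
  have hES := lintegral_sq_sub_le_tsum ν hfL
  have hmp := m.measurePreserving_input_pair
  -- one resampled input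
  have hone : ∀ k : ℤ, eLpNorm (fun w : ℤ → (A × B) × (A × B) =>
      f (fun i => (w i).1) - f (Function.update (fun i => (w i).1) k (w k).2)) 2 Q
      ≤ ∑ i ∈ s, if k ≤ (i : ℤ) then a ((i : ℤ) - k).toNat else 0 := by
    intro k
    set d : ℕ → (ℤ → (A × B) × (A × B)) → ℝ := fun i w =>
      g i (pastOf i fun l => (w l).1) - g i (pastOf i (Function.update (fun l => (w l).1) k (w k).2))
      with hd
    have mupd : ∀ k : ℤ, Measurable fun w : ℤ → (A × B) × (A × B) =>
        Function.update (fun l => (w l).1) k (w k).2 := by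
      intro k
      refine measurable_pi_lambda _ fun l => ?_
      by_cases hl : l = k
      · subst hl; simp only [Function.update_self]; fun_prop
      · simp only [ne_eq, hl, not_false_eq_true, Function.update_of_ne]; fun_prop
    have md : ∀ i ∈ s, Measurable (d i) := fun i hi =>
      ((hgm i hi).comp ((measurable_pastOf _).comp (by fun_prop))).sub
        ((hgm i hi).comp ((measurable_pastOf _).comp (mupd k)))
    have e : (fun w : ℤ → (A × B) × (A × B) =>
        f (fun i => (w i).1) - f (Function.update (fun i => (w i).1) k (w k).2))
        = ∑ i ∈ s, d i := by
      funext w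
      simp only [hf, hd, Finset.sum_apply, Finset.sum_sub_distrib]
    rw [e]
    refine (eLpNorm_sum_le (fun i hi => (md i hi).aestronglyMeasurable) one_le_two).trans ?_
    refine Finset.sum_le_sum fun i hi => ?_
    split_ifs with hik
    · -- shift the resampled time to the origin
      have hsh := measurePreserving_shift (ν.prod ν) k
      set d0 : (ℤ → (A × B) × (A × B)) → ℝ := fun w =>
        g i (pastOf (i - k) fun l => (w l).1)
          - g i (pastOf (i - k) (Function.update (fun l => (w l).1) 0 (w 0).2)) with hd0
      have md0 : Measurable d0 :=
        ((hgm i hi).comp ((measurable_pastOf _).comp (by fun_prop))).sub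
          ((hgm i hi).comp ((measurable_pastOf _).comp (mupd 0)))
      have e1 : d i = d0 ∘ fun (x : ℤ → (A × B) × (A × B)) l => x (l + k) := by
        funext w
        simp only [hd, hd0, Function.comp_apply]
        rw [pastOf_shift i k fun l => (w l).1]
        congr 2
        rw [← pastOf_shift i k (Function.update (fun l => (w l).1) k (w k).2)]
        congr 1
        funext l
        by_cases hl : l = 0
        · subst hl; simp
        · simp [hl]
      rw [e1, eLpNorm_comp_measurePreserving md0.aestronglyMeasurable hsh,
        ← eLpNorm_comp_measurePreserving md0.aestronglyMeasurable hmp]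
      have hk : (((i : ℤ) - k).toNat : ℤ) = i - k := by omega
      have h := ha i hi ((i : ℤ) - k).toNat
      rw [hk] at h
      refine le_trans (le_of_eq ?_) h
      congr 1
      funext w
      simp only [hd0, Function.comp_apply, m.pastStar_eq]
      rfl
    · have e1 : d i = 0 := by
        funext w
        have : pastOf (i : ℤ) (Function.update (fun l => (w l).1) k (w k).2)
            = pastOf (i : ℤ) fun l => (w l).1 := by
          refine Prod.ext ?_ ?_ <;> funext j
          · have : (i : ℤ) - 1 - j ≠ k := by omega
            simp [pastOf, this]
          · have : (i : ℤ) - j ≠ k := by omega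
            simp [pastOf, this]
        simp [hd, this]
      simp [e1]
  have hpair : eLpNorm (fun w : Ω × Ω => S w.1 - S w.2) 2 (P.prod P) ^ 2
      ≤ s.card * (∑' k, a k) ^ 2 := by
    have e : (fun w : Ω × Ω => S w.1 - S w.2) = (fun w : ℤ → (A × B) × (A × B) =>
        f (fun i => (w i).1) - f (fun i => (w i).2))
          ∘ (fun (w : Ω × Ω) j => (m.input j w.1, m.input j w.2)) := by
      funext w; simp only [hS, hf, Function.comp_apply]; rfl
    have hme : AEStronglyMeasurable (fun w : ℤ → (A × B) × (A × B) =>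
        f (fun i => (w i).1) - f (fun i => (w i).2)) Q :=
      (hfL.comp_measurePreserving (measurePreserving_fst_infinitePi ν)).1.sub
        (hfL.comp_measurePreserving (measurePreserving_snd_infinitePi ν)).1
    rw [e, eLpNorm_comp_measurePreserving hme hmp]
    refine hES.trans (le_trans ?_ (tsum_sq_sum_le a s))
    exact ENNReal.tsum_le_tsum fun k => by gcongr; exact hone k
  -- the variance is half the mean squared difference of two independent copies
  have hS1 : MemLp (fun w : Ω × Ω => S w.1) 2 (P.prod P) :=
    hSL.comp_measurePreserving measurePreserving_fst
  have hS2 : MemLp (fun w : Ω × Ω => S w.2) 2 (P.prod P) :=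
    hSL.comp_measurePreserving measurePreserving_snd
  refine le_trans ?_ hpair
  rw [eLpNorm_two_sq (f := fun ω => S ω - ∫ ω', S ω' ∂P) (hSL.sub (memLp_const _)),
    eLpNorm_two_sq (f := fun w : Ω × Ω => S w.1 - S w.2) (hS1.sub hS2)]
  refine ENNReal.ofReal_le_ofReal ?_
  set c := ∫ ω', S ω' ∂P with hc
  have hSi : Integrable S P := hSL.integrable one_le_two
  have hi1 : Integrable (fun ω => (S ω - c) ^ 2) P := (hSL.sub (memLp_const c)).integrable_sq
  have hi0 : Integrable (fun ω => S ω - c) P := hSi.sub (integrable_const c)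
  have e1 : ∫ w, (S w.1 - S w.2) ^ 2 ∂(P.prod P)
      = ∫ ω, (S ω - c) ^ 2 ∂P + ∫ ω, (S ω - c) ^ 2 ∂P := by
    have hp : ∀ w : Ω × Ω, (S w.1 - S w.2) ^ 2
        = ((S w.1 - c) ^ 2 + (S w.2 - c) ^ 2) - 2 * ((S w.1 - c) * (S w.2 - c)) :=
      fun w => by ring
    simp_rw [hp]
    rw [integral_sub ((hi1.comp_fst P).fun_add (hi1.comp_snd P))
      ((hi0.mul_prod hi0).const_mul 2),
      integral_add (hi1.comp_fst P) (hi1.comp_snd P), integral_const_mul,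
      integral_prod_mul (fun ω => S ω - c) (fun ω => S ω - c), integral_sub hSi (integrable_const c),
      integral_fun_fst (fun ω => (S ω - c) ^ 2), integral_fun_snd (fun ω => (S ω - c) ^ 2)]
    simp [hc]
  rw [e1]
  have : 0 ≤ ∫ ω, (S ω - c) ^ 2 ∂P := integral_nonneg fun ω => sq_nonneg _
  linarith

end PLSProcess

/-! ### Derivatives of families of distribution functions -/

/-- For a right-continuous function, the derivative is determined by the difference quotients with
rational increments. -/
theorem hasDerivAt_iff_tendsto_rat {F : ℝ → ℝ} (hF : ∀ x, ContinuousWithinAt F (Set.Ici x) x)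
    (x₀ d : ℝ) :
    HasDerivAt F d x₀ ↔ Tendsto (fun q : ℚ => (q : ℝ)⁻¹ • (F (x₀ + q) - F x₀))
      (comap (fun q : ℚ => (q : ℝ)) (𝓝[≠] 0)) (𝓝 d) := by
  rw [hasDerivAt_iff_tendsto_slope_zero]
  refine ⟨fun h => h.comp tendsto_comap, fun h => ?_⟩
  rw [Metric.tendsto_nhds] at h ⊢
  intro ε hε
  have h1 := h (ε / 2) (by positivity)
  rw [eventually_comap, eventually_nhdsWithin_iff, Metric.eventually_nhds_iff] at h1
  obtain ⟨δ, hδ, h1⟩ := h1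
  rw [eventually_nhdsWithin_iff, Metric.eventually_nhds_iff]
  refine ⟨δ, hδ, fun t ht ht0 => ?_⟩
  have ht0' : t ≠ 0 := ht0
  have hcont : ContinuousWithinAt (fun s : ℝ => s⁻¹ • (F (x₀ + s) - F x₀)) (Set.Ici t) t := by
    refine ContinuousWithinAt.smul (continuousAt_inv₀ ht0').continuousWithinAt ?_
    refine ContinuousWithinAt.sub ?_ continuousWithinAt_const
    refine (hF (x₀ + t)).comp (by fun_prop) fun s hs => ?_
    simpa using hs
  rw [Metric.continuousWithinAt_iff] at hcont
  obtain ⟨δ', hδ', hc⟩ := hcont (ε / 2) (by positivity)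
  rw [Real.dist_0_eq_abs] at ht
  have hpos : t < min (t + δ') (if 0 < t then δ else 0) := by
    rw [lt_min_iff]
    refine ⟨by linarith, ?_⟩
    split_ifs with h0
    · exact (le_abs_self t).trans_lt ht
    · exact lt_of_le_of_ne (not_lt.1 h0) ht0'
  obtain ⟨q, hq1, hq2⟩ := exists_rat_btwn hpos
  rw [lt_min_iff] at hq2
  have hq0 : (q : ℝ) ≠ 0 ∧ |(q : ℝ)| < δ := by
    split_ifs at hq2 with h0
    · exact ⟨by linarith, by rw [abs_of_pos (by linarith)]; exact hq2.2⟩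
    · have h2 := hq2.2
      refine ⟨h2.ne, ?_⟩
      rw [abs_of_neg h2]
      have : -(q : ℝ) < -t := by linarith
      exact this.trans_le ((neg_le_abs t).trans ht.le)
  have a1 := h1 (by rw [Real.dist_0_eq_abs]; exact hq0.2) hq0.1 q rfl
  have a2 := hc (x := (q : ℝ)) hq1.le (by rw [Real.dist_eq, abs_of_pos (by linarith)]; linarith)
  calc dist (t⁻¹ • (F (x₀ + t) - F x₀)) d
      ≤ dist (t⁻¹ • (F (x₀ + t) - F x₀)) ((q : ℝ)⁻¹ • (F (x₀ + q) - F x₀))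
        + dist ((q : ℝ)⁻¹ • (F (x₀ + q) - F x₀)) d := dist_triangle _ _ _
    _ < ε / 2 + ε / 2 := by rw [dist_comm] at a2; exact add_lt_add a2 a1
    _ = ε := by ring

/-- The derivative is measurable in the parameter even where the function is not differentiable:
right continuity lets the difference quotients run through rational increments only. -/
theorem measurable_deriv_of_continuousWithinAt_Ici {α : Type*} [MeasurableSpace α] {F : α → ℝ → ℝ}
    (hm : ∀ x, Measurable fun a => F a x)
    (hF : ∀ a x, ContinuousWithinAt (F a) (Set.Ici x) x) (x₀ : ℝ) :
    Measurable fun a => deriv (F a) x₀ := by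
  classical
  set l : Filter ℚ := comap (fun q : ℚ => (q : ℝ)) (𝓝[≠] 0) with hl
  have hne : l.NeBot := by
    rw [hl, comap_neBot_iff]
    intro t ht
    rw [mem_nhdsWithin_iff_exists_mem_nhds_inter] at ht
    obtain ⟨u, hu, hut⟩ := ht
    obtain ⟨ε, hε, hb⟩ := Metric.mem_nhds_iff.1 hu
    obtain ⟨q, hq1, hq2⟩ := exists_rat_btwn hε
    exact ⟨q, hut ⟨hb (by rw [Metric.mem_ball, Real.dist_0_eq_abs, abs_of_pos hq1]; exact hq2),
      by simpa using hq1.ne'⟩⟩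
  set g : ℚ → α → ℝ := fun q a => (q : ℝ)⁻¹ • (F a (x₀ + q) - F a x₀) with hg
  have hgm : ∀ q, Measurable (g q) := fun q => by
    simp only [hg, smul_eq_mul]
    exact ((hm _).sub (hm _)).const_mul _
  have hS : MeasurableSet {a | ∃ c, Tendsto (fun q => g q a) l (𝓝 c)} :=
    measurableSet_exists_tendsto hgm
  have hlim : Measurable fun a => limUnder l fun q => g q a :=
    (StronglyMeasurable.limUnder fun q => (hgm q).stronglyMeasurable).measurable
  have e : (fun a => deriv (F a) x₀)
      = fun a => if a ∈ {a | ∃ c, Tendsto (fun q => g q a) l (𝓝 c)}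
          then limUnder l fun q => g q a else 0 := by
    funext a
    split_ifs with h
    · obtain ⟨c, hc⟩ := h
      rw [hc.limUnder_eq, ((hasDerivAt_iff_tendsto_rat (hF a) x₀ c).2 hc).deriv]
    · refine deriv_zero_of_not_differentiableAt fun hd => h ?_
      exact ⟨_, (hasDerivAt_iff_tendsto_rat (hF a) x₀ _).1 hd.hasDerivAt⟩
  rw [e]
  exact Measurable.ite hS hlim measurable_const

/-! ### Knight's identity for the check function -/

/-- The remainder in Knight's identity,
`ρ_τ(e - v) - ρ_τ(e) = - v ψ_τ(e) + knightRem e v`. -/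
noncomputable def knightRem (e v : ℝ) : ℝ := if 0 ≤ e then max (v - e) 0 else max (e - v) 0

/-- **Knight's identity**. -/
theorem checkFun_sub (τ e v : ℝ) :
    checkFun τ (e - v) - checkFun τ e = -(v * checkDeriv τ e) + knightRem e v := by
  unfold checkFun checkDeriv knightRem
  rcases le_or_gt 0 e with h | h
  · rw [if_neg (not_lt.2 h), if_pos h]
    split_ifs with h2
    · rw [max_eq_left (by linarith)]; ring
    · rw [max_eq_right (by linarith)]; ring
  · rw [if_pos h, if_neg (not_le.2 h)]
    split_ifs with h2
    · rw [max_eq_right (by linarith)]; ring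
    · rw [max_eq_left (by linarith)]; ring

theorem checkFun_eq_max (τ u : ℝ) : checkFun τ u = max (τ * u) ((τ - 1) * u) := by
  unfold checkFun
  split_ifs with h
  · rw [max_eq_right (by nlinarith)]; ring
  · rw [max_eq_left (by nlinarith)]; ring

theorem convexOn_checkFun (τ : ℝ) : ConvexOn ℝ Set.univ (checkFun τ) := by
  have e : checkFun τ = (fun u => τ * u) ⊔ (fun u => (τ - 1) * u) := by
    funext u; exact checkFun_eq_max τ u
  rw [e]
  exact ((LinearMap.mulLeft ℝ τ).convexOn convex_univ).sup
    ((LinearMap.mulLeft ℝ (τ - 1)).convexOn convex_univ)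

theorem knightRem_nonneg (e v : ℝ) : 0 ≤ knightRem e v := by
  unfold knightRem; split_ifs <;> exact le_max_right _ _

theorem knightRem_zero (e : ℝ) : knightRem e 0 = 0 := by
  unfold knightRem; split_ifs with h
  · exact max_eq_right (by linarith)
  · exact max_eq_right (by linarith)

theorem measurable_knightRem : Measurable fun z : ℝ × ℝ => knightRem z.1 z.2 := by
  unfold knightRem
  exact Measurable.ite (measurableSet_le measurable_const measurable_fst) (by fun_prop)
    (by fun_prop)

theorem measurable_checkDeriv (τ : ℝ) : Measurable (checkDeriv τ) := by
  unfold checkDeriv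
  exact measurable_const.sub (Measurable.ite measurableSet_Iio measurable_const measurable_const)

/-- Knight's remainder is Lipschitz continuous, and locally constant unless the error is as small as
the arguments. -/
theorem abs_knightRem_sub_le {e v v' w : ℝ} (hv : |v| ≤ w) (hv' : |v'| ≤ w) :
    |knightRem e v - knightRem e v'| ≤ |v - v'| * if |e| ≤ w then 1 else 0 := by
  rw [abs_le] at hv hv'
  unfold knightRem
  by_cases hw : |e| ≤ w
  · rw [if_pos hw, mul_one]
    split_ifs
    · refine (abs_max_sub_max_le_abs _ _ _).trans (le_of_eq ?_); congr 1; ring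
    · refine (abs_max_sub_max_le_abs _ _ _).trans (le_of_eq ?_); rw [abs_sub_comm v v']
      congr 1; ring
  · rw [if_neg hw]
    rw [not_le, lt_abs] at hw
    split_ifs with h
    · have : w < e := by rcases hw with h1 | h1 <;> linarith
      rw [max_eq_right (by linarith), max_eq_right (by linarith)]; simp
    · have : w < -e := by rcases hw with h1 | h1 <;> linarith
      rw [max_eq_right (by linarith), max_eq_right (by linarith)]; simp

theorem knightRem_le (e v : ℝ) : knightRem e v ≤ |v| := by
  have h := abs_knightRem_sub_le (e := e) (v := v) (v' := 0) (w := |v| + |e|)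
    (by linarith [abs_nonneg e]) (by simp; positivity)
  rw [knightRem_zero, sub_zero, sub_zero, abs_of_nonneg (knightRem_nonneg e v)] at h
  refine h.trans ?_
  split_ifs <;> simp

/-- The integral form of Knight's remainder, which fails at `d = 0` for `v < 0`. -/
theorem knightRem_eq_integral {d : ℝ} (hd : d ≠ 0) (v : ℝ) :
    knightRem d v = ∫ s in (0 : ℝ)..v, ((if d ≤ s then 1 else 0) - if d ≤ 0 then 1 else 0) := by
  set c : ℝ := if d ≤ 0 then 1 else 0 with hc
  have hder : ∀ x : ℝ, HasDerivWithinAt (fun s => max (s - d) 0 - c * s)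
      ((if d ≤ x then 1 else 0) - c) (Set.Ioi x) x := by
    intro x
    refine HasDerivWithinAt.sub ?_ (by simpa using ((hasDerivAt_id x).const_mul c).hasDerivWithinAt)
    split_ifs with h
    · refine ((hasDerivAt_id x).sub_const d).hasDerivWithinAt.congr (fun y hy => ?_) ?_
      · have hy' : x < y := hy
        exact max_eq_left (by linarith)
      · exact max_eq_left (by linarith)
    · refine (HasDerivAt.congr_of_eventuallyEq (hasDerivAt_const x (0 : ℝ)) ?_).hasDerivWithinAt
      filter_upwards [eventually_lt_nhds (not_le.1 h)] with y hy
      exact max_eq_right (by linarith)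
  have hmono : Monotone fun s : ℝ => if d ≤ s then (1 : ℝ) else 0 := by
    intro a b hab
    dsimp only
    split_ifs with h1 h2
    · exact le_rfl
    · exact absurd (h1.trans hab) h2
    · exact zero_le_one
    · exact le_rfl
  have hint : IntervalIntegrable (fun s : ℝ => (if d ≤ s then (1 : ℝ) else 0) - c) volume 0 v :=
    hmono.intervalIntegrable.sub intervalIntegrable_const
  rw [intervalIntegral.integral_eq_sub_of_hasDeriv_right (f := fun s => max (s - d) 0 - c * s)
    (by fun_prop) (fun x _ => hder x) hint]
  unfold knightRem
  rcases lt_or_gt_of_ne hd with h | h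
  · rw [if_neg (not_le.2 h), hc, if_pos h.le]
    rw [max_eq_left (by linarith : (0 : ℝ) ≤ 0 - d)]
    rcases le_total v d with h2 | h2
    · rw [max_eq_left (by linarith), max_eq_right (by linarith)]; ring
    · rw [max_eq_right (by linarith), max_eq_left (by linarith)]; ring
  · rw [if_pos h.le, hc, if_neg (not_le.2 h), max_eq_right (by linarith : 0 - d ≤ (0 : ℝ))]
    ring

/-- A quadratic expansion at `0` of the distribution function excludes an atom at `0`. -/
theorem measure_singleton_zero_of_expansion {lam : Measure ℝ} [IsProbabilityMeasure lam] {f C : ℝ}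
    (h : ∀ s : ℝ, |lam.real (Set.Iic s) - lam.real (Set.Iic 0) - f * s| ≤ C * s ^ 2) :
    lam {0} = 0 := by
  have h1 : ∀ δ : ℝ, 0 < δ → lam.real {0} ≤ f * δ + C * δ ^ 2 := by
    intro δ hδ
    have hd : lam.real (Set.Ioc (-δ) 0) = lam.real (Set.Iic 0) - lam.real (Set.Iic (-δ)) := by
      have e : Set.Ioc (-δ) 0 = Set.Iic 0 \ Set.Iic (-δ) := by ext; simp
      rw [e, measureReal_sdiff (Set.Iic_subset_Iic.2 (by linarith))
        measurableSet_Iic]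
    have hle : lam.real {0} ≤ lam.real (Set.Ioc (-δ) 0) :=
      measureReal_mono (by simpa using hδ)
    have := (abs_le.1 (h (-δ))).1
    nlinarith
  have h2 : Tendsto (fun δ : ℝ => f * δ + C * δ ^ 2) (𝓝[>] 0) (𝓝 (f * 0 + C * 0 ^ 2)) :=
    (Continuous.tendsto (by fun_prop) 0).mono_left nhdsWithin_le_nhds
  have h3 : lam.real {0} ≤ f * 0 + C * 0 ^ 2 :=
    ge_of_tendsto h2 (by filter_upwards [self_mem_nhdsWithin] with δ hδ using h1 δ hδ)
  have h4 : lam.real {0} = 0 := le_antisymm (by simpa using h3) measureReal_nonneg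
  rwa [measureReal_eq_zero_iff] at h4

/-- The mean of Knight's remainder is `f v² / 2` up to third order, if the distribution function has
a quadratic expansion at `0` with density `f`. -/
theorem abs_integral_knightRem_sub_le {lam : Measure ℝ} [IsProbabilityMeasure lam] {f C : ℝ}
    (h : ∀ s : ℝ, |lam.real (Set.Iic s) - lam.real (Set.Iic 0) - f * s| ≤ C * s ^ 2) (v : ℝ) :
    |∫ d, knightRem d v ∂lam - f * v ^ 2 / 2| ≤ C * |v| ^ 3 := by
  have hC : 0 ≤ C := by have := (abs_nonneg _).trans (h 1); linarith
  have h0 := measure_singleton_zero_of_expansion h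
  have hae : ∀ᵐ d ∂lam, d ≠ 0 := by
    rw [ae_iff]; simpa using h0
  have e1 : ∫ d, knightRem d v ∂lam
      = ∫ d, (∫ s in (0 : ℝ)..v, ((if d ≤ s then 1 else 0) - if d ≤ 0 then (1 : ℝ) else 0)) ∂lam :=
    integral_congr_ae (hae.mono fun d hd => knightRem_eq_integral hd v)
  have hmeas : Measurable fun z : ℝ × ℝ =>
      ((if z.2 ≤ z.1 then (1 : ℝ) else 0) - if z.2 ≤ 0 then (1 : ℝ) else 0) :=
    (Measurable.ite (measurableSet_le measurable_snd measurable_fst) measurable_const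
      measurable_const).sub (Measurable.ite (measurableSet_le measurable_snd measurable_const)
      measurable_const measurable_const)
  rw [e1, ← intervalIntegral_integral_swap (f := fun s d =>
    ((if d ≤ s then (1 : ℝ) else 0) - if d ≤ 0 then (1 : ℝ) else 0))]
  swap
  · have : IsFiniteMeasure ((volume : Measure ℝ).restrict (Set.uIoc 0 v)) :=
      ⟨by simp [Set.uIoc]⟩
    refine Integrable.of_bound (C := 1) hmeas.aestronglyMeasurable (Eventually.of_forall fun z => ?_)
    simp only [Function.uncurry]
    split_ifs <;> simp
  have e2 : ∀ s : ℝ, ∫ d, ((if d ≤ s then (1 : ℝ) else 0) - if d ≤ 0 then (1 : ℝ) else 0) ∂lam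
      = lam.real (Set.Iic s) - lam.real (Set.Iic 0) := by
    intro s
    have hi : ∀ s : ℝ, (fun d : ℝ => if d ≤ s then (1 : ℝ) else 0) = (Set.Iic s).indicator 1 := by
      intro s; funext d; simp [Set.indicator]
    have hI : ∀ s : ℝ, Integrable (fun d : ℝ => if d ≤ s then (1 : ℝ) else 0) lam := by
      intro s; rw [hi s]; exact (integrable_const (1 : ℝ)).indicator measurableSet_Iic
    rw [integral_sub (hI s) (hI 0), hi s, hi 0, integral_indicator_one measurableSet_Iic,
      integral_indicator_one measurableSet_Iic]
  simp_rw [e2]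
  have hmono : Monotone fun s : ℝ => lam.real (Set.Iic s) := fun a b hab =>
    measureReal_mono (Set.Iic_subset_Iic.2 hab)
  have e3 : f * v ^ 2 / 2 = ∫ s in (0 : ℝ)..v, f * s := by
    rw [intervalIntegral.integral_const_mul, integral_id]; ring
  have i1 : IntervalIntegrable (fun s : ℝ => lam.real (Set.Iic s) - lam.real (Set.Iic 0)) volume
    0 v := hmono.intervalIntegrable.sub intervalIntegrable_const
  have i2 : IntervalIntegrable (fun s : ℝ => f * s) volume 0 v :=
    Continuous.intervalIntegrable (by fun_prop) _ _
  rw [e3, ← intervalIntegral.integral_sub i1 i2]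
  have := intervalIntegral.norm_integral_le_of_norm_le_const (a := (0 : ℝ)) (b := v)
    (f := fun s => lam.real (Set.Iic s) - lam.real (Set.Iic 0) - f * s) (C := C * v ^ 2)
    fun s hs => by
      refine (h s).trans ?_
      have hs' : |s| ≤ |v| := by
        rcases le_total 0 v with hv | hv
        · rw [Set.uIoc_of_le hv] at hs
          rw [abs_of_pos hs.1, abs_of_nonneg hv]; exact hs.2
        · rw [Set.uIoc_of_ge hv] at hs
          rw [abs_of_nonpos hs.2, abs_of_nonpos hv]; linarith [hs.1]
      have := sq_le_sq.2 hs'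
      gcongr
  rw [Real.norm_eq_abs, sub_zero] at this
  refine this.trans (le_of_eq ?_)
  rw [← sq_abs]; ring

/-! ### Conditional distributions given the past -/

theorem measurable_consSeq {S : Type*} [MeasurableSpace S] :
    Measurable fun z : S × (ℕ → S) => consSeq z.1 z.2 := by
  refine measurable_pi_lambda _ fun j => ?_
  cases j with
  | zero => exact measurable_fst
  | succ j => exact (measurable_pi_apply j).comp measurable_snd

namespace PLSProcess

variable {Ω A B : Type*} [MeasurableSpace Ω] [MeasurableSpace A] [MeasurableSpace B]
  {P : Measure Ω} {p R : ℕ}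

/-- The common law of the pairs of histories `(F_{k-1}, G_k)`. -/
noncomputable def pastLaw (m : PLSProcess Ω A B P p R) : Measure ((ℕ → A) × (ℕ → B)) :=
  P.map (m.past 0)

/-- The error as a function of the current input and of the past. -/
def errOf (m : PLSProcess Ω A B P p R) (r : Fin (R + 1)) (t : ℝ) (e : A)
    (z : (ℕ → A) × (ℕ → B)) : ℝ := m.D r t (consSeq e z.1) z.2

/-- The predictor as a function of the past. -/
def predOf (m : PLSProcess Ω A B P p R) (r : Fin (R + 1)) (t : ℝ) (z : (ℕ → A) × (ℕ → B)) :
    EuclideanSpace ℝ (Fin p) := m.H r t z.1 z.2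

/-- The conditional law of the error given the past. -/
noncomputable def condLaw (m : PLSProcess Ω A B P p R) (r : Fin (R + 1)) (t : ℝ)
    (z : (ℕ → A) × (ℕ → B)) : Measure ℝ := (P.map (m.η 0)).map fun e => m.errOf r t e z

/-- The conditional distribution function of the error as a function of the past. -/
noncomputable def cdfOf (m : PLSProcess Ω A B P p R) (r : Fin (R + 1)) (t : ℝ)
    (z : (ℕ → A) × (ℕ → B)) (x : ℝ) : ℝ := m.condDistFun r t z.1 z.2 x

/-- The conditional density of the error at `0` as a function of the past. -/
noncomputable def densOf (m : PLSProcess Ω A B P p R) (r : Fin (R + 1)) (t : ℝ)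
    (z : (ℕ → A) × (ℕ → B)) : ℝ := m.condDeriv 1 r t z.1 z.2 0

theorem err_eq (m : PLSProcess Ω A B P p R) (r : Fin (R + 1)) (t : ℝ) (k : ℤ) (ω : Ω) :
    m.err r t k ω = m.errOf r t (m.η k ω) (m.past k ω) := by
  unfold err errOf past
  rw [consSeq_history]

theorem measurable_errOf (m : PLSProcess Ω A B P p R) (r : Fin (R + 1)) (t : ℝ) :
    Measurable fun w : A × ((ℕ → A) × (ℕ → B)) => m.errOf r t w.1 w.2 := by
  have h : Measurable fun w : A × ((ℕ → A) × (ℕ → B)) => (consSeq w.1 w.2.1, w.2.2) :=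
    (measurable_consSeq.comp (measurable_fst.prodMk (measurable_fst.comp measurable_snd))).prodMk
      (measurable_snd.comp measurable_snd)
  exact (m.measurable_D r t).comp h

theorem measurable_errOf_left (m : PLSProcess Ω A B P p R) (r : Fin (R + 1)) (t : ℝ)
    (z : (ℕ → A) × (ℕ → B)) : Measurable fun e => m.errOf r t e z :=
  (m.measurable_errOf r t).comp (measurable_id.prodMk measurable_const)

theorem measurable_predOf (m : PLSProcess Ω A B P p R) (r : Fin (R + 1)) (t : ℝ) :
    Measurable (m.predOf r t) := m.measurable_H r t

theorem cdfOf_eq (m : PLSProcess Ω A B P p R) (r : Fin (R + 1)) (t : ℝ)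
    (z : (ℕ → A) × (ℕ → B)) (x : ℝ) : m.cdfOf r t z x = (m.condLaw r t z).real (Set.Iic x) := by
  unfold condLaw
  rw [map_measureReal_apply (m.measurable_errOf_left r t z) measurableSet_Iic]
  rfl

theorem densOf_eq_deriv (m : PLSProcess Ω A B P p R) (r : Fin (R + 1)) (t : ℝ)
    (z : (ℕ → A) × (ℕ → B)) : m.densOf r t z = deriv (m.cdfOf r t z) 0 := by
  unfold densOf condDeriv
  rw [iteratedDeriv_one]
  rfl

variable [IsProbabilityMeasure P]

instance (m : PLSProcess Ω A B P p R) : IsProbabilityMeasure m.pastLaw :=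
  Measure.isProbabilityMeasure_map (m.measurable_past 0).aemeasurable

theorem isProbabilityMeasure_map_η (m : PLSProcess Ω A B P p R) :
    IsProbabilityMeasure (P.map (m.η 0)) :=
  Measure.isProbabilityMeasure_map (m.measurable_η 0).aemeasurable

instance (m : PLSProcess Ω A B P p R) (r : Fin (R + 1)) (t : ℝ) (z : (ℕ → A) × (ℕ → B)) :
    IsProbabilityMeasure (m.condLaw r t z) :=
  have := m.isProbabilityMeasure_map_η
  Measure.isProbabilityMeasure_map (m.measurable_errOf_left r t z).aemeasurable

theorem measurable_cdfOf (m : PLSProcess Ω A B P p R) (r : Fin (R + 1)) (t x : ℝ) :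
    Measurable fun z => m.cdfOf r t z x := by
  have := m.isProbabilityMeasure_map_η
  have hs : MeasurableSet {w : ((ℕ → A) × (ℕ → B)) × A | m.errOf r t w.2 w.1 ≤ x} :=
    measurableSet_le ((m.measurable_errOf r t).comp measurable_swap) measurable_const
  exact (measurable_measure_prodMk_left (ν := P.map (m.η 0)) hs).ennreal_toReal

theorem continuousWithinAt_cdfOf (m : PLSProcess Ω A B P p R) (r : Fin (R + 1)) (t : ℝ)
    (z : (ℕ → A) × (ℕ → B)) (x : ℝ) : ContinuousWithinAt (m.cdfOf r t z) (Set.Ici x) x := by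
  have e : m.cdfOf r t z = cdf (m.condLaw r t z) := by
    funext x; rw [m.cdfOf_eq, cdf_eq_real]
  rw [e]
  exact (cdf (m.condLaw r t z)).right_continuous x

theorem monotone_cdfOf (m : PLSProcess Ω A B P p R) (r : Fin (R + 1)) (t : ℝ)
    (z : (ℕ → A) × (ℕ → B)) : Monotone (m.cdfOf r t z) := by
  intro x y hxy
  rw [m.cdfOf_eq, m.cdfOf_eq]
  exact measureReal_mono (Set.Iic_subset_Iic.2 hxy)

theorem cdfOf_mem (m : PLSProcess Ω A B P p R) (r : Fin (R + 1)) (t : ℝ)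
    (z : (ℕ → A) × (ℕ → B)) (x : ℝ) : m.cdfOf r t z x ∈ Set.Icc (0 : ℝ) 1 := by
  rw [m.cdfOf_eq]
  exact ⟨measureReal_nonneg, measureReal_le_one⟩

/-- Measurability at every `(r, t)`, including those where no regularity is assumed. -/
theorem measurable_densOf (m : PLSProcess Ω A B P p R) (r : Fin (R + 1)) (t : ℝ) :
    Measurable (m.densOf r t) := by
  have e : m.densOf r t = fun z => deriv (m.cdfOf r t z) 0 := funext (m.densOf_eq_deriv r t)
  rw [e]
  exact measurable_deriv_of_continuousWithinAt_Ici (m.measurable_cdfOf r t)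
    (m.continuousWithinAt_cdfOf r t) 0

/-- The conditional distribution function of the error given the past `z` has a quadratic expansion
at `0`, with a density between `ε₀` and `M`. -/
structure Expansion (m : PLSProcess Ω A B P p R) (r : Fin (R + 1)) (t ε₀ M C : ℝ)
    (z : (ℕ → A) × (ℕ → B)) : Prop where
  le_dens : ε₀ ≤ m.densOf r t z
  dens_le : m.densOf r t z ≤ M
  abs_sub_le : ∀ s : ℝ, |m.cdfOf r t z s - m.cdfOf r t z 0 - m.densOf r t z * s| ≤ C * s ^ 2

omit [IsProbabilityMeasure P] in
theorem Expansion.abs_condLaw {m : PLSProcess Ω A B P p R} {r : Fin (R + 1)} {t ε₀ M C : ℝ}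
    {z : (ℕ → A) × (ℕ → B)} (h : m.Expansion r t ε₀ M C z) (s : ℝ) :
    |(m.condLaw r t z).real (Set.Iic s) - (m.condLaw r t z).real (Set.Iic 0)
      - m.densOf r t z * s| ≤ C * s ^ 2 := by
  have := h.abs_sub_le s
  rwa [m.cdfOf_eq, m.cdfOf_eq] at this

theorem measurableSet_expansion (m : PLSProcess Ω A B P p R) (r : Fin (R + 1)) (t ε₀ M C : ℝ) :
    MeasurableSet {z | m.Expansion r t ε₀ M C z} := by
  have hd := m.measurable_densOf r t
  have e : {z | m.Expansion r t ε₀ M C z} = ({z | ε₀ ≤ m.densOf r t z} ∩ {z | m.densOf r t z ≤ M})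
      ∩ ⋂ q : ℚ, {z | |m.cdfOf r t z q - m.cdfOf r t z 0 - m.densOf r t z * q| ≤ C * (q : ℝ) ^ 2} := by
    ext z
    simp only [Set.mem_inter_iff, Set.mem_iInter]
    constructor
    · intro h
      exact ⟨⟨h.le_dens, h.dens_le⟩, fun q => h.abs_sub_le q⟩
    · rintro ⟨⟨h1, h2⟩, h3⟩
      refine ⟨h1, h2, fun s => ?_⟩
      -- approximate `s` by rationals from the right
      have hcl : s ∈ closure (Set.Ioi s ∩ Set.range ((↑) : ℚ → ℝ)) := by
        rw [Metric.mem_closure_iff]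
        intro ε hε
        obtain ⟨q, hq1, hq2⟩ := exists_rat_btwn (lt_add_of_pos_right s hε)
        refine ⟨q, ⟨hq1, q, rfl⟩, ?_⟩
        rw [dist_comm, Real.dist_eq, abs_of_pos (by linarith)]; linarith
      have hne : (𝓝[Set.Ioi s ∩ Set.range ((↑) : ℚ → ℝ)] s).NeBot :=
        mem_closure_iff_nhdsWithin_neBot.1 hcl
      have hF : Tendsto (m.cdfOf r t z) (𝓝[Set.Ioi s ∩ Set.range ((↑) : ℚ → ℝ)] s)
          (𝓝 (m.cdfOf r t z s)) :=
        (m.continuousWithinAt_cdfOf r t z s).mono_left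
          (nhdsWithin_mono _ (Set.inter_subset_left.trans Set.Ioi_subset_Ici_self))
      have hid : Tendsto (fun x : ℝ => x) (𝓝[Set.Ioi s ∩ Set.range ((↑) : ℚ → ℝ)] s) (𝓝 s) :=
        tendsto_id.mono_left nhdsWithin_le_nhds
      refine le_of_tendsto_of_tendsto (((hF.sub_const _).sub (hid.const_mul _)).abs)
        ((hid.pow 2).const_mul C) ?_
      filter_upwards [self_mem_nhdsWithin] with x hx
      obtain ⟨-, q, rfl⟩ := hx
      exact h3 q
  rw [e]
  refine ((measurableSet_le measurable_const hd).inter (measurableSet_le hd measurable_const)).inter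
    (MeasurableSet.iInter fun q => measurableSet_le ?_ measurable_const)
  have h1 := m.measurable_cdfOf r t q
  have h2 := m.measurable_cdfOf r t 0
  exact ((h1.sub h2).sub (hd.mul_const _)).abs

/-- Near `0` the Lipschitz bound on the density gives the expansion, and away from `0` it is trivial
since a distribution function has values in `[0, 1]`. -/
theorem exists_expansion (m : PLSProcess Ω A B P p R) (hp : 0 < p) (h2 : m.C2) (h3 : m.C3) :
    ∃ ε₀ M C : ℝ, 0 < ε₀ ∧ ∀ r, ∀ t ∈ m.openSeg r, ∀ᵐ z ∂m.pastLaw, m.Expansion r t ε₀ M C z := by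
  obtain ⟨-, hdiff, -⟩ := h2
  obtain ⟨c, ε₀, M, hc, hε, hreg, -⟩ := h3
  refine ⟨ε₀, M, |M| + 1 / c ^ 2 + |M| / c, hε, fun r t ht => ?_⟩
  unfold pastLaw
  rw [ae_map_iff (m.measurable_past 0).aemeasurable (m.measurableSet_expansion r t ε₀ M _)]
  filter_upwards [hdiff r t ht, hreg r t ht] with ω h0 h1
  set z := m.past 0 ω with hz
  have hD : Differentiable ℝ (m.cdfOf r t z) := by
    have := h0 0 hp
    unfold condDeriv at this
    rwa [iteratedDeriv_zero] at this
  have hdens : ∀ x, m.condDens r t x 0 ω = deriv (m.cdfOf r t z) x := by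
    intro x
    unfold condDens condDeriv
    rw [iteratedDeriv_one]
    rfl
  simp only [hdens] at h1
  obtain ⟨hlow, hup, hlip⟩ := h1
  have hnn : ∀ x, 0 ≤ deriv (m.cdfOf r t z) x := fun x => (m.monotone_cdfOf r t z).deriv_nonneg
  refine ⟨?_, ?_, fun s => ?_⟩
  · rw [m.densOf_eq_deriv, ← abs_of_nonneg (hnn 0)]; exact hlow 0 (by simpa using hc)
  · rw [m.densOf_eq_deriv]; exact (le_abs_self _).trans (hup 0)
  rw [m.densOf_eq_deriv]
  set f0 := deriv (m.cdfOf r t z) 0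
  have hf0 : |f0| ≤ |M| := (hup 0).trans (le_abs_self M)
  rcases lt_or_ge |s| c with hs | hs
  · have hlip0 : ∀ x, |x| < c → |deriv (m.cdfOf r t z) x - f0| ≤ |M| * |x| := by
      intro x hx
      rw [abs_lt] at hx
      rcases lt_trichotomy x 0 with h | h | h
      · have := hlip x 0 hx.1 h hc
        rw [abs_div, div_le_iff₀ (by simpa using h.ne), sub_zero] at this
        exact this.trans (by gcongr; exact le_abs_self M)
      · subst h; simp [f0]
      · have := hlip 0 x (by linarith) h hx.2
        rw [abs_div, div_le_iff₀ (by simpa using h.ne'), zero_sub, abs_neg, abs_sub_comm] at this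
        exact this.trans (by gcongr; exact le_abs_self M)
    have hmv := Convex.norm_image_sub_le_of_norm_deriv_le (f := fun x => m.cdfOf r t z x - f0 * x)
      (s := Set.uIcc 0 s) (x := 0) (y := s) (C := |M| * |s|)
      (fun x _ => (hD x).sub (by fun_prop)) (fun x hx => by
        have hd : deriv (fun x => m.cdfOf r t z x - f0 * x) x = deriv (m.cdfOf r t z) x - f0 := by
          rw [deriv_fun_sub (hD x) (by fun_prop)]
          simp
        have hx' : |x| ≤ |s| := by simpa using Set.abs_sub_left_of_mem_uIcc hx
        rw [hd, Real.norm_eq_abs]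
        exact (hlip0 x (hx'.trans_lt hs)).trans (by gcongr)) (convex_uIcc 0 s)
      Set.left_mem_uIcc Set.right_mem_uIcc
    simp only [Real.norm_eq_abs, mul_zero, sub_zero] at hmv
    have e : m.cdfOf r t z s - f0 * s - m.cdfOf r t z 0
        = m.cdfOf r t z s - m.cdfOf r t z 0 - f0 * s := by ring
    rw [e] at hmv
    refine hmv.trans ?_
    rw [mul_assoc, ← sq, sq_abs]
    have : 0 ≤ 1 / c ^ 2 + |M| / c := by positivity
    nlinarith [sq_nonneg s]
  · have a1 : |m.cdfOf r t z s - m.cdfOf r t z 0| ≤ 1 := by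
      have h1 := m.cdfOf_mem r t z s
      have h2 := m.cdfOf_mem r t z 0
      rw [abs_le]; constructor <;> linarith [h1.1, h1.2, h2.1, h2.2]
    have a2 : 1 ≤ 1 / c ^ 2 * s ^ 2 := by
      rw [one_div, ← div_eq_inv_mul, le_div_iff₀ (by positivity), one_mul, ← sq_abs s]
      gcongr
    have a3 : |f0 * s| ≤ |M| / c * s ^ 2 := by
      rw [abs_mul, div_mul_eq_mul_div, le_div_iff₀ hc, ← sq_abs s]
      have : |f0| * |s| * c ≤ |M| * |s| * |s| := by gcongr
      nlinarith
    calc _ ≤ |m.cdfOf r t z s - m.cdfOf r t z 0| + |f0 * s| := abs_sub _ _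
      _ ≤ 1 / c ^ 2 * s ^ 2 + |M| / c * s ^ 2 := by linarith
      _ ≤ _ := by
        have : 0 ≤ |M| * s ^ 2 := by positivity
        nlinarith

end PLSProcess

/-! ### Quadratic forms and smallest eigenvalues -/

theorem quadForm_eq_sum {p : ℕ} (S : Matrix (Fin p) (Fin p) ℝ) (v : EuclideanSpace ℝ (Fin p)) :
    quadForm S v = ∑ j, ∑ l, S j l * (v j * v l) := by
  unfold quadForm
  rw [Matrix.toLpLin_apply, PiLp.inner_apply]
  refine Finset.sum_congr rfl fun j _ => ?_
  simp only [Matrix.mulVec, dotProduct, RCLike.inner_apply, conj_trivial, Finset.sum_mul]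
  exact Finset.sum_congr rfl fun l _ => by ring

theorem quadForm_eq_dotProduct {p : ℕ} (S : Matrix (Fin p) (Fin p) ℝ)
    (v : EuclideanSpace ℝ (Fin p)) : quadForm S v = star v.ofLp ⬝ᵥ S.mulVec v.ofLp := by
  rw [quadForm_eq_sum]
  simp only [dotProduct, Matrix.mulVec, Finset.mul_sum, star_trivial]
  exact Finset.sum_congr rfl fun j _ => Finset.sum_congr rfl fun l _ => by ring

theorem le_quadForm_of_le_smallestEigenvalue {p : ℕ} {S : Matrix (Fin p) (Fin p) ℝ}
    (hS : S.IsHermitian) {ε : ℝ} (h : ε ≤ smallestEigenvalue S) (v : EuclideanSpace ℝ (Fin p)) :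
    ε * ‖v‖ ^ 2 ≤ quadForm S v := by
  have hsp : ∀ c ∈ spectrum ℝ S, ε ≤ c := by
    intro c hc
    refine h.trans (csInf_le ?_ hc)
    rw [hS.spectrum_real_eq_range_eigenvalues]
    exact (Set.finite_range _).bddBelow
  have hpsd : (S - algebraMap ℝ (Matrix (Fin p) (Fin p) ℝ) ε).PosSemidef := by
    rw [Matrix.posSemidef_iff_isHermitian_and_spectrum_nonneg]
    refine ⟨hS.sub ?_, ?_⟩
    · rw [Algebra.algebraMap_eq_smul_one]
      exact Matrix.isHermitian_one.smul (by simp [IsSelfAdjoint])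
    · rw [← spectrum.sub_singleton_eq]
      rintro _ ⟨c, hc, _, rfl, rfl⟩
      exact sub_nonneg.2 (hsp c hc)
  have h1 := hpsd.dotProduct_mulVec_nonneg v.ofLp
  rw [Matrix.sub_mulVec, dotProduct_sub, ← quadForm_eq_dotProduct, Algebra.algebraMap_eq_smul_one,
    Matrix.smul_mulVec, Matrix.one_mulVec, dotProduct_smul] at h1
  have h2 : star v.ofLp ⬝ᵥ v.ofLp = ‖v‖ ^ 2 := by
    rw [EuclideanSpace.real_norm_sq_eq]
    simp only [dotProduct, star_trivial]
    exact Finset.sum_congr rfl fun i _ => by ring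
  rw [h2, smul_eq_mul] at h1
  linarith

theorem inner_sq_eq_sum {p : ℕ} (x v : EuclideanSpace ℝ (Fin p)) :
    inner ℝ x v ^ 2 = ∑ j, ∑ l, x j * x l * (v j * v l) := by
  rw [PiLp.inner_apply, sq, Finset.sum_mul_sum]
  refine Finset.sum_congr rfl fun j _ => Finset.sum_congr rfl fun l _ => ?_
  simp only [RCLike.inner_apply, conj_trivial]; ring

/-! ### Uniform regularity of the design -/

/-- A geometrically decaying quantity that is also bounded is dominated by a summable sequence. -/
theorem GeometricDecay.exists_summable {Δ : ℕ → ℝ≥0∞} (h : GeometricDecay Δ) {b : ℝ≥0∞}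
    (hb : b ≠ ⊤) : ∃ a : ℕ → ℝ≥0∞, ∑' k, a k ≠ ⊤ ∧ ∀ k, min (Δ k) b ≤ a k := by
  obtain ⟨χ, h0, h1, C, hC⟩ := h
  obtain ⟨k₀, hk₀⟩ := eventually_atTop.1 hC
  refine ⟨fun k => (if k < k₀ then b else 0) + C * ENNReal.ofReal (χ ^ k), ?_, fun k => ?_⟩
  · rw [ENNReal.tsum_add, ENNReal.tsum_mul_left, ENNReal.add_ne_top]
    refine ⟨?_, ENNReal.mul_ne_top ENNReal.coe_ne_top ?_⟩
    · rw [tsum_eq_sum (s := Finset.range k₀) fun k hk => if_neg (by simpa using hk)]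
      refine (ENNReal.sum_lt_top.2 fun k _ => ?_).ne
      split_ifs
      · exact hb.lt_top
      · exact ENNReal.zero_lt_top
    · rw [← ENNReal.ofReal_tsum_of_nonneg (fun k => by positivity)
        (summable_geometric_of_lt_one h0.le h1)]
      exact ENNReal.ofReal_ne_top
  · by_cases hk : k < k₀
    · simp only [hk, if_true]
      exact (min_le_right _ _).trans le_self_add
    · simp only [hk, if_false, zero_add]
      exact (min_le_left _ _).trans (hk₀ k (not_lt.1 hk))

/-- An event whose conditional probability is constant behaves in integrals against conditioned
variables as if it were independent of them. -/
theorem integral_mul_indicator_of_condExp_eq {Ω : Type*} {σ mΩ : MeasurableSpace Ω} {P : Measure Ω}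
    [IsProbabilityMeasure P] (hσ : σ ≤ mΩ) {s : Set Ω} (hs : MeasurableSet s) {f : Ω → ℝ}
    (hf : StronglyMeasurable[σ] f) (hfi : Integrable f P) {τ : ℝ}
    (h : P⟦s | σ⟧ =ᵐ[P] fun _ => τ) :
    Integrable (fun ω => f ω * s.indicator (fun _ => (1 : ℝ)) ω) P ∧
      ∫ ω, f ω * s.indicator (fun _ => (1 : ℝ)) ω ∂P = ∫ ω, f ω * τ ∂P := by
  have hI : Integrable (s.indicator fun _ => (1 : ℝ)) P :=
    (integrable_const (1 : ℝ)).indicator hs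
  have hprod : Integrable (f * s.indicator fun _ => (1 : ℝ)) P := by
    refine hfi.mul_bdd (c := 1) hI.1 (Eventually.of_forall fun ω => ?_)
    by_cases h : ω ∈ s <;> simp [h]
  refine ⟨hprod, ?_⟩
  have hpull := condExp_mul_of_stronglyMeasurable_left hf hprod hI
  refine Eq.trans (integral_condExp hσ (μ := P)
    (f := f * s.indicator fun _ => (1 : ℝ))).symm (integral_congr_ae ?_)
  filter_upwards [hpull, h] with ω h3 h4
  rw [h3, Pi.mul_apply, h4]

namespace PLSProcess

variable {Ω A B : Type*} [MeasurableSpace Ω] [MeasurableSpace A] [MeasurableSpace B]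
  {P : Measure Ω} {p R : ℕ}

/-- The properties of the filters `H_r(t, ·)` and `D_r(t, ·)` on which the asymptotics rest. The
constants `ε₀`, `M`, `C` and the sequence `a` do not depend on `(r, t)`. -/
structure RegularAt (m : PLSProcess Ω A B P p R) (τ : ℝ) (ε₀ M C : ℝ) (a : ℕ → ℝ≥0∞)
    (r : Fin (R + 1)) (t : ℝ) : Prop where
  expansion : ∀ᵐ z ∂m.pastLaw, m.Expansion r t ε₀ M C z
  moment : eLpNorm (m.predOf r t) 4 m.pastLaw ≤ ENNReal.ofReal M
  dep_pred : ∀ k : ℕ, eLpNorm (fun w : Ω × Ω =>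
    m.predOf r t (m.past k w.1) - m.predOf r t (m.pastStar k w)) 4 (P.prod P) ≤ a k
  dep_cdf : ∀ k : ℕ, eLpNorm (fun w : Ω × Ω =>
    m.cdfOf r t (m.past k w.1) 0 - m.cdfOf r t (m.pastStar k w) 0) 4 (P.prod P) ≤ a k
  dep_dens : ∀ k : ℕ, eLpNorm (fun w : Ω × Ω =>
    m.densOf r t (m.past k w.1) - m.densOf r t (m.pastStar k w)) 4 (P.prod P) ≤ a k
  lower : ∀ v : EuclideanSpace ℝ (Fin p),
    ε₀ * ‖v‖ ^ 2 ≤ ∫ z, inner ℝ (m.predOf r t z) v ^ 2 ∂m.pastLaw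
  mean_zero : ∀ v : EuclideanSpace ℝ (Fin p),
    ∫ z, inner ℝ (m.predOf r t z) v * (τ - m.cdfOf r t z 0) ∂m.pastLaw = 0

variable [IsProbabilityMeasure P]

theorem eLpNorm_comp_past (m : PLSProcess Ω A B P p R) (k : ℤ) {E : Type*} [NormedAddCommGroup E]
    {g : (ℕ → A) × (ℕ → B) → E} (hg : AEStronglyMeasurable g m.pastLaw) (q : ℝ≥0∞) :
    eLpNorm (fun ω => g (m.past k ω)) q P = eLpNorm g q m.pastLaw :=
  eLpNorm_comp_measurePreserving hg (m.measurePreserving_past k)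

/-- Integration over the current input and the past. -/
theorem integral_η_past (m : PLSProcess Ω A B P p R) (k : ℤ)
    {g : A × ((ℕ → A) × (ℕ → B)) → ℝ} (hg : Integrable g ((P.map (m.η 0)).prod m.pastLaw)) :
    ∫ ω, g (m.η k ω, m.past k ω) ∂P = ∫ z, ∫ e, g (e, z) ∂(P.map (m.η 0)) ∂m.pastLaw := by
  have := m.isProbabilityMeasure_map_η
  have h : MeasurePreserving (fun ω => (m.η k ω, m.past k ω)) P
    ((P.map (m.η 0)).prod m.pastLaw) := m.measurePreserving_η_past k
  rw [← integral_prod_symm g hg]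
  rw [← h.map_eq] at hg ⊢
  exact (integral_map h.measurable.aemeasurable hg.1).symm

theorem integral_past (m : PLSProcess Ω A B P p R) (k : ℤ) {E : Type*} [NormedAddCommGroup E]
    [NormedSpace ℝ E] {g : (ℕ → A) × (ℕ → B) → E} (hg : AEStronglyMeasurable g m.pastLaw) :
    ∫ ω, g (m.past k ω) ∂P = ∫ z, g z ∂m.pastLaw := by
  have h := m.measurePreserving_past k
  have e : m.pastLaw = P.map (m.past k) := (m.map_past k).symm
  rw [e] at hg ⊢
  exact (integral_map h.measurable.aemeasurable hg).symm

/-- If `0` is a conditional `τ`-quantile given the predictor and the conditional law given the past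
has no atom at `0`, then the scores are centred. -/
theorem integral_inner_mul_eq_zero (m : PLSProcess Ω A B P p R) {τ : ℝ} (n i : ℕ)
    (hq₁ : ∀ᵐ ω ∂P,
      (P⟦{ω' | m.ε n i ω' < 0} | MeasurableSpace.comap (m.x n i) inferInstance⟧) ω ≤ τ)
    (hq₂ : ∀ᵐ ω ∂P,
      τ ≤ (P⟦{ω' | m.ε n i ω' ≤ 0} | MeasurableSpace.comap (m.x n i) inferInstance⟧) ω)
    {ε₀ M C : ℝ}
    (hexp : ∀ᵐ z ∂m.pastLaw, m.Expansion (m.seg ((i : ℝ) / n)) ((i : ℝ) / n) ε₀ M C z)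
    (hmom : MemLp (m.predOf (m.seg ((i : ℝ) / n)) ((i : ℝ) / n)) 4 m.pastLaw)
    (v : EuclideanSpace ℝ (Fin p)) :
    ∫ z, inner ℝ (m.predOf (m.seg ((i : ℝ) / n)) ((i : ℝ) / n) z) v
      * (τ - m.cdfOf (m.seg ((i : ℝ) / n)) ((i : ℝ) / n) z 0) ∂m.pastLaw = 0 := by
  set t := (i : ℝ) / n
  set r := m.seg t
  have hpη := m.isProbabilityMeasure_map_η
  have hx : m.x n i = fun ω => m.predOf r t (m.past i ω) := rfl
  have hxm : Measurable (m.x n i) := (m.measurable_predOf r t).comp (m.measurable_past i)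
  have hε : m.ε n i = fun ω => m.errOf r t (m.η i ω) (m.past i ω) := by
    funext ω; exact m.err_eq r t i ω
  have hεm : Measurable (m.ε n i) := by
    rw [hε]
    exact (m.measurable_errOf r t).comp ((m.measurable_η i).prodMk (m.measurable_past i))
  -- the error has no atom at zero
  have hatom : P {ω | m.ε n i ω = 0} = 0 := by
    have hms : MeasurableSet {w : A × ((ℕ → A) × (ℕ → B)) | m.errOf r t w.1 w.2 = 0} :=
      measurableSet_eq_fun (m.measurable_errOf r t) measurable_const
    have h1 : P {ω | m.ε n i ω = 0} = ((P.map (m.η 0)).prod m.pastLaw)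
        {w | m.errOf r t w.1 w.2 = 0} := by
      have := (m.measurePreserving_η_past i).measure_preimage hms.nullMeasurableSet
      rw [hε]
      exact this
    rw [h1, Measure.prod_apply_symm hms, lintegral_eq_zero_iff
      (measurable_measure_prodMk_right hms)]
    filter_upwards [hexp] with z hz
    have := measure_singleton_zero_of_expansion hz.abs_condLaw
    unfold condLaw at this
    rw [Measure.map_apply (m.measurable_errOf_left r t z) (measurableSet_singleton 0)] at this
    exact this
  have hind : ({ω' | m.ε n i ω' < 0} : Set Ω).indicator (fun _ => (1 : ℝ))
      =ᵐ[P] ({ω' | m.ε n i ω' ≤ 0} : Set Ω).indicator (fun _ => (1 : ℝ)) := by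
    have : ∀ᵐ ω ∂P, m.ε n i ω ≠ 0 := by rw [ae_iff]; simpa using hatom
    filter_upwards [this] with ω hω
    by_cases h : m.ε n i ω ≤ 0
    · have h' : m.ε n i ω < 0 := lt_of_le_of_ne h hω
      simp [h, h']
    · have h' : ¬ m.ε n i ω < 0 := fun h'' => h h''.le
      simp [h, h']
  set s2 : Set Ω := {ω' | m.ε n i ω' ≤ 0} with hs2
  have hs2m : MeasurableSet s2 := measurableSet_le hεm measurable_const
  have hτ : P⟦s2 | MeasurableSpace.comap (m.x n i) inferInstance⟧ =ᵐ[P] fun _ => τ := by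
    filter_upwards [hq₁, hq₂, condExp_congr_ae (m := MeasurableSpace.comap (m.x n i) inferInstance)
      hind] with ω h1 h2 h3
    exact le_antisymm (by rw [← h3]; exact h1) h2
  have hX : MemLp (m.x n i) 4 P := hmom.comp_measurePreserving (m.measurePreserving_past i)
  have hXv : Integrable (fun ω => inner ℝ (m.x n i ω) v) P :=
    (hX.inner_const v).integrable (by norm_num)
  have hI : Integrable (s2.indicator fun _ => (1 : ℝ)) P :=
    (integrable_const (1 : ℝ)).indicator hs2m
  have hsm : StronglyMeasurable[MeasurableSpace.comap (m.x n i) inferInstance]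
      fun ω => inner ℝ (m.x n i ω) v := by
    have h2 : Measurable fun x : EuclideanSpace ℝ (Fin p) => inner ℝ x v := by fun_prop
    exact (h2.comp (comap_measurable (m.x n i))).stronglyMeasurable
  obtain ⟨hprod, h1⟩ := integral_mul_indicator_of_condExp_eq hxm.comap_le hs2m hsm hXv hτ
  -- integrate out the current input
  have h2 : ∫ ω, inner ℝ (m.x n i ω) v * s2.indicator (fun _ => (1 : ℝ)) ω ∂P
      = ∫ z, inner ℝ (m.predOf r t z) v * m.cdfOf r t z 0 ∂m.pastLaw := by
    set g : A × ((ℕ → A) × (ℕ → B)) → ℝ := fun w => inner ℝ (m.predOf r t w.2) v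
      * (if m.errOf r t w.1 w.2 ≤ 0 then 1 else 0) with hg
    have hgi : Integrable g ((P.map (m.η 0)).prod m.pastLaw) := by
      have hgm : Measurable g := by
        have := m.measurable_predOf r t
        have h5 : Measurable fun w : A × ((ℕ → A) × (ℕ → B)) => inner ℝ (m.predOf r t w.2) v := by
          fun_prop
        exact h5.mul (Measurable.ite (measurableSet_le (m.measurable_errOf r t) measurable_const)
          measurable_const measurable_const)
      have hmp : MeasurePreserving (fun ω => (m.η i ω, m.past i ω)) P
        ((P.map (m.η 0)).prod m.pastLaw) := m.measurePreserving_η_past i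
      rw [← hmp.map_eq, integrable_map_measure hgm.aestronglyMeasurable hmp.measurable.aemeasurable]
      refine hprod.congr (Eventually.of_forall fun ω => ?_)
      simp only [hg, Function.comp_apply, Set.indicator, hs2, Set.mem_ofPred_eq, hε]
      rfl
    have h3 := m.integral_η_past i hgi
    have h4 : ∀ ω, inner ℝ (m.x n i ω) v * s2.indicator (fun _ => (1 : ℝ)) ω
        = g (m.η i ω, m.past i ω) := by
      intro ω
      simp only [hg, Set.indicator, hs2, Set.mem_ofPred_eq, hε]
      rfl
    simp_rw [h4]
    rw [h3]
    refine integral_congr_ae (Eventually.of_forall fun z => ?_)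
    simp only [hg]
    rw [integral_const_mul]
    congr 1
    have h5 : (fun e => if m.errOf r t e z ≤ 0 then (1 : ℝ) else 0)
        = Set.indicator {e | m.errOf r t e z ≤ 0} 1 := by
      funext e; simp [Set.indicator]
    rw [h5, integral_indicator_one (measurableSet_le (m.measurable_errOf_left r t z)
      measurable_const)]
    rfl
  have h3 : ∫ ω, inner ℝ (m.x n i ω) v * τ ∂P
      = ∫ z, inner ℝ (m.predOf r t z) v * τ ∂m.pastLaw := by
    have := m.integral_past i (g := fun z => inner ℝ (m.predOf r t z) v * τ)
      (((hmom.inner_const v).1).mul_const τ)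
    exact this
  have hi : Integrable (fun z => inner ℝ (m.predOf r t z) v) m.pastLaw :=
    (hmom.inner_const v).integrable (by norm_num)
  simp_rw [mul_sub]
  rw [integral_sub (hi.mul_const τ), ← h2, h1, h3, sub_self]
  refine hi.mul_bdd (c := 1) (m.measurable_cdfOf r t 0).aestronglyMeasurable
    (Eventually.of_forall fun z => ?_)
  have := m.cdfOf_mem r t z 0
  rw [Real.norm_eq_abs, abs_of_nonneg this.1]; exact this.2

/-- The conditions give regularity with uniform constants inside the segments, and the moment bound
at all design points. -/
theorem exists_regularAt (m : PLSProcess Ω A B P p R) (hp : 0 < p) {τ : ℝ}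
    (hquant : m.CondQuantileZero τ) (h1 : m.C1) (h2 : m.C2) (h3 : m.C3) (h4 : m.C4) :
    ∃ (ε₀ M C : ℝ) (a : ℕ → ℝ≥0∞), 0 < ε₀ ∧ 0 ≤ M ∧ 0 ≤ C ∧ ∑' k, a k ≠ ⊤ ∧
      (∀ n i : ℕ, 1 ≤ i → i ≤ n → eLpNorm (m.predOf (m.seg ((i : ℝ) / n)) ((i : ℝ) / n)) 4 m.pastLaw
        ≤ ENNReal.ofReal M) ∧
      ∀ n i : ℕ, 1 ≤ i → i ≤ n → (i : ℝ) / n ∈ m.openSeg (m.seg ((i : ℝ) / n)) →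
        m.RegularAt τ ε₀ M C a (m.seg ((i : ℝ) / n)) ((i : ℝ) / n) := by
  obtain ⟨e1, M1, C1, he1, hexp⟩ := m.exists_expansion hp h2 h3
  obtain ⟨-, hdecH, κ, hκ, M2, hM2⟩ := h1
  obtain ⟨-, -, c, hc, hdecF⟩ := h2
  obtain ⟨e2, he2, hlow⟩ := h4
  set M := max |M1| M2 with hM
  have hM0 : 0 ≤ M := (abs_nonneg M1).trans (le_max_left _ _)
  have hmom : ∀ n i : ℕ, 1 ≤ i → i ≤ n →
      eLpNorm (m.predOf (m.seg ((i : ℝ) / n)) ((i : ℝ) / n)) 4 m.pastLaw ≤ ENNReal.ofReal M := by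
    intro n i hi hin
    have h := hM2 n i hi hin
    rw [← m.eLpNorm_comp_past i (m.measurable_predOf _ _).aestronglyMeasurable]
    have hxm : Measurable (m.x n i) := (m.measurable_predOf _ _).comp (m.measurable_past i)
    refine (eLpNorm_le_eLpNorm_of_exponent_le (q := ENNReal.ofReal (4 + κ)) ?_
      hxm.aestronglyMeasurable).trans (h.trans ?_)
    · rw [show (4 : ℝ≥0∞) = ENNReal.ofReal 4 by simp]
      exact ENNReal.ofReal_le_ofReal (by linarith)
    · rw [← ENNReal.ofReal_coe_nnreal]
      exact ENNReal.ofReal_le_ofReal (le_max_right _ _)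
  have hb : ENNReal.ofReal M + ENNReal.ofReal M + 1 + ENNReal.ofReal M ≠ ⊤ := by simp
  set b := ENNReal.ofReal M + ENNReal.ofReal M + 1 + ENNReal.ofReal M with hbdef
  obtain ⟨a1, ha1, hD1⟩ := hdecH.exists_summable hb
  obtain ⟨a2, ha2, hD2⟩ := (hdecF 0 (Nat.zero_le p)).exists_summable hb
  obtain ⟨a3, ha3, hD3⟩ := (hdecF 1 hp).exists_summable hb
  refine ⟨min e1 e2, M, |C1|, fun k => a1 k + a2 k + a3 k, lt_min he1 he2, hM0, abs_nonneg _, ?_,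
    hmom, ?_⟩
  · rw [ENNReal.tsum_add, ENNReal.tsum_add]
    simp [ha1, ha2, ha3]
  intro n i hi hin ht
  have hquanti := hquant n i hi hin
  have hmomi := hmom n i hi hin
  have hexpi := hexp _ _ ht
  have hmem : MemLp (m.predOf (m.seg ((i : ℝ) / n)) ((i : ℝ) / n)) 4 m.pastLaw :=
    ⟨(m.measurable_predOf _ _).aestronglyMeasurable, hmomi.trans_lt ENNReal.ofReal_lt_top⟩
  have hmz := m.integral_inner_mul_eq_zero n i hquanti.1 hquanti.2 hexpi hmem
  set t := (i : ℝ) / n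
  set r := m.seg t
  have hpast : ∀ k : ℕ, MeasurePreserving (fun w : Ω × Ω => m.past k w.1) (P.prod P) m.pastLaw :=
    fun k => (m.measurePreserving_past k).comp measurePreserving_fst
  have hstar : ∀ k : ℕ, MeasurePreserving (m.pastStar k) (P.prod P) m.pastLaw :=
    fun k => m.measurePreserving_pastStar k
  have hexp' : ∀ᵐ z ∂m.pastLaw, m.Expansion r t (min e1 e2) M |C1| z := by
    filter_upwards [hexpi] with z hz
    exact ⟨(min_le_left _ _).trans hz.le_dens,
      hz.dens_le.trans ((le_abs_self _).trans (le_max_left _ _)),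
      fun s => (hz.abs_sub_le s).trans (by gcongr; exact le_abs_self _)⟩
  have huniv : (P.prod P) Set.univ = 1 := measure_univ
  refine ⟨hexp', hmomi, fun k => ?_, fun k => ?_, fun k => ?_, fun v => ?_, hmz⟩
  · have hm1 := (m.measurable_predOf r t).aestronglyMeasurable (μ := m.pastLaw)
    have hΔ : eLpNorm (fun w : Ω × Ω =>
        m.predOf r t (m.past k w.1) - m.predOf r t (m.pastStar k w)) 4 (P.prod P)
        ≤ m.depMeasureH 4 k := by
      unfold depMeasureH
      exact le_iSup_of_le r (le_iSup₂_of_le (f := fun t (_ : t ∈ m.openSeg r) =>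
        eLpNorm (fun w : Ω × Ω => m.pred r t k w.1 - m.predStar r t k w) 4 (P.prod P)) t ht le_rfl)
    have hB : eLpNorm (fun w : Ω × Ω =>
        m.predOf r t (m.past k w.1) - m.predOf r t (m.pastStar k w)) 4 (P.prod P) ≤ b := by
      refine (eLpNorm_sub_le (hm1.comp_measurePreserving (hpast k))
        (hm1.comp_measurePreserving (hstar k)) (by norm_num)).trans ?_
      rw [eLpNorm_comp_measurePreserving hm1 (hpast k), eLpNorm_comp_measurePreserving hm1 (hstar k)]
      refine (add_le_add hmomi hmomi).trans ?_
      rw [hbdef, add_assoc _ 1]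
      exact le_self_add
    exact (le_min hΔ hB).trans ((hD1 k).trans (by rw [add_assoc]; exact le_self_add))
  · have hΔ : eLpNorm (fun w : Ω × Ω =>
        m.cdfOf r t (m.past k w.1) 0 - m.cdfOf r t (m.pastStar k w) 0) 4 (P.prod P)
        ≤ m.depMeasureF 0 c 4 k := by
      unfold depMeasureF
      refine le_iSup_of_le r (le_iSup₂_of_le t ht (le_iSup₂_of_le 0 (by simpa using hc)
        (le_of_eq ?_)))
      simp only [inner_zero_right]
      unfold condDeriv
      simp only [iteratedDeriv_zero]
      rfl
    have hB : eLpNorm (fun w : Ω × Ω =>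
        m.cdfOf r t (m.past k w.1) 0 - m.cdfOf r t (m.pastStar k w) 0) 4 (P.prod P) ≤ b := by
      refine (eLpNorm_le_of_ae_bound (C := 1) (Eventually.of_forall fun w => ?_)).trans ?_
      · have h5 := m.cdfOf_mem r t (m.past k w.1) 0
        have h6 := m.cdfOf_mem r t (m.pastStar k w) 0
        rw [Real.norm_eq_abs, abs_le]
        constructor <;> linarith [h5.1, h5.2, h6.1, h6.2]
      · rw [huniv, ENNReal.one_rpow, one_mul, ENNReal.ofReal_one, hbdef, add_assoc _ 1]
        exact le_add_left le_self_add
    exact (le_min hΔ hB).trans ((hD2 k).trans (by rw [add_right_comm]; exact le_add_self))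
  · have hΔ : eLpNorm (fun w : Ω × Ω =>
        m.densOf r t (m.past k w.1) - m.densOf r t (m.pastStar k w)) 4 (P.prod P)
        ≤ m.depMeasureF 1 c 4 k := by
      unfold depMeasureF
      refine le_iSup_of_le r (le_iSup₂_of_le t ht (le_iSup₂_of_le 0 (by simpa using hc)
        (le_of_eq ?_)))
      simp only [inner_zero_right]
      rfl
    have hB : eLpNorm (fun w : Ω × Ω =>
        m.densOf r t (m.past k w.1) - m.densOf r t (m.pastStar k w)) 4 (P.prod P) ≤ b := by
      refine (eLpNorm_le_of_ae_bound (C := M) ?_).trans ?_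
      · filter_upwards [(hpast k).quasiMeasurePreserving.ae hexp',
          (hstar k).quasiMeasurePreserving.ae hexp'] with w h5 h6
        have hpos : 0 < min e1 e2 := lt_min he1 he2
        rw [Real.norm_eq_abs, abs_le]
        constructor <;> linarith [h5.1, h5.2, h6.1, h6.2]
      · rw [huniv, ENNReal.one_rpow, one_mul, hbdef]
        exact le_add_self
    exact (le_min hΔ hB).trans ((hD3 k).trans le_add_self)
  · have hl := hlow r t ht
    set S : Matrix (Fin p) (Fin p) ℝ :=
      Matrix.of fun j l : Fin p => ∫ ω, m.pred r t 0 ω j * m.pred r t 0 ω l ∂P with hS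
    have hSh : S.IsHermitian := by
      ext j l
      simp only [hS, Matrix.conjTranspose_apply, Matrix.of_apply, star_trivial]
      exact integral_congr_ae (Eventually.of_forall fun ω => mul_comm _ _)
    have hq := le_quadForm_of_le_smallestEigenvalue hSh hl v
    have hX : MemLp (fun ω => m.pred r t 0 ω) 4 P :=
      hmem.comp_measurePreserving (m.measurePreserving_past 0)
    have hXj : ∀ j, MemLp (fun ω => m.pred r t 0 ω j) 2 P := fun j => by
      refine (hX.norm.mono ?_ (Eventually.of_forall fun ω => ?_)).mono_exponent (by norm_num)
      · have : Measurable fun ω => m.pred r t 0 ω :=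
          (m.measurable_predOf r t).comp (m.measurable_past 0)
        exact (by fun_prop : Measurable fun ω => m.pred r t 0 ω j).aestronglyMeasurable
      · rw [norm_norm]; exact PiLp.norm_apply_le _ j
    have e : ∫ z, inner ℝ (m.predOf r t z) v ^ 2 ∂m.pastLaw = quadForm S v := by
      have e5 := m.integral_past 0 (g := fun z => inner ℝ (m.predOf r t z) v ^ 2)
        ((hmem.inner_const v).1.pow 2)
      rw [← e5, quadForm_eq_sum]
      have e6 : ∀ ω, inner ℝ (m.predOf r t (m.past 0 ω)) v ^ 2
        = ∑ j, ∑ l, m.pred r t 0 ω j * m.pred r t 0 ω l * (v j * v l) :=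
        fun ω => inner_sq_eq_sum _ _
      simp_rw [e6]
      have hint : ∀ j l, Integrable
          (fun ω => m.pred r t 0 ω j * m.pred r t 0 ω l * (v j * v l)) P :=
        fun j l => ((hXj j).integrable_mul (hXj l)).mul_const _
      rw [integral_finsetSum _ fun j _ => integrable_finsetSum _ fun l _ => hint j l]
      refine Finset.sum_congr rfl fun j _ => ?_
      rw [integral_finsetSum _ fun l _ => hint j l]
      refine Finset.sum_congr rfl fun l _ => ?_
      rw [integral_mul_const]
      rfl
    rw [e]
    refine le_trans ?_ hq
    gcongr
    exact min_le_right _ _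

end PLSProcess

/-! ### Moment bounds -/

theorem integral_norm_pow_le {α E : Type*} [MeasurableSpace α] {μ : Measure α}
    [IsProbabilityMeasure μ] [NormedAddCommGroup E] {f : α → E} (hf : AEStronglyMeasurable f μ)
    {M : ℝ} (hM : 0 ≤ M) (h : eLpNorm f 4 μ ≤ ENNReal.ofReal M) {k : ℕ} (hk : k ≤ 4) :
    Integrable (fun x => ‖f x‖ ^ k) μ ∧ ∫ x, ‖f x‖ ^ k ∂μ ≤ M ^ k := by
  rcases Nat.eq_zero_or_pos k with rfl | hk0
  · simp
  have hk4 : (k : ℝ≥0∞) ≤ 4 := by exact_mod_cast hk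
  have h1 : eLpNorm f k μ ≤ ENNReal.ofReal M :=
    (eLpNorm_le_eLpNorm_of_exponent_le hk4 hf).trans h
  have hmem : MemLp f k μ := ⟨hf, h1.trans_lt ENNReal.ofReal_lt_top⟩
  have hk0' : (k : ℝ≥0∞) ≠ 0 := by exact_mod_cast hk0.ne'
  have hint : Integrable (fun x => ‖f x‖ ^ k) μ := by
    exact hmem.integrable_norm_pow hk0.ne'
  refine ⟨hint, ?_⟩
  have h2 := hmem.eLpNorm_eq_integral_rpow_norm hk0' (ENNReal.natCast_ne_top k)
  rw [h2] at h1
  simp only [ENNReal.toReal_natCast, Real.rpow_natCast] at h1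
  have hnn : 0 ≤ ∫ x, ‖f x‖ ^ k ∂μ := integral_nonneg fun x => by positivity
  have h3 := (ENNReal.ofReal_le_ofReal_iff hM).1 h1
  calc ∫ x, ‖f x‖ ^ k ∂μ = ((∫ x, ‖f x‖ ^ k ∂μ) ^ ((k : ℝ)⁻¹)) ^ k := by
        rw [← Real.rpow_natCast, ← Real.rpow_mul hnn, inv_mul_cancel₀ (by exact_mod_cast hk0.ne'),
          Real.rpow_one]
    _ ≤ M ^ k := by gcongr

theorem eLpNorm_one_le_of_integral_abs_le {α : Type*} [MeasurableSpace α] {μ : Measure α}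
    {f : α → ℝ} (hf : Integrable f μ) {c : ℝ} (h : ∫ x, |f x| ∂μ ≤ c) :
    eLpNorm f 1 μ ≤ ENNReal.ofReal c := by
  rw [eLpNorm_one_eq_lintegral_enorm, ← ofReal_integral_norm_eq_lintegral_enorm hf]
  exact ENNReal.ofReal_le_ofReal h

theorem eLpNorm_two_le_of_integral_sq_le {α : Type*} [MeasurableSpace α] {μ : Measure α}
    {f : α → ℝ} (hf : MemLp f 2 μ) {c : ℝ} (hc : 0 ≤ c) (h : ∫ x, f x ^ 2 ∂μ ≤ c ^ 2) :
    eLpNorm f 2 μ ≤ ENNReal.ofReal c := by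
  have h1 : eLpNorm f 2 μ ^ 2 ≤ ENNReal.ofReal c ^ 2 := by
    rw [eLpNorm_two_sq hf, ← ENNReal.ofReal_pow hc]
    exact ENNReal.ofReal_le_ofReal h
  exact (ENNReal.pow_right_strictMono two_ne_zero).le_iff_le.1 h1

instance holderTriple_four_four_two : ENNReal.HolderTriple 4 4 2 where
  inv_add_inv_eq_inv := by
    rw [← ENNReal.toReal_eq_toReal_iff' (by simp) (by simp), ENNReal.toReal_add (by simp) (by simp)]
    simp only [ENNReal.toReal_inv, ENNReal.toReal_ofNat]
    norm_num

namespace PLSProcess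

variable {Ω A B : Type*} [MeasurableSpace Ω] [MeasurableSpace A] [MeasurableSpace B]
  {P : Measure Ω} {p R : ℕ} [IsProbabilityMeasure P]

/-! ### Martingale differences -/

omit [IsProbabilityMeasure P] in
/-- Earlier inputs and histories are functions of a later history. -/
theorem past_of_past (m : PLSProcess Ω A B P p R) {i j : ℕ} (hij : i < j) (ω : Ω) :
    m.η i ω = (m.past j ω).1 (j - 1 - i) ∧
      m.past i ω = (fun l => (m.past j ω).1 (j - i + l), fun l => (m.past j ω).2 (j - i + l)) := by
  refine ⟨?_, Prod.ext ?_ ?_⟩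
  · simp only [past, history]
    congr 1; omega
  · funext l
    simp only [past, history]
    congr 1; omega
  · funext l
    simp only [past, history]
    congr 1; omega

/-- Sums of functions of the current input and the past that are centred in the current input are
orthogonal. -/
theorem integral_sq_sum_eq (m : PLSProcess Ω A B P p R)
    {θ : ℕ → A × ((ℕ → A) × (ℕ → B)) → ℝ} {s : Finset ℕ} (hm : ∀ i ∈ s, Measurable (θ i))
    (hL : ∀ i ∈ s, MemLp (θ i) 2 ((P.map (m.η 0)).prod m.pastLaw))
    (hz : ∀ i ∈ s, ∀ᵐ z ∂m.pastLaw, ∫ e, θ i (e, z) ∂(P.map (m.η 0)) = 0) :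
    MemLp (fun ω => ∑ i ∈ s, θ i (m.η i ω, m.past i ω)) 2 P ∧
    ∫ ω, (∑ i ∈ s, θ i (m.η i ω, m.past i ω)) ^ 2 ∂P
      = ∑ i ∈ s, ∫ w, θ i w ^ 2 ∂((P.map (m.η 0)).prod m.pastLaw) := by
  have hpη := m.isProbabilityMeasure_map_η
  have hmp : ∀ k : ℕ, MeasurePreserving (fun ω => (m.η k ω, m.past k ω)) P
    ((P.map (m.η 0)).prod m.pastLaw) := fun k => m.measurePreserving_η_past k
  have hLp : ∀ i ∈ s, MemLp (fun ω => θ i (m.η i ω, m.past i ω)) 2 P := fun i hi =>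
    (hL i hi).comp_measurePreserving (hmp i)
  refine ⟨memLp_finsetSum _ hLp, ?_⟩
  have hlt : ∀ i ∈ s, ∀ j ∈ s, i < j →
      ∫ ω, θ i (m.η i ω, m.past i ω) * θ j (m.η j ω, m.past j ω) ∂P = 0 := by
    intro i hi j hj hij
    set h : (ℕ → A) × (ℕ → B) → ℝ := fun z =>
      θ i (z.1 (j - 1 - i), (fun l => z.1 (j - i + l), fun l => z.2 (j - i + l))) with hh
    have hhm : Measurable h := (hm i hi).comp (by fun_prop)
    have e1 : ∀ ω, θ i (m.η i ω, m.past i ω) = h (m.past j ω) := by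
      intro ω
      obtain ⟨h1, h2⟩ := m.past_of_past hij ω
      rw [h1, h2]
    have hint : Integrable (fun w : A × ((ℕ → A) × (ℕ → B)) => h w.2 * θ j w)
        ((P.map (m.η 0)).prod m.pastLaw) := by
      have hmm : Measurable fun w : A × ((ℕ → A) × (ℕ → B)) => h w.2 * θ j w :=
        (hhm.comp measurable_snd).mul (hm j hj)
      rw [← (hmp j).map_eq, integrable_map_measure hmm.aestronglyMeasurable
        (hmp j).measurable.aemeasurable]
      refine ((hLp i hi).integrable_mul (hLp j hj)).congr (Eventually.of_forall fun ω => ?_)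
      simp only [Pi.mul_apply, Function.comp_apply, e1]
    have e2 := m.integral_η_past j hint
    simp_rw [e1]
    rw [e2]
    refine integral_eq_zero_of_ae ?_
    filter_upwards [hz j hj] with z hz
    rw [integral_const_mul, hz, mul_zero, Pi.zero_apply]
  have e : ∀ ω, (∑ i ∈ s, θ i (m.η i ω, m.past i ω)) ^ 2
      = ∑ i ∈ s, ∑ j ∈ s, θ i (m.η i ω, m.past i ω) * θ j (m.η j ω, m.past j ω) := fun ω => by
    rw [sq, Finset.sum_mul_sum]
  simp_rw [e]
  have hint : ∀ i ∈ s, ∀ j ∈ s,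
      Integrable (fun ω => θ i (m.η i ω, m.past i ω) * θ j (m.η j ω, m.past j ω)) P :=
    fun i hi j hj => (hLp i hi).integrable_mul (hLp j hj)
  rw [integral_finsetSum _ fun i hi => integrable_finsetSum _ fun j hj => hint i hi j hj]
  refine Finset.sum_congr rfl fun i hi => ?_
  rw [integral_finsetSum _ fun j hj => hint i hi j hj, Finset.sum_eq_single_of_mem i hi]
  · have hae : AEStronglyMeasurable (fun w => θ i w ^ 2)
        (P.map fun ω => (m.η i ω, m.past i ω)) := ((hm i hi).pow_const 2).aestronglyMeasurable
    rw [← (hmp i).map_eq, integral_map (hmp i).measurable.aemeasurable hae]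
    exact integral_congr_ae (Eventually.of_forall fun ω => (sq _).symm)
  · intro j hj hne
    rcases lt_or_gt_of_ne hne with h | h
    · rw [← hlt j hj i hi h]
      exact integral_congr_ae (Eventually.of_forall fun ω => mul_comm _ _)
    · exact hlt i hi j hj h

/-! ### Conditional means of Knight's remainder -/

/-- The conditional mean of Knight's remainder given the past, at a shift that depends on the
past. -/
noncomputable def condKnight (m : PLSProcess Ω A B P p R) (r : Fin (R + 1)) (t : ℝ)
    (v : (ℕ → A) × (ℕ → B) → ℝ) (z : (ℕ → A) × (ℕ → B)) : ℝ :=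
  ∫ e, knightRem (m.errOf r t e z) (v z) ∂(P.map (m.η 0))

omit [IsProbabilityMeasure P] in
theorem measurable_knightRem_errOf (m : PLSProcess Ω A B P p R) (r : Fin (R + 1)) (t : ℝ)
    {v : (ℕ → A) × (ℕ → B) → ℝ} (hv : Measurable v) :
    Measurable fun w : A × ((ℕ → A) × (ℕ → B)) => knightRem (m.errOf r t w.1 w.2) (v w.2) :=
  measurable_knightRem.comp ((m.measurable_errOf r t).prodMk (hv.comp measurable_snd))

theorem measurable_condKnight (m : PLSProcess Ω A B P p R) (r : Fin (R + 1)) (t : ℝ)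
    {v : (ℕ → A) × (ℕ → B) → ℝ} (hv : Measurable v) : Measurable (m.condKnight r t v) := by
  have hpη := m.isProbabilityMeasure_map_η
  exact (StronglyMeasurable.integral_prod_left
    (m.measurable_knightRem_errOf r t hv).stronglyMeasurable).measurable

omit [IsProbabilityMeasure P] in
theorem condKnight_nonneg (m : PLSProcess Ω A B P p R) (r : Fin (R + 1)) (t : ℝ)
    (v : (ℕ → A) × (ℕ → B) → ℝ) (z : (ℕ → A) × (ℕ → B)) : 0 ≤ m.condKnight r t v z :=
  integral_nonneg fun _ => knightRem_nonneg _ _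

theorem integrable_knightRem_left (m : PLSProcess Ω A B P p R) (r : Fin (R + 1)) (t y : ℝ)
    (z : (ℕ → A) × (ℕ → B)) :
    Integrable (fun e => knightRem (m.errOf r t e z) y) (P.map (m.η 0)) := by
  have hpη := m.isProbabilityMeasure_map_η
  have h1 : Measurable fun e => knightRem (m.errOf r t e z) y :=
    measurable_knightRem.comp ((m.measurable_errOf_left r t z).prodMk measurable_const)
  refine Integrable.of_bound (C := |y|) h1.aestronglyMeasurable (Eventually.of_forall fun e => ?_)
  rw [Real.norm_eq_abs, abs_of_nonneg (knightRem_nonneg _ _)]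
  exact knightRem_le _ _

theorem condKnight_le (m : PLSProcess Ω A B P p R) (r : Fin (R + 1)) (t : ℝ)
    (v : (ℕ → A) × (ℕ → B) → ℝ) (z : (ℕ → A) × (ℕ → B)) : m.condKnight r t v z ≤ |v z| := by
  have hpη := m.isProbabilityMeasure_map_η
  have := integral_mono (m.integrable_knightRem_left r t (v z) z) (integrable_const |v z|)
    fun e => knightRem_le _ _
  unfold condKnight
  simpa using this

/-- The conditional mean of Knight's remainder is quadratic up to third order. -/
theorem Expansion.abs_condKnight_sub_le {m : PLSProcess Ω A B P p R} {r : Fin (R + 1)}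
    {t ε₀ M C : ℝ} {z : (ℕ → A) × (ℕ → B)} (h : m.Expansion r t ε₀ M C z)
    (v : (ℕ → A) × (ℕ → B) → ℝ) :
    |m.condKnight r t v z - m.densOf r t z * v z ^ 2 / 2| ≤ C * |v z| ^ 3 := by
  have h1 := abs_integral_knightRem_sub_le h.abs_condLaw (v z)
  unfold condLaw at h1
  rw [integral_map (m.measurable_errOf_left r t z).aemeasurable] at h1
  · exact h1
  · exact (measurable_knightRem.comp (measurable_id.prodMk measurable_const)).aestronglyMeasurable

theorem Expansion.condKnight_le {m : PLSProcess Ω A B P p R} {r : Fin (R + 1)}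
    {t ε₀ M C : ℝ} {z : (ℕ → A) × (ℕ → B)} (h : m.Expansion r t ε₀ M C z)
    (v : (ℕ → A) × (ℕ → B) → ℝ) :
    m.condKnight r t v z ≤ M * |v z| ^ 2 + C * |v z| ^ 3 := by
  have h1 := (abs_le.1 (h.abs_condKnight_sub_le v)).2
  have h2 : m.densOf r t z * v z ^ 2 ≤ M * |v z| ^ 2 := by
    rw [sq_abs]; gcongr; exact h.dens_le
  rcases le_or_gt 0 (m.densOf r t z) with h4 | h4
  · have : 0 ≤ m.densOf r t z * v z ^ 2 := by positivity
    linarith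
  · have h5 := (m.monotone_cdfOf r t z).deriv_nonneg (x := (0 : ℝ))
    rw [← m.densOf_eq_deriv] at h5
    linarith

/-- The conditional distribution function has no atom at `0`, so that the mean of `ψ_τ(ε_i)` given
the past is `τ - F(0 | past)`. -/
theorem Expansion.measureReal_Iio {m : PLSProcess Ω A B P p R} {r : Fin (R + 1)}
    {t ε₀ M C : ℝ} {z : (ℕ → A) × (ℕ → B)} (h : m.Expansion r t ε₀ M C z) :
    ∫ e, (if m.errOf r t e z < 0 then (1 : ℝ) else 0) ∂(P.map (m.η 0)) = m.cdfOf r t z 0 := by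
  have h0 := measure_singleton_zero_of_expansion h.abs_condLaw
  have e1 : (fun e => if m.errOf r t e z < 0 then (1 : ℝ) else 0)
      = Set.indicator ((fun e => m.errOf r t e z) ⁻¹' Set.Iio 0) 1 := by
    funext e; simp [Set.indicator]
  have hm := m.measurable_errOf_left r t z
  rw [e1, integral_indicator_one (hm measurableSet_Iio),
    ← map_measureReal_apply hm measurableSet_Iio, m.cdfOf_eq]
  change (m.condLaw r t z).real _ = _
  refine measureReal_congr ?_
  have : ∀ᵐ d ∂(m.condLaw r t z), d ≠ 0 := by rw [ae_iff]; simpa using h0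
  filter_upwards [this] with d hd
  exact propext ⟨fun h => le_of_lt h, fun h => lt_of_le_of_ne h hd⟩

end PLSProcess

/-! ### Norm inequalities -/

theorem eLpNorm_le_add_of_ae_le {α E₁ E₂ : Type*} [MeasurableSpace α] {μ : Measure α}
    [NormedAddCommGroup E₁] [NormedAddCommGroup E₂] {f : α → ℝ} {g₁ : α → E₁} {g₂ : α → E₂}
    (h₁ : AEStronglyMeasurable g₁ μ) (h₂ : AEStronglyMeasurable g₂ μ) {c₁ c₂ : ℝ} (hc₁ : 0 ≤ c₁)
    (hc₂ : 0 ≤ c₂) (h : ∀ᵐ x ∂μ, |f x| ≤ c₁ * ‖g₁ x‖ + c₂ * ‖g₂ x‖) {q : ℝ≥0∞} (hq : 1 ≤ q) :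
    eLpNorm f q μ ≤ ENNReal.ofReal c₁ * eLpNorm g₁ q μ + ENNReal.ofReal c₂ * eLpNorm g₂ q μ := by
  have h3 : eLpNorm f q μ ≤ eLpNorm ((c₁ • fun x => ‖g₁ x‖) + c₂ • fun x => ‖g₂ x‖) q μ := by
    refine eLpNorm_mono_ae_real ?_
    filter_upwards [h] with x hx
    simpa using hx
  refine h3.trans ((eLpNorm_add_le (h₁.norm.const_smul c₁) (h₂.norm.const_smul c₂) hq).trans ?_)
  rw [eLpNorm_const_smul, eLpNorm_const_smul, eLpNorm_norm, eLpNorm_norm,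
    Real.enorm_eq_ofReal hc₁, Real.enorm_eq_ofReal hc₂]

theorem le_ofReal_sqrt_mul {x T : ℝ≥0∞} {k N : ℕ} (h : x ^ 2 ≤ k * T ^ 2) (hT : T ≠ ⊤)
    (hk : k ≤ N) : x ≤ ENNReal.ofReal (√N * T.toReal) := by
  rw [← ENNReal.pow_le_pow_left_iff two_ne_zero, ← ENNReal.ofReal_pow (by positivity), mul_pow,
    Real.sq_sqrt (by positivity), ENNReal.ofReal_mul (by positivity), ENNReal.ofReal_natCast,
    ENNReal.ofReal_pow ENNReal.toReal_nonneg, ENNReal.ofReal_toReal hT]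
  refine h.trans ?_
  gcongr

/-! ### Truncation -/

/-- Truncation of a real number at `-B` and `B`. -/
noncomputable def clip (B y : ℝ) : ℝ := max (-B) (min y B)

theorem abs_clip_le {B : ℝ} (hB : 0 ≤ B) (y : ℝ) : |clip B y| ≤ B := by
  unfold clip
  rw [abs_le]
  exact ⟨le_max_left _ _, max_le (by linarith) (min_le_right _ _)⟩

theorem abs_clip_sub_le (B y y' : ℝ) : |clip B y - clip B y'| ≤ |y - y'| := by
  unfold clip
  rw [max_comm, max_comm (-B)]
  exact (abs_max_sub_max_le_abs _ _ _).trans (abs_inf_sub_inf_le_abs _ _ _)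

theorem sq_sub_clip_sq {B : ℝ} (hB : 0 < B) (y : ℝ) :
    0 ≤ y ^ 2 - clip B y ^ 2 ∧ y ^ 2 - clip B y ^ 2 ≤ y ^ 4 / B ^ 2 := by
  have h0 : 0 ≤ y ^ 4 / B ^ 2 := by positivity
  by_cases h : |y| ≤ B
  · have hc : clip B y = y := by
      rw [abs_le] at h
      unfold clip
      rw [min_eq_left h.2, max_eq_right h.1]
    rw [hc]; constructor <;> linarith
  · rw [not_le] at h
    have hc : clip B y ^ 2 ≤ B ^ 2 := by
      rw [← sq_abs (clip B y)]; have := abs_clip_le hB.le y; gcongr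
    have hy : B ^ 2 ≤ y ^ 2 := by rw [← sq_abs y]; gcongr
    refine ⟨by linarith, ?_⟩
    have : y ^ 2 ≤ y ^ 4 / B ^ 2 := by
      rw [le_div_iff₀ (by positivity)]
      nlinarith [sq_nonneg y]
    nlinarith [sq_nonneg (clip B y)]

theorem measurable_clip (B : ℝ) : Measurable (clip B) := by unfold clip; fun_prop

namespace PLSProcess

variable {Ω A B : Type*} [MeasurableSpace Ω] [MeasurableSpace A] [MeasurableSpace B]
  {P : Measure Ω} {p R : ℕ} [IsProbabilityMeasure P]

/-! ### The score -/

section RegularAt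

variable {m : PLSProcess Ω A B P p R} {τ ε₀ M C : ℝ} {a : ℕ → ℝ≥0∞} {r : Fin (R + 1)} {t : ℝ}

omit [IsProbabilityMeasure P] in
theorem RegularAt.memLp (h : m.RegularAt τ ε₀ M C a r t) : MemLp (m.predOf r t) 4 m.pastLaw :=
  ⟨(m.measurable_predOf r t).aestronglyMeasurable, h.moment.trans_lt ENNReal.ofReal_lt_top⟩

theorem RegularAt.integral_abs_inner_pow_le (h : m.RegularAt τ ε₀ M C a r t) (hM : 0 ≤ M)
    (v : EuclideanSpace ℝ (Fin p)) {k : ℕ} (hk : k ≤ 4) :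
    Integrable (fun z => |inner ℝ (m.predOf r t z) v| ^ k) m.pastLaw ∧
      ∫ z, |inner ℝ (m.predOf r t z) v| ^ k ∂m.pastLaw ≤ (M * ‖v‖) ^ k := by
  obtain ⟨h1, h2⟩ := integral_norm_pow_le h.memLp.1 hM h.moment hk
  have hle : ∀ z, |inner ℝ (m.predOf r t z) v| ^ k ≤ ‖m.predOf r t z‖ ^ k * ‖v‖ ^ k := fun z => by
    rw [← mul_pow]; have := abs_real_inner_le_norm (m.predOf r t z) v; gcongr
  have hi : Integrable (fun z => |inner ℝ (m.predOf r t z) v| ^ k) m.pastLaw := by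
    refine (h1.mul_const (‖v‖ ^ k)).mono' ?_ (Eventually.of_forall fun z => ?_)
    · have := m.measurable_predOf r t
      exact (by fun_prop : Measurable fun z =>
        |inner ℝ (m.predOf r t z) v| ^ k).aestronglyMeasurable
    · rw [Real.norm_eq_abs, abs_of_nonneg (by positivity)]; exact hle z
  refine ⟨hi, (integral_mono hi (h1.mul_const _) hle).trans ?_⟩
  rw [integral_mul_const, mul_pow]
  gcongr

/-- The conditional mean of the score inherits the short memory of its two factors. -/
theorem RegularAt.dep_score (h : m.RegularAt τ ε₀ M C a r t) (hM : 0 ≤ M) (hτ₀ : 0 < τ)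
    (hτ₁ : τ < 1) (v : EuclideanSpace ℝ (Fin p)) (k : ℕ) :
    eLpNorm (fun w : Ω × Ω =>
      inner ℝ (m.predOf r t (m.past k w.1)) v * (τ - m.cdfOf r t (m.past k w.1) 0)
        - inner ℝ (m.predOf r t (m.pastStar k w)) v * (τ - m.cdfOf r t (m.pastStar k w) 0)) 2
        (P.prod P) ≤ ENNReal.ofReal (‖v‖ * (1 + M)) * a k := by
  have hpast : MeasurePreserving (fun w : Ω × Ω => m.past k w.1) (P.prod P) m.pastLaw :=
    (m.measurePreserving_past k).comp measurePreserving_fst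
  have hstar : MeasurePreserving (m.pastStar k) (P.prod P) m.pastLaw :=
    m.measurePreserving_pastStar k
  have mp := m.measurable_predOf r t
  have mc := m.measurable_cdfOf r t 0
  have mΔ : Measurable fun w : Ω × Ω =>
      m.predOf r t (m.past k w.1) - m.predOf r t (m.pastStar k w) :=
    (mp.comp hpast.measurable).sub (mp.comp hstar.measurable)
  have mX : Measurable fun w : Ω × Ω => ‖m.predOf r t (m.pastStar k w)‖ :=
    (mp.comp hstar.measurable).norm
  have mF : Measurable fun w : Ω × Ω =>
      m.cdfOf r t (m.past k w.1) 0 - m.cdfOf r t (m.pastStar k w) 0 :=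
    (mc.comp hpast.measurable).sub (mc.comp hstar.measurable)
  have h1 := eLpNorm_le_add_of_ae_le (q := 2) (μ := P.prod P) mΔ.aestronglyMeasurable
    (mX.smul mF).aestronglyMeasurable (norm_nonneg v) (norm_nonneg v)
    (f := fun w : Ω × Ω =>
      inner ℝ (m.predOf r t (m.past k w.1)) v * (τ - m.cdfOf r t (m.past k w.1) 0)
        - inner ℝ (m.predOf r t (m.pastStar k w)) v * (τ - m.cdfOf r t (m.pastStar k w) 0))
    (Eventually.of_forall fun w => by
      set x := m.predOf r t (m.past k w.1)
      set x' := m.predOf r t (m.pastStar k w)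
      set F := m.cdfOf r t (m.past k w.1) 0 with hF
      set F' := m.cdfOf r t (m.pastStar k w) 0
      have hF01 := m.cdfOf_mem r t (m.past k w.1) 0
      rw [← hF] at hF01
      have e : inner ℝ x v * (τ - F) - inner ℝ x' v * (τ - F')
          = inner ℝ (x - x') v * (τ - F) - inner ℝ x' v * (F - F') := by
        rw [inner_sub_left]; ring
      have b1 : |τ - F| ≤ 1 := by rw [abs_le]; constructor <;> linarith [hF01.1, hF01.2]
      have b2 := abs_real_inner_le_norm (x - x') v
      have b3 := abs_real_inner_le_norm x' v
      rw [e]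
      calc _ ≤ |inner ℝ (x - x') v * (τ - F)| + |inner ℝ x' v * (F - F')| := abs_sub _ _
        _ ≤ ‖x - x'‖ * ‖v‖ * 1 + ‖x'‖ * ‖v‖ * |F - F'| := by
            rw [abs_mul, abs_mul]; gcongr
        _ = _ := by
            simp only [Pi.smul_apply', norm_smul, abs_norm, Real.norm_eq_abs]; ring) one_le_two
  have h2 : eLpNorm ((fun w : Ω × Ω => ‖m.predOf r t (m.pastStar k w)‖) • fun w : Ω × Ω =>
      m.cdfOf r t (m.past k w.1) 0 - m.cdfOf r t (m.pastStar k w) 0) 2 (P.prod P)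
      ≤ ENNReal.ofReal M * a k := by
    refine (eLpNorm_smul_le_mul_eLpNorm (p := 4) (q := 4) mF.aestronglyMeasurable
      mX.aestronglyMeasurable).trans ?_
    gcongr
    · rw [eLpNorm_norm]
      have := eLpNorm_comp_measurePreserving (p := 4) h.memLp.1 hstar
      exact this.le.trans h.moment
    · exact h.dep_cdf k
  have h3 : eLpNorm (fun w : Ω × Ω =>
      m.predOf r t (m.past k w.1) - m.predOf r t (m.pastStar k w)) 2 (P.prod P) ≤ a k :=
    (eLpNorm_le_eLpNorm_of_exponent_le (by norm_num) mΔ.aestronglyMeasurable).trans (h.dep_pred k)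
  refine h1.trans ((add_le_add (mul_le_mul_right h3 _) (mul_le_mul_right h2 _)).trans ?_)
  rw [mul_add, mul_one]
  rw [ENNReal.ofReal_add (norm_nonneg _) (by positivity), ENNReal.ofReal_mul (norm_nonneg _),
    add_mul, mul_assoc]

end RegularAt

/-! ### Sums over the sample -/

/-- A bound in mean that ignores the dependence between the summands. -/
theorem eLpNorm_one_sum_le (m : PLSProcess Ω A B P p R)
    {f : ℕ → A × ((ℕ → A) × (ℕ → B)) → ℝ} {s : Finset ℕ} {N : ℕ} (hs : s.card ≤ N)
    (hf : ∀ i ∈ s, Integrable (f i) ((P.map (m.η 0)).prod m.pastLaw)) {c : ℝ}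
    (h : ∀ i ∈ s, ∫ w, |f i w| ∂((P.map (m.η 0)).prod m.pastLaw) ≤ c) :
    eLpNorm (fun ω => ∑ i ∈ s, f i (m.η i ω, m.past i ω)) 1 P ≤ ENNReal.ofReal (N * c) := by
  have hmp : ∀ k : ℕ, MeasurePreserving (fun ω => (m.η k ω, m.past k ω)) P
    ((P.map (m.η 0)).prod m.pastLaw) := fun k => m.measurePreserving_η_past k
  have e : (fun ω => ∑ i ∈ s, f i (m.η i ω, m.past i ω))
      = ∑ i ∈ s, fun ω => f i (m.η i ω, m.past i ω) := by
    funext ω; rw [Finset.sum_apply]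
  rw [e]
  refine (eLpNorm_sum_le (fun i hi => ((hmp i).integrable_comp_of_integrable (hf i hi)).1)
    le_rfl).trans ?_
  have h1 : ∀ i ∈ s, eLpNorm (fun ω => f i (m.η i ω, m.past i ω)) 1 P ≤ ENNReal.ofReal c := by
    intro i hi
    have := eLpNorm_comp_measurePreserving (p := 1) (hf i hi).1 (hmp i)
    exact this.le.trans (eLpNorm_one_le_of_integral_abs_le (hf i hi) (h i hi))
  refine (Finset.sum_le_sum h1).trans ?_
  rw [Finset.sum_const, nsmul_eq_mul, ENNReal.ofReal_mul (by positivity), ENNReal.ofReal_natCast]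
  gcongr

theorem eLpNorm_one_sum_past_le (m : PLSProcess Ω A B P p R)
    {f : ℕ → (ℕ → A) × (ℕ → B) → ℝ} {s : Finset ℕ} {N : ℕ} (hs : s.card ≤ N)
    (hf : ∀ i ∈ s, Integrable (f i) m.pastLaw) {c : ℝ}
    (h : ∀ i ∈ s, ∫ z, |f i z| ∂m.pastLaw ≤ c) :
    eLpNorm (fun ω => ∑ i ∈ s, f i (m.past i ω)) 1 P ≤ ENNReal.ofReal (N * c) := by
  have hpη := m.isProbabilityMeasure_map_η
  refine m.eLpNorm_one_sum_le (f := fun i w => f i w.2) hs (fun i hi => (hf i hi).comp_snd _)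
    fun i hi => ?_
  rw [integral_fun_snd (fun z => |f i z|), probReal_univ, one_smul]
  exact h i hi

/-- The normalized score is bounded in `L²`: its martingale part by orthogonality, its predictable
part by weak dependence. -/
theorem eLpNorm_score_le (m : PLSProcess Ω A B P p R) {τ ε₀ M C : ℝ} {a : ℕ → ℝ≥0∞}
    (hM : 0 ≤ M) (hτ₀ : 0 < τ) (hτ₁ : τ < 1) (ha : ∑' k, a k ≠ ⊤)
    {s : Finset ℕ} {N : ℕ} (hs : s.card ≤ N) {r : ℕ → Fin (R + 1)} {t : ℕ → ℝ}
    (hreg : ∀ i ∈ s, m.RegularAt τ ε₀ M C a (r i) (t i)) (v : EuclideanSpace ℝ (Fin p)) :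
    eLpNorm (fun ω => ∑ i ∈ s, inner ℝ (m.predOf (r i) (t i) (m.past i ω)) v
      * checkDeriv τ (m.errOf (r i) (t i) (m.η i ω) (m.past i ω))) 2 P
      ≤ ENNReal.ofReal (√N * (‖v‖ * (M + (1 + M) * (∑' k, a k).toReal))) := by
  have hpη := m.isProbabilityMeasure_map_η
  set θ : ℕ → A × ((ℕ → A) × (ℕ → B)) → ℝ := fun i w => inner ℝ (m.predOf (r i) (t i) w.2) v
    * (m.cdfOf (r i) (t i) w.2 0 - if m.errOf (r i) (t i) w.1 w.2 < 0 then 1 else 0) with hθ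
  set g : ℕ → (ℕ → A) × (ℕ → B) → ℝ := fun i z => inner ℝ (m.predOf (r i) (t i) z) v
    * (τ - m.cdfOf (r i) (t i) z 0) with hg
  have hinm : ∀ i, Measurable fun z => inner ℝ (m.predOf (r i) (t i) z) v := fun i => by
    have := m.measurable_predOf (r i) (t i)
    fun_prop
  have hind : ∀ i, Measurable fun w : A × ((ℕ → A) × (ℕ → B)) =>
      (if m.errOf (r i) (t i) w.1 w.2 < 0 then (1 : ℝ) else 0) := fun i =>
    Measurable.ite (measurableSet_lt (m.measurable_errOf _ _) measurable_const)
      measurable_const measurable_const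
  have hθm : ∀ i, Measurable (θ i) := fun i =>
    ((hinm i).comp measurable_snd).mul
      (((m.measurable_cdfOf (r i) (t i) 0).comp measurable_snd).sub (hind i))
  have hgm : ∀ i, Measurable (g i) := fun i =>
    (hinm i).mul (measurable_const.sub (m.measurable_cdfOf (r i) (t i) 0))
  have hin2 : ∀ i ∈ s, MemLp (fun z => inner ℝ (m.predOf (r i) (t i) z) v) 2 m.pastLaw :=
    fun i hi => ((hreg i hi).memLp.inner_const v).mono_exponent (by norm_num)
  have hθle : ∀ i w, |θ i w| ≤ |inner ℝ (m.predOf (r i) (t i) w.2) v| := by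
    intro i w
    rw [hθ, abs_mul]
    have h1 := m.cdfOf_mem (r i) (t i) w.2 0
    refine mul_le_of_le_one_right (abs_nonneg _) ?_
    split_ifs <;> rw [abs_le] <;> constructor <;> linarith [h1.1, h1.2]
  have hgle : ∀ i z, |g i z| ≤ |inner ℝ (m.predOf (r i) (t i) z) v| := by
    intro i z
    rw [hg, abs_mul]
    have h1 := m.cdfOf_mem (r i) (t i) z 0
    refine mul_le_of_le_one_right (abs_nonneg _) ?_
    rw [abs_le]; constructor <;> linarith [h1.1, h1.2]
  have hin2' : ∀ i ∈ s, MemLp (fun w : A × ((ℕ → A) × (ℕ → B)) =>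
      inner ℝ (m.predOf (r i) (t i) w.2) v) 2 ((P.map (m.η 0)).prod m.pastLaw) :=
    fun i hi => (hin2 i hi).comp_measurePreserving measurePreserving_snd
  have hθ2 : ∀ i ∈ s, MemLp (θ i) 2 ((P.map (m.η 0)).prod m.pastLaw) := fun i hi =>
    (hin2' i hi).mono (hθm i).aestronglyMeasurable (Eventually.of_forall fun w => by
      simpa only [Real.norm_eq_abs] using hθle i w)
  have hg2 : ∀ i ∈ s, MemLp (g i) 2 m.pastLaw := fun i hi =>
    (hin2 i hi).mono (hgm i).aestronglyMeasurable (Eventually.of_forall fun z => by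
      simpa only [Real.norm_eq_abs] using hgle i z)
  have hmart := m.integral_sq_sum_eq (fun i _ => hθm i) hθ2 fun i hi => by
    filter_upwards [(hreg i hi).expansion] with z hz
    simp only [hθ]
    rw [integral_const_mul, integral_sub (integrable_const _), hz.measureReal_Iio, integral_const,
      probReal_univ, one_smul, sub_self, mul_zero]
    refine Integrable.of_bound (C := 1)
      ((hind i).comp measurable_prodMk_right).aestronglyMeasurable
      (Eventually.of_forall fun e => ?_)
    change ‖(if m.errOf (r i) (t i) e z < 0 then (1 : ℝ) else 0)‖ ≤ 1
    split_ifs <;> simp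
  have hsq : ∀ i ∈ s, ∫ w, θ i w ^ 2 ∂((P.map (m.η 0)).prod m.pastLaw) ≤ (M * ‖v‖) ^ 2 := by
    intro i hi
    obtain ⟨h1, h2⟩ := (hreg i hi).integral_abs_inner_pow_le hM v (k := 2) (by norm_num)
    refine (integral_mono (hθ2 i hi).integrable_sq (h1.comp_snd _) fun w => ?_).trans
      (le_trans (le_of_eq ?_) h2)
    · change θ i w ^ 2 ≤ |inner ℝ (m.predOf (r i) (t i) w.2) v| ^ 2
      rw [← sq_abs (θ i w)]
      have := hθle i w
      gcongr
    · rw [integral_fun_snd (fun z => |inner ℝ (m.predOf (r i) (t i) z) v| ^ 2), probReal_univ,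
        one_smul]
  have hA : eLpNorm (fun ω => ∑ i ∈ s, θ i (m.η i ω, m.past i ω)) 2 P
      ≤ ENNReal.ofReal (√N * (M * ‖v‖)) := by
    refine eLpNorm_two_le_of_integral_sq_le hmart.1 (by positivity) ?_
    rw [hmart.2, mul_pow, Real.sq_sqrt (by positivity)]
    refine (Finset.sum_le_sum hsq).trans ?_
    rw [Finset.sum_const, nsmul_eq_mul]
    gcongr
  have hB : eLpNorm (fun ω => ∑ i ∈ s, g i (m.past i ω)) 2 P
      ≤ ENNReal.ofReal (√N * (‖v‖ * (1 + M) * (∑' k, a k).toReal)) := by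
    have h1 := m.eLpNorm_sum_sub_integral_sq_le (fun i _ => hgm i) hg2
      (a := fun k => ENNReal.ofReal (‖v‖ * (1 + M)) * a k)
      fun i hi k => (hreg i hi).dep_score hM hτ₀ hτ₁ v k
    have h0 : ∫ ω, ∑ i ∈ s, g i (m.past i ω) ∂P = 0 := by
      rw [integral_finsetSum]
      · refine Finset.sum_eq_zero fun i hi => ?_
        rw [m.integral_past i (hgm i).aestronglyMeasurable]
        exact (hreg i hi).mean_zero v
      · exact fun i hi => ((hg2 i hi).comp_measurePreserving
          (m.measurePreserving_past i)).integrable one_le_two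
    rw [h0, ENNReal.tsum_mul_left] at h1
    simp only [sub_zero] at h1
    have h2 := le_ofReal_sqrt_mul h1 (ENNReal.mul_ne_top ENNReal.ofReal_ne_top ha) hs
    rwa [ENNReal.toReal_mul, ENNReal.toReal_ofReal (by positivity)] at h2
  have e : (fun ω => ∑ i ∈ s, inner ℝ (m.predOf (r i) (t i) (m.past i ω)) v
      * checkDeriv τ (m.errOf (r i) (t i) (m.η i ω) (m.past i ω)))
      = (fun ω => ∑ i ∈ s, θ i (m.η i ω, m.past i ω)) + fun ω => ∑ i ∈ s, g i (m.past i ω) := by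
    funext ω
    rw [Pi.add_apply, ← Finset.sum_add_distrib]
    refine Finset.sum_congr rfl fun i _ => ?_
    simp only [hθ, hg, checkDeriv]; ring
  rw [e]
  refine (eLpNorm_add_le ?_ ?_ one_le_two).trans ((add_le_add hA hB).trans ?_)
  · exact hmart.1.1
  · exact (Finset.measurable_fun_sum s fun i _ =>
      (hgm i).comp (m.measurable_past i)).aestronglyMeasurable
  · rw [← ENNReal.ofReal_add (by positivity) (by positivity)]
    exact ENNReal.ofReal_le_ofReal (le_of_eq (by ring))

end PLSProcess

/-! ### Local behaviour of Knight's remainder -/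

/-- The probability of a small error is controlled by Knight's remainders at `2 w` and `-2 w`: for
`0 ≤ e ≤ w` the former is at least `w`, and for `-w ≤ e < 0` the latter is. -/
theorem mul_indicator_le_knightRem {e w : ℝ} :
    w * (if |e| ≤ w then 1 else 0) ≤ knightRem e (2 * w) + knightRem e (-(2 * w)) := by
  split_ifs with h
  · rw [mul_one]
    rw [abs_le] at h
    by_cases he : 0 ≤ e
    · have h1 : knightRem e (2 * w) = max (2 * w - e) 0 := by simp [knightRem, he]
      have h2 := knightRem_nonneg e (-(2 * w))
      have h3 := le_max_left (2 * w - e) 0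
      linarith [h.2]
    · have h1 : knightRem e (-(2 * w)) = max (e - -(2 * w)) 0 := by simp [knightRem, he]
      have h2 := knightRem_nonneg e (2 * w)
      have h3 := le_max_left (e - -(2 * w)) 0
      linarith [h.1]
  · rw [mul_zero]
    exact add_nonneg (knightRem_nonneg _ _) (knightRem_nonneg _ _)

namespace PLSProcess

variable {Ω A B : Type*} [MeasurableSpace Ω] [MeasurableSpace A] [MeasurableSpace B]
  {P : Measure Ω} {p R : ℕ} [IsProbabilityMeasure P]

section RegularAt

variable {m : PLSProcess Ω A B P p R} {τ ε₀ M C : ℝ} {a : ℕ → ℝ≥0∞} {r : Fin (R + 1)} {t : ℝ}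

theorem densOf_nonneg (m : PLSProcess Ω A B P p R) (r : Fin (R + 1)) (t : ℝ)
    (z : (ℕ → A) × (ℕ → B)) : 0 ≤ m.densOf r t z := by
  have h5 := (m.monotone_cdfOf r t z).deriv_nonneg (x := (0 : ℝ))
  rwa [← m.densOf_eq_deriv] at h5

/-- Moments of the rescaled predictors. -/
theorem RegularAt.integral_abs_mul_inner_pow_le (h : m.RegularAt τ ε₀ M C a r t) (hM : 0 ≤ M)
    (u : EuclideanSpace ℝ (Fin p)) {σ : ℝ} (hσ : 0 ≤ σ) {k : ℕ} (hk : k ≤ 4) :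
    Integrable (fun z => |σ * inner ℝ (m.predOf r t z) u| ^ k) m.pastLaw ∧
      ∫ z, |σ * inner ℝ (m.predOf r t z) u| ^ k ∂m.pastLaw ≤ (σ * (M * ‖u‖)) ^ k := by
  obtain ⟨h1, h2⟩ := h.integral_abs_inner_pow_le hM u hk
  simp_rw [abs_mul, abs_of_nonneg hσ, mul_pow]
  refine ⟨h1.const_mul _, ?_⟩
  rw [integral_const_mul, ← mul_pow]
  gcongr

/-- The conditional variance of Knight's remainder is of third order. -/
theorem RegularAt.memLp_knightRem_sub (h : m.RegularAt τ ε₀ M C a r t) (hM : 0 ≤ M) (hC : 0 ≤ C)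
    (u : EuclideanSpace ℝ (Fin p)) {σ : ℝ} (hσ : 0 ≤ σ) (hσ1 : σ ≤ 1) :
    MemLp (fun w : A × ((ℕ → A) × (ℕ → B)) =>
      knightRem (m.errOf r t w.1 w.2) (σ * inner ℝ (m.predOf r t w.2) u)
        - m.condKnight r t (fun z => σ * inner ℝ (m.predOf r t z) u) w.2) 2
      ((P.map (m.η 0)).prod m.pastLaw) ∧
    ∫ w : A × ((ℕ → A) × (ℕ → B)),
      (knightRem (m.errOf r t w.1 w.2) (σ * inner ℝ (m.predOf r t w.2) u)
        - m.condKnight r t (fun z => σ * inner ℝ (m.predOf r t z) u) w.2) ^ 2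
      ∂((P.map (m.η 0)).prod m.pastLaw)
      ≤ σ ^ 3 * (2 * (M * (M * ‖u‖) ^ 3 + C * (M * ‖u‖) ^ 4)) := by
  have hpη := m.isProbabilityMeasure_map_η
  set y : (ℕ → A) × (ℕ → B) → ℝ := fun z => σ * inner ℝ (m.predOf r t z) u with hy
  have hym : Measurable y := by
    have := m.measurable_predOf r t
    simp only [hy]; fun_prop
  have hrm := m.measurable_knightRem_errOf r t hym
  have hcm := m.measurable_condKnight r t hym
  have hθm : Measurable fun w : A × ((ℕ → A) × (ℕ → B)) =>
      knightRem (m.errOf r t w.1 w.2) (y w.2) - m.condKnight r t y w.2 :=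
    hrm.sub (hcm.comp measurable_snd)
  have hy2 : MemLp y 2 m.pastLaw :=
    ((h.memLp.inner_const u).mono_exponent (by norm_num)).const_mul σ
  have hy2' : MemLp (fun w : A × ((ℕ → A) × (ℕ → B)) => y w.2) 2
      ((P.map (m.η 0)).prod m.pastLaw) := hy2.comp_measurePreserving measurePreserving_snd
  have hL : MemLp (fun w : A × ((ℕ → A) × (ℕ → B)) =>
      knightRem (m.errOf r t w.1 w.2) (y w.2) - m.condKnight r t y w.2) 2
      ((P.map (m.η 0)).prod m.pastLaw) := by
    refine hy2'.mono hθm.aestronglyMeasurable (Eventually.of_forall fun w => ?_)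
    rw [Real.norm_eq_abs, Real.norm_eq_abs, abs_le]
    have h1 := knightRem_nonneg (m.errOf r t w.1 w.2) (y w.2)
    have h2 := knightRem_le (m.errOf r t w.1 w.2) (y w.2)
    have h3 := m.condKnight_nonneg r t y w.2
    have h4 := m.condKnight_le r t y w.2
    constructor <;> linarith
  refine ⟨hL, ?_⟩
  have hkL : MemLp (fun w : A × ((ℕ → A) × (ℕ → B)) => knightRem (m.errOf r t w.1 w.2) (y w.2)) 2
      ((P.map (m.η 0)).prod m.pastLaw) := by
    refine hy2'.mono hrm.aestronglyMeasurable (Eventually.of_forall fun w => ?_)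
    rw [Real.norm_eq_abs, Real.norm_eq_abs, abs_of_nonneg (knightRem_nonneg _ _)]
    exact knightRem_le _ _
  have hcL : MemLp (m.condKnight r t y) 2 m.pastLaw := by
    refine hy2.mono hcm.aestronglyMeasurable (Eventually.of_forall fun z => ?_)
    rw [Real.norm_eq_abs, Real.norm_eq_abs, abs_of_nonneg (m.condKnight_nonneg _ _ _ _)]
    exact m.condKnight_le _ _ _ _
  have hcL' : MemLp (fun w : A × ((ℕ → A) × (ℕ → B)) => m.condKnight r t y w.2) 2
      ((P.map (m.η 0)).prod m.pastLaw) := hcL.comp_measurePreserving measurePreserving_snd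
  have hya : MemLp (fun z => |y z|) 2 m.pastLaw := hy2.abs
  have hya' : MemLp (fun w : A × ((ℕ → A) × (ℕ → B)) => |y w.2|) 2
      ((P.map (m.η 0)).prod m.pastLaw) := hy2'.abs
  have i1 : Integrable (fun w : A × ((ℕ → A) × (ℕ → B)) =>
      |y w.2| * (knightRem (m.errOf r t w.1 w.2) (y w.2) + m.condKnight r t y w.2))
      ((P.map (m.η 0)).prod m.pastLaw) := hya'.integrable_mul (hkL.add hcL')
  calc _ ≤ ∫ w : A × ((ℕ → A) × (ℕ → B)),
      |y w.2| * (knightRem (m.errOf r t w.1 w.2) (y w.2) + m.condKnight r t y w.2)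
      ∂((P.map (m.η 0)).prod m.pastLaw) := by
        refine integral_mono hL.integrable_sq i1 fun w => ?_
        have h1 := knightRem_nonneg (m.errOf r t w.1 w.2) (y w.2)
        have h2 := knightRem_le (m.errOf r t w.1 w.2) (y w.2)
        have h3 := m.condKnight_nonneg r t y w.2
        have h4 := m.condKnight_le r t y w.2
        change (knightRem (m.errOf r t w.1 w.2) (y w.2) - m.condKnight r t y w.2) ^ 2 ≤ _
        nlinarith
    _ = ∫ z, |y z| * (2 * m.condKnight r t y z) ∂m.pastLaw := by
        rw [integral_prod_symm _ i1]
        refine integral_congr_ae (Eventually.of_forall fun z => ?_)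
        simp only
        rw [integral_const_mul, integral_add (m.integrable_knightRem_left r t (y z) z)
          (integrable_const _), integral_const, probReal_univ, one_smul, two_mul]
        rfl
    _ ≤ ∫ z, (2 * M * |y z| ^ 3 + 2 * C * |y z| ^ 4) ∂m.pastLaw := by
        refine integral_mono_ae (hya.integrable_mul (hcL.const_mul 2))
          (((h.integral_abs_mul_inner_pow_le hM u hσ (k := 3) (by norm_num)).1.const_mul
            (2 * M)).add ((h.integral_abs_mul_inner_pow_le hM u hσ (k := 4)
            le_rfl).1.const_mul (2 * C))) ?_
        filter_upwards [h.expansion] with z hz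
        have h1 := hz.condKnight_le y
        have h2 := abs_nonneg (y z)
        calc |y z| * (2 * m.condKnight r t y z)
            ≤ |y z| * (2 * (M * |y z| ^ 2 + C * |y z| ^ 3)) := by gcongr
          _ = _ := by ring
    _ ≤ 2 * M * (σ * (M * ‖u‖)) ^ 3 + 2 * C * (σ * (M * ‖u‖)) ^ 4 := by
        rw [integral_add ((h.integral_abs_mul_inner_pow_le hM u hσ (k := 3)
          (by norm_num)).1.const_mul (2 * M)) ((h.integral_abs_mul_inner_pow_le hM u hσ (k := 4)
            le_rfl).1.const_mul (2 * C)), integral_const_mul, integral_const_mul]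
        have h3 := (h.integral_abs_mul_inner_pow_le hM u hσ (k := 3) (by norm_num)).2
        have h4 := (h.integral_abs_mul_inner_pow_le hM u hσ (k := 4) le_rfl).2
        gcongr
    _ ≤ _ := by
        have h4 : σ ^ 4 ≤ σ ^ 3 := pow_le_pow_of_le_one hσ hσ1 (by norm_num)
        have h5 : 0 ≤ 2 * C * (M * ‖u‖) ^ 4 := by positivity
        have := mul_le_mul_of_nonneg_right h4 h5
        rw [mul_pow, mul_pow]
        linarith

/-- Weak dependence of the truncated curvature. -/
theorem RegularAt.dep_curvature (h : m.RegularAt τ ε₀ M C a r t) (hM : 0 ≤ M)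
    (u : EuclideanSpace ℝ (Fin p)) {b : ℝ} (hb : 0 ≤ b) (k : ℕ) :
    eLpNorm (fun w : Ω × Ω =>
      m.densOf r t (m.past k w.1) * clip b (inner ℝ (m.predOf r t (m.past k w.1)) u) ^ 2
        - m.densOf r t (m.pastStar k w) * clip b (inner ℝ (m.predOf r t (m.pastStar k w)) u) ^ 2) 2
        (P.prod P) ≤ ENNReal.ofReal (b ^ 2 + 2 * M * b * ‖u‖) * a k := by
  have hpast : MeasurePreserving (fun w : Ω × Ω => m.past k w.1) (P.prod P) m.pastLaw :=
    (m.measurePreserving_past k).comp measurePreserving_fst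
  have hstar : MeasurePreserving (m.pastStar k) (P.prod P) m.pastLaw :=
    m.measurePreserving_pastStar k
  have mp := m.measurable_predOf r t
  have md := m.measurable_densOf r t
  have mΔ : Measurable fun w : Ω × Ω =>
      m.predOf r t (m.past k w.1) - m.predOf r t (m.pastStar k w) :=
    (mp.comp hpast.measurable).sub (mp.comp hstar.measurable)
  have mF : Measurable fun w : Ω × Ω =>
      m.densOf r t (m.past k w.1) - m.densOf r t (m.pastStar k w) :=
    (md.comp hpast.measurable).sub (md.comp hstar.measurable)
  have h1 := eLpNorm_le_add_of_ae_le (q := 2) (μ := P.prod P) mF.aestronglyMeasurable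
    mΔ.aestronglyMeasurable (c₁ := b ^ 2) (c₂ := 2 * M * b * ‖u‖) (by positivity) (by positivity)
    (f := fun w : Ω × Ω =>
      m.densOf r t (m.past k w.1) * clip b (inner ℝ (m.predOf r t (m.past k w.1)) u) ^ 2
        - m.densOf r t (m.pastStar k w) * clip b (inner ℝ (m.predOf r t (m.pastStar k w)) u) ^ 2)
    (by
      filter_upwards [hstar.quasiMeasurePreserving.ae h.expansion] with w hw
      have hd := hw.dens_le
      have hd0 := m.densOf_nonneg r t (m.pastStar k w)
      set d := m.densOf r t (m.past k w.1)
      set d' := m.densOf r t (m.pastStar k w)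
      set x := m.predOf r t (m.past k w.1)
      set x' := m.predOf r t (m.pastStar k w)
      have c1 := abs_clip_le hb (inner ℝ x u)
      have c2 := abs_clip_le hb (inner ℝ x' u)
      have c3 := (abs_clip_sub_le b (inner ℝ x u) (inner ℝ x' u)).trans_eq
        (by rw [← inner_sub_left])
      have c4 := abs_real_inner_le_norm (x - x') u
      set y := clip b (inner ℝ x u)
      set y' := clip b (inner ℝ x' u)
      have e : d * y ^ 2 - d' * y' ^ 2 = (d - d') * y ^ 2 + d' * ((y + y') * (y - y')) := by ring
      have c5 : |y + y'| ≤ 2 * b := (abs_add_le _ _).trans (by linarith)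
      have c6 : |y - y'| ≤ ‖x - x'‖ * ‖u‖ := c3.trans c4
      rw [e]
      calc _ ≤ |(d - d') * y ^ 2| + |d' * ((y + y') * (y - y'))| := abs_add_le _ _
        _ = |d - d'| * |y| ^ 2 + d' * (|y + y'| * |y - y'|) := by
            rw [abs_mul, abs_mul, abs_mul, abs_pow, abs_of_nonneg hd0]
        _ ≤ |d - d'| * b ^ 2 + M * ((2 * b) * (‖x - x'‖ * ‖u‖)) := by gcongr
        _ = _ := by rw [Real.norm_eq_abs]; ring) one_le_two
  have h3 : eLpNorm (fun w : Ω × Ω =>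
      m.predOf r t (m.past k w.1) - m.predOf r t (m.pastStar k w)) 2 (P.prod P) ≤ a k :=
    (eLpNorm_le_eLpNorm_of_exponent_le (by norm_num) mΔ.aestronglyMeasurable).trans (h.dep_pred k)
  have h4 : eLpNorm (fun w : Ω × Ω =>
      m.densOf r t (m.past k w.1) - m.densOf r t (m.pastStar k w)) 2 (P.prod P) ≤ a k :=
    (eLpNorm_le_eLpNorm_of_exponent_le (by norm_num) mF.aestronglyMeasurable).trans (h.dep_dens k)
  refine h1.trans ((add_le_add (mul_le_mul_right h4 _) (mul_le_mul_right h3 _)).trans ?_)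
  rw [ENNReal.ofReal_add (by positivity) (by positivity), add_mul]

/-- The curvature at the true parameter is bounded above and below. -/
theorem RegularAt.integral_densOf_mul_sq (h : m.RegularAt τ ε₀ M C a r t) (hε₀ : 0 ≤ ε₀)
    (hM : 0 ≤ M) (u : EuclideanSpace ℝ (Fin p)) :
    Integrable (fun z => m.densOf r t z * inner ℝ (m.predOf r t z) u ^ 2) m.pastLaw ∧
      ε₀ ^ 2 * ‖u‖ ^ 2 ≤ ∫ z, m.densOf r t z * inner ℝ (m.predOf r t z) u ^ 2 ∂m.pastLaw ∧
      ∫ z, m.densOf r t z * inner ℝ (m.predOf r t z) u ^ 2 ∂m.pastLaw ≤ M * (M * ‖u‖) ^ 2 := by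
  obtain ⟨h1, h2⟩ := h.integral_abs_inner_pow_le hM u (k := 2) (by norm_num)
  simp_rw [sq_abs] at h1 h2
  have mp := m.measurable_predOf r t
  have md := m.measurable_densOf r t
  have hi : Integrable (fun z => m.densOf r t z * inner ℝ (m.predOf r t z) u ^ 2) m.pastLaw := by
    refine (h1.const_mul M).mono' (by fun_prop) ?_
    filter_upwards [h.expansion] with z hz
    have := m.densOf_nonneg r t z
    rw [Real.norm_eq_abs, abs_of_nonneg (by positivity)]
    gcongr
    exact hz.dens_le
  refine ⟨hi, ?_, ?_⟩
  · calc ε₀ ^ 2 * ‖u‖ ^ 2 = ε₀ * (ε₀ * ‖u‖ ^ 2) := by ring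
      _ ≤ ε₀ * ∫ z, inner ℝ (m.predOf r t z) u ^ 2 ∂m.pastLaw := by gcongr; exact h.lower u
      _ = ∫ z, ε₀ * inner ℝ (m.predOf r t z) u ^ 2 ∂m.pastLaw := (integral_const_mul _ _).symm
      _ ≤ _ := by
        refine integral_mono_ae (h1.const_mul _) hi ?_
        filter_upwards [h.expansion] with z hz
        have := hz.le_dens
        gcongr
  · calc _ ≤ ∫ z, M * inner ℝ (m.predOf r t z) u ^ 2 ∂m.pastLaw := by
          refine integral_mono_ae hi (h1.const_mul _) ?_
          filter_upwards [h.expansion] with z hz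
          have := hz.dens_le
          gcongr
      _ ≤ _ := by rw [integral_const_mul]; gcongr

end RegularAt

end PLSProcess

namespace PLSProcess

variable {Ω A B : Type*} [MeasurableSpace Ω] [MeasurableSpace A] [MeasurableSpace B]
  {P : Measure Ω} {p R : ℕ} [IsProbabilityMeasure P]

/-! ### The law of large numbers for Knight's remainder -/

section Sums

variable (m : PLSProcess Ω A B P p R) {τ ε₀ M C : ℝ} {a : ℕ → ℝ≥0∞} {s : Finset ℕ} {N : ℕ}
  {r : ℕ → Fin (R + 1)} {t : ℕ → ℝ}

/-- Knight's remainder is close to its conditional mean. -/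
theorem eLpNorm_sum_knightRem_sub_condKnight_le (hM : 0 ≤ M) (hC : 0 ≤ C) (hs : s.card ≤ N)
    (hreg : ∀ i ∈ s, m.RegularAt τ ε₀ M C a (r i) (t i)) (u : EuclideanSpace ℝ (Fin p))
    {σ : ℝ} (hσ : 0 ≤ σ) (hσ1 : σ ≤ 1) (hN : N * σ ^ 2 ≤ 1) :
    eLpNorm (fun ω => ∑ i ∈ s,
      (knightRem (m.errOf (r i) (t i) (m.η i ω) (m.past i ω))
        (σ * inner ℝ (m.predOf (r i) (t i) (m.past i ω)) u)
      - m.condKnight (r i) (t i) (fun z => σ * inner ℝ (m.predOf (r i) (t i) z) u) (m.past i ω))) 1 P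
      ≤ ENNReal.ofReal (√σ * √(2 * (M * (M * ‖u‖) ^ 3 + C * (M * ‖u‖) ^ 4))) := by
  have hpη := m.isProbabilityMeasure_map_η
  set K := 2 * (M * (M * ‖u‖) ^ 3 + C * (M * ‖u‖) ^ 4) with hK
  have hK0 : 0 ≤ K := by positivity
  set θ : ℕ → A × ((ℕ → A) × (ℕ → B)) → ℝ := fun i w =>
    knightRem (m.errOf (r i) (t i) w.1 w.2) (σ * inner ℝ (m.predOf (r i) (t i) w.2) u)
      - m.condKnight (r i) (t i) (fun z => σ * inner ℝ (m.predOf (r i) (t i) z) u) w.2 with hθ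
  have hym : ∀ i, Measurable fun z => σ * inner ℝ (m.predOf (r i) (t i) z) u := fun i => by
    have := m.measurable_predOf (r i) (t i)
    fun_prop
  have hmart := m.integral_sq_sum_eq (θ := θ) (s := s)
    (fun i _ => (m.measurable_knightRem_errOf (r i) (t i) (hym i)).sub
      ((m.measurable_condKnight (r i) (t i) (hym i)).comp measurable_snd))
    (fun i hi => ((hreg i hi).memLp_knightRem_sub hM hC u hσ hσ1).1)
    (fun i _ => Eventually.of_forall fun z => by
      simp only [hθ]
      rw [integral_sub (m.integrable_knightRem_left _ _ _ z) (integrable_const _), integral_const,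
        probReal_univ, one_smul]
      exact sub_self _)
  refine (eLpNorm_le_eLpNorm_of_exponent_le one_le_two hmart.1.1).trans ?_
  refine eLpNorm_two_le_of_integral_sq_le hmart.1 (by positivity) ?_
  rw [hmart.2, mul_pow, Real.sq_sqrt hσ, Real.sq_sqrt hK0]
  refine (Finset.sum_le_sum fun i hi =>
    ((hreg i hi).memLp_knightRem_sub hM hC u hσ hσ1).2).trans ?_
  rw [Finset.sum_const, nsmul_eq_mul]
  have h1 : (s.card : ℝ) ≤ N := by exact_mod_cast hs
  calc (s.card : ℝ) * (σ ^ 3 * K) ≤ N * (σ ^ 3 * K) := by gcongr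
    _ = (N * σ ^ 2) * (σ * K) := by ring
    _ ≤ 1 * (σ * K) := by gcongr
    _ = σ * K := one_mul _

/-- The conditional mean of Knight's remainder is close to a quadratic function. -/
theorem eLpNorm_sum_condKnight_sub_le (hM : 0 ≤ M) (hC : 0 ≤ C) (hs : s.card ≤ N)
    (hreg : ∀ i ∈ s, m.RegularAt τ ε₀ M C a (r i) (t i))
    (u : EuclideanSpace ℝ (Fin p))
    {σ : ℝ} (hσ : 0 ≤ σ) (hN : N * σ ^ 2 ≤ 1) :
    eLpNorm (fun ω => ∑ i ∈ s,
      (m.condKnight (r i) (t i) (fun z => σ * inner ℝ (m.predOf (r i) (t i) z) u) (m.past i ω)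
      - σ ^ 2 / 2 * (m.densOf (r i) (t i) (m.past i ω)
        * inner ℝ (m.predOf (r i) (t i) (m.past i ω)) u ^ 2))) 1 P
      ≤ ENNReal.ofReal (σ * (C * (M * ‖u‖) ^ 3)) := by
  have hym : ∀ i, Measurable fun z => σ * inner ℝ (m.predOf (r i) (t i) z) u := fun i => by
    have := m.measurable_predOf (r i) (t i)
    fun_prop
  have hle : ∀ i ∈ s, ∀ᵐ z ∂m.pastLaw,
      |m.condKnight (r i) (t i) (fun z => σ * inner ℝ (m.predOf (r i) (t i) z) u) z
      - σ ^ 2 / 2 * (m.densOf (r i) (t i) z * inner ℝ (m.predOf (r i) (t i) z) u ^ 2)|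
      ≤ C * |σ * inner ℝ (m.predOf (r i) (t i) z) u| ^ 3 := fun i hi => by
    filter_upwards [(hreg i hi).expansion] with z hz
    refine le_trans (le_of_eq ?_)
      (hz.abs_condKnight_sub_le fun z => σ * inner ℝ (m.predOf (r i) (t i) z) u)
    congr 2; ring
  have hmom := fun i (hi : i ∈ s) =>
    (hreg i hi).integral_abs_mul_inner_pow_le hM u hσ (k := 3) (by norm_num)
  have hint : ∀ i ∈ s, Integrable (fun z =>
      m.condKnight (r i) (t i) (fun z => σ * inner ℝ (m.predOf (r i) (t i) z) u) z
      - σ ^ 2 / 2 * (m.densOf (r i) (t i) z * inner ℝ (m.predOf (r i) (t i) z) u ^ 2)) m.pastLaw := by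
    intro i hi
    have h1 := m.measurable_predOf (r i) (t i)
    have h2 := m.measurable_densOf (r i) (t i)
    have h3 := m.measurable_condKnight (r i) (t i) (hym i)
    exact ((hmom i hi).1.const_mul C).mono' (by fun_prop) (hle i hi)
  refine (m.eLpNorm_one_sum_past_le (c := C * (σ * (M * ‖u‖)) ^ 3) hs hint fun i hi => ?_).trans ?_
  · refine (integral_mono_ae (hint i hi).abs ((hmom i hi).1.const_mul C) (hle i hi)).trans ?_
    rw [integral_const_mul]
    have := (hmom i hi).2
    gcongr
  · refine ENNReal.ofReal_le_ofReal ?_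
    calc N * (C * (σ * (M * ‖u‖)) ^ 3) = (N * σ ^ 2) * (σ * (C * (M * ‖u‖) ^ 3)) := by ring
      _ ≤ 1 * (σ * (C * (M * ‖u‖) ^ 3)) := by gcongr
      _ = _ := one_mul _

/-- A weak law of large numbers for the curvature. The predictors are truncated at a level that
balances the truncation error against the dependence of the truncated variables. -/
theorem eLpNorm_sum_curvature_sub_le (hM : 0 ≤ M) (ha : ∑' k, a k ≠ ⊤) (hs : s.card ≤ N)
    (hreg : ∀ i ∈ s, m.RegularAt τ ε₀ M C a (r i) (t i))
    (u : EuclideanSpace ℝ (Fin p))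
    {σ : ℝ} (hσ : 0 < σ) (hσ1 : σ ≤ 1) (hN : N * σ ^ 2 ≤ 1) :
    eLpNorm (fun ω => σ ^ 2 / 2 * ((∑ i ∈ s, m.densOf (r i) (t i) (m.past i ω)
        * inner ℝ (m.predOf (r i) (t i) (m.past i ω)) u ^ 2)
      - ∑ i ∈ s, ∫ z, m.densOf (r i) (t i) z * inner ℝ (m.predOf (r i) (t i) z) u ^ 2 ∂m.pastLaw))
      1 P ≤ ENNReal.ofReal (√σ * (M * (M * ‖u‖) ^ 4
        + (1 + 2 * M * ‖u‖) * (∑' k, a k).toReal)) := by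
  -- With `b ^ 2 = 1 / √σ`, the truncation error `σ ^ 2 * N / b ^ 2` and the deviation
  -- `σ ^ 2 * √N * b ^ 2` of the truncated sum are both at most `√σ`.
  set b : ℝ := (√√σ)⁻¹ with hb
  have hσ' : 0 < √σ := Real.sqrt_pos.2 hσ
  have hb0 : 0 < b := inv_pos.2 (Real.sqrt_pos.2 hσ')
  have hb2 : b ^ 2 = (√σ)⁻¹ := by rw [hb, inv_pow, Real.sq_sqrt hσ'.le]
  have hb1 : 1 ≤ b := by
    rw [hb]
    refine (one_le_inv₀ (Real.sqrt_pos.2 hσ')).2 ?_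
    rw [Real.sqrt_le_one, Real.sqrt_le_one]
    exact hσ1
  set y : ℕ → (ℕ → A) × (ℕ → B) → ℝ := fun i z => inner ℝ (m.predOf (r i) (t i) z) u with hy
  set d : ℕ → (ℕ → A) × (ℕ → B) → ℝ := fun i z => m.densOf (r i) (t i) z with hd
  have hym : ∀ i, Measurable (y i) := fun i => by
    have := m.measurable_predOf (r i) (t i)
    simp only [hy]; fun_prop
  have hdm : ∀ i, Measurable (d i) := fun i => m.measurable_densOf (r i) (t i)
  have hcm : ∀ i, Measurable fun z => clip b (y i z) := fun i => (measurable_clip b).comp (hym i)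
  set g : ℕ → (ℕ → A) × (ℕ → B) → ℝ := fun i z => d i z * clip b (y i z) ^ 2 with hg
  set e : ℕ → (ℕ → A) × (ℕ → B) → ℝ := fun i z => d i z * (y i z ^ 2 - clip b (y i z) ^ 2) with he
  have hgm : ∀ i, Measurable (g i) := fun i => (hdm i).mul ((hcm i).pow_const 2)
  have hem : ∀ i, Measurable (e i) := fun i =>
    (hdm i).mul (((hym i).pow_const 2).sub ((hcm i).pow_const 2))
  have hg2 : ∀ i ∈ s, MemLp (g i) 2 m.pastLaw := fun i hi => by
    refine MemLp.of_bound (hgm i).aestronglyMeasurable (M * b ^ 2) ?_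
    filter_upwards [(hreg i hi).expansion] with z hz
    have h1 := hz.dens_le
    have h2 : 0 ≤ d i z := m.densOf_nonneg _ _ _
    have h3 := abs_clip_le hb0.le (y i z)
    rw [hg, Real.norm_eq_abs, abs_mul, abs_of_nonneg h2, abs_pow]
    gcongr
  have hmom := fun i (hi : i ∈ s) =>
    (hreg i hi).integral_abs_inner_pow_le hM u (k := 4) le_rfl
  have hele : ∀ i ∈ s, ∀ᵐ z ∂m.pastLaw, |e i z| ≤ M / b ^ 2 * |y i z| ^ 4 := fun i hi => by
    filter_upwards [(hreg i hi).expansion] with z hz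
    obtain ⟨h1, h2⟩ := sq_sub_clip_sq hb0 (y i z)
    have h3 : 0 ≤ d i z := m.densOf_nonneg _ _ _
    have h4 : d i z ≤ M := hz.dens_le
    rw [he, abs_mul, abs_of_nonneg h3, abs_of_nonneg h1]
    calc _ ≤ M * (y i z ^ 4 / b ^ 2) := by gcongr
      _ = _ := by rw [Even.pow_abs (by decide : Even 4)]; ring
  have hei : ∀ i ∈ s, Integrable (e i) m.pastLaw := fun i hi =>
    ((hmom i hi).1.const_mul (M / b ^ 2)).mono' (hem i).aestronglyMeasurable (hele i hi)
  have heb : ∀ i ∈ s, ∫ z, |e i z| ∂m.pastLaw ≤ M / b ^ 2 * (M * ‖u‖) ^ 4 := fun i hi => by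
    refine (integral_mono_ae (hei i hi).abs ((hmom i hi).1.const_mul _) (hele i hi)).trans ?_
    rw [integral_const_mul]
    have := (hmom i hi).2
    gcongr
  -- the truncation error and its mean
  have hE1 := m.eLpNorm_one_sum_past_le hs hei heb
  have hE2 : |∑ i ∈ s, ∫ z, e i z ∂m.pastLaw| ≤ N * (M / b ^ 2 * (M * ‖u‖) ^ 4) := by
    refine (Finset.abs_sum_le_sum_abs _ _).trans ((Finset.sum_le_sum fun i hi =>
      abs_integral_le_integral_abs.trans (heb i hi)).trans ?_)
    rw [Finset.sum_const, nsmul_eq_mul]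
    gcongr
  -- the truncated part
  have hG : eLpNorm (fun ω => ∑ i ∈ s, g i (m.past i ω) - ∫ ω', ∑ i ∈ s, g i (m.past i ω') ∂P) 1 P
      ≤ ENNReal.ofReal (√N * ((b ^ 2 + 2 * M * b * ‖u‖) * (∑' k, a k).toReal)) := by
    have hmeas : Measurable fun ω =>
        ∑ i ∈ s, g i (m.past i ω) - ∫ ω', ∑ i ∈ s, g i (m.past i ω') ∂P :=
      (Finset.measurable_fun_sum s fun i _ => (hgm i).comp (m.measurable_past i)).sub
        measurable_const
    refine (eLpNorm_le_eLpNorm_of_exponent_le one_le_two hmeas.aestronglyMeasurable).trans ?_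
    have h1 := m.eLpNorm_sum_sub_integral_sq_le (fun i _ => hgm i) hg2
      (a := fun k => ENNReal.ofReal (b ^ 2 + 2 * M * b * ‖u‖) * a k)
      fun i hi k => (hreg i hi).dep_curvature hM u hb0.le k
    rw [ENNReal.tsum_mul_left] at h1
    have h2 := le_ofReal_sqrt_mul h1 (ENNReal.mul_ne_top ENNReal.ofReal_ne_top ha) hs
    rwa [ENNReal.toReal_mul, ENNReal.toReal_ofReal (by positivity)] at h2
  have hGint : ∫ ω', ∑ i ∈ s, g i (m.past i ω') ∂P = ∑ i ∈ s, ∫ z, g i z ∂m.pastLaw := by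
    rw [integral_finsetSum]
    · exact Finset.sum_congr rfl fun i _ => m.integral_past i (hgm i).aestronglyMeasurable
    · exact fun i hi => ((hg2 i hi).comp_measurePreserving
        (m.measurePreserving_past i)).integrable one_le_two
  have hsplit : ∀ i ∈ s, ∫ z, d i z * y i z ^ 2 ∂m.pastLaw
      = ∫ z, g i z ∂m.pastLaw + ∫ z, e i z ∂m.pastLaw := fun i hi => by
    rw [← integral_add ((hg2 i hi).integrable one_le_two) (hei i hi)]
    refine integral_congr_ae (Eventually.of_forall fun z => ?_)
    simp only [hg, he]; ring
  have hfun : (fun ω => σ ^ 2 / 2 * ((∑ i ∈ s, d i (m.past i ω) * y i (m.past i ω) ^ 2)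
      - ∑ i ∈ s, ∫ z, d i z * y i z ^ 2 ∂m.pastLaw))
      = (σ ^ 2 / 2) • ((fun ω => ∑ i ∈ s, g i (m.past i ω) - ∫ ω', ∑ i ∈ s, g i (m.past i ω') ∂P)
        + ((fun ω => ∑ i ∈ s, e i (m.past i ω))
          - fun _ => ∑ i ∈ s, ∫ z, e i z ∂m.pastLaw)) := by
    funext ω
    rw [Finset.sum_congr rfl hsplit, Finset.sum_add_distrib, hGint]
    have : ∑ i ∈ s, d i (m.past i ω) * y i (m.past i ω) ^ 2
        = ∑ i ∈ s, g i (m.past i ω) + ∑ i ∈ s, e i (m.past i ω) := by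
      rw [← Finset.sum_add_distrib]
      refine Finset.sum_congr rfl fun i _ => ?_
      simp only [hg, he]; ring
    simp only [Pi.smul_apply, Pi.add_apply, Pi.sub_apply, smul_eq_mul, this]
    ring
  change eLpNorm (fun ω => σ ^ 2 / 2 * ((∑ i ∈ s, d i (m.past i ω) * y i (m.past i ω) ^ 2)
      - ∑ i ∈ s, ∫ z, d i z * y i z ^ 2 ∂m.pastLaw)) 1 P ≤ _
  rw [hfun, eLpNorm_const_smul, Real.enorm_eq_ofReal (by positivity)]
  have hmg : AEStronglyMeasurable (fun ω =>
      ∑ i ∈ s, g i (m.past i ω) - ∫ ω', ∑ i ∈ s, g i (m.past i ω') ∂P) P :=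
    ((Finset.measurable_fun_sum s fun i _ => (hgm i).comp (m.measurable_past i)).sub
        measurable_const).aestronglyMeasurable
  have hme : AEStronglyMeasurable (fun ω => ∑ i ∈ s, e i (m.past i ω)) P :=
    (Finset.measurable_fun_sum s fun i _ => (hem i).comp (m.measurable_past i)).aestronglyMeasurable
  have hconst : eLpNorm (fun _ : Ω => ∑ i ∈ s, ∫ z, e i z ∂m.pastLaw) 1 P
      ≤ ENNReal.ofReal (N * (M / b ^ 2 * (M * ‖u‖) ^ 4)) := by
    rw [eLpNorm_const _ one_ne_zero (NeZero.ne P), measure_univ, ENNReal.one_rpow, mul_one,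
      Real.enorm_eq_ofReal_abs]
    exact ENNReal.ofReal_le_ofReal hE2
  calc _ ≤ ENNReal.ofReal (σ ^ 2 / 2) *
        (ENNReal.ofReal (√N * ((b ^ 2 + 2 * M * b * ‖u‖) * (∑' k, a k).toReal))
          + (ENNReal.ofReal (N * (M / b ^ 2 * (M * ‖u‖) ^ 4))
            + ENNReal.ofReal (N * (M / b ^ 2 * (M * ‖u‖) ^ 4)))) := by
        gcongr
        refine (eLpNorm_add_le hmg (hme.sub aestronglyMeasurable_const) le_rfl).trans ?_
        gcongr
        refine (eLpNorm_sub_le hme aestronglyMeasurable_const le_rfl).trans ?_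
        gcongr
    _ = ENNReal.ofReal (σ ^ 2 / 2 * (√N * ((b ^ 2 + 2 * M * b * ‖u‖) * (∑' k, a k).toReal)
          + (N * (M / b ^ 2 * (M * ‖u‖) ^ 4) + N * (M / b ^ 2 * (M * ‖u‖) ^ 4)))) := by
        rw [← ENNReal.ofReal_add (by positivity) (by positivity),
          ← ENNReal.ofReal_add (by positivity) (by positivity),
          ← ENNReal.ofReal_mul (by positivity)]
    _ ≤ _ := by
        refine ENNReal.ofReal_le_ofReal ?_
        have hT : 0 ≤ (∑' k, a k).toReal := ENNReal.toReal_nonneg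
        set T := (∑' k, a k).toReal
        have hNσ : √N * σ ≤ 1 := by
          rw [← Real.sqrt_sq hσ.le, ← Real.sqrt_mul (by positivity)]
          exact Real.sqrt_le_one.2 hN
        have hσσ : σ = √σ * √σ := (Real.mul_self_sqrt hσ.le).symm
        have hσb : σ * b ^ 2 = √σ := by
          rw [hb2]; nth_rewrite 1 [hσσ]; field_simp
        have h1 : σ ^ 2 * (√N * ((b ^ 2 + 2 * M * b * ‖u‖) * T)) ≤ √σ * ((1 + 2 * M * ‖u‖) * T) := by
          have h2 : b ≤ b ^ 2 := by nlinarith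
          calc _ = (√N * σ) * (σ * ((b ^ 2 + 2 * M * b * ‖u‖) * T)) := by ring
            _ ≤ 1 * (σ * ((b ^ 2 + 2 * M * b ^ 2 * ‖u‖) * T)) := by gcongr
            _ = (σ * b ^ 2) * ((1 + 2 * M * ‖u‖) * T) := by ring
            _ = _ := by rw [hσb]
        have h3 : σ ^ 2 * (N * (M / b ^ 2 * (M * ‖u‖) ^ 4)) ≤ √σ * (M * (M * ‖u‖) ^ 4) := by
          calc _ = (N * σ ^ 2) * ((b ^ 2)⁻¹ * (M * (M * ‖u‖) ^ 4)) := by ring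
            _ ≤ 1 * ((b ^ 2)⁻¹ * (M * (M * ‖u‖) ^ 4)) := by gcongr
            _ = _ := by rw [hb2, inv_inv, one_mul]
        have h5 : 0 ≤ √σ * ((1 + 2 * M * ‖u‖) * T) := by positivity
        rw [mul_add √σ]
        linarith

/-- The sum of Knight's remainders is close to a deterministic quadratic function. -/
theorem eLpNorm_sum_knightRem_sub_le (hM : 0 ≤ M) (hC : 0 ≤ C) (ha : ∑' k, a k ≠ ⊤)
    (hs : s.card ≤ N)
    (hreg : ∀ i ∈ s, m.RegularAt τ ε₀ M C a (r i) (t i))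
    (u : EuclideanSpace ℝ (Fin p))
    {σ : ℝ} (hσ : 0 < σ) (hσ1 : σ ≤ 1) (hN : N * σ ^ 2 ≤ 1) :
    eLpNorm (fun ω => ∑ i ∈ s, knightRem (m.errOf (r i) (t i) (m.η i ω) (m.past i ω))
        (σ * inner ℝ (m.predOf (r i) (t i) (m.past i ω)) u)
      - σ ^ 2 / 2 * ∑ i ∈ s, ∫ z, m.densOf (r i) (t i) z
        * inner ℝ (m.predOf (r i) (t i) z) u ^ 2 ∂m.pastLaw) 1 P
      ≤ ENNReal.ofReal (√σ * (√(2 * (M * (M * ‖u‖) ^ 3 + C * (M * ‖u‖) ^ 4))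
        + C * (M * ‖u‖) ^ 3 + (M * (M * ‖u‖) ^ 4
        + (1 + 2 * M * ‖u‖) * (∑' k, a k).toReal))) := by
  have h1 := m.eLpNorm_sum_knightRem_sub_condKnight_le hM hC hs hreg u hσ.le hσ1 hN
  have h2 := m.eLpNorm_sum_condKnight_sub_le hM hC hs hreg u hσ.le hN
  have h3 := m.eLpNorm_sum_curvature_sub_le hM ha hs hreg u hσ hσ1 hN
  have hpm : ∀ i : ℕ, Measurable fun ω => m.predOf (r i) (t i) (m.past i ω) := fun i =>
    (m.measurable_predOf (r i) (t i)).comp (m.measurable_past i)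
  have hym : ∀ i, Measurable fun z => σ * inner ℝ (m.predOf (r i) (t i) z) u := fun i => by
    have := m.measurable_predOf (r i) (t i)
    fun_prop
  have hkm : ∀ i : ℕ, Measurable fun ω => m.condKnight (r i) (t i)
      (fun z => σ * inner ℝ (m.predOf (r i) (t i) z) u) (m.past i ω) := fun i =>
    (m.measurable_condKnight (r i) (t i) (hym i)).comp (m.measurable_past i)
  have hdm : ∀ i : ℕ, Measurable fun ω => m.densOf (r i) (t i) (m.past i ω) := fun i =>
    (m.measurable_densOf (r i) (t i)).comp (m.measurable_past i)
  have hrm : ∀ i : ℕ, Measurable fun ω => knightRem (m.errOf (r i) (t i) (m.η i ω) (m.past i ω))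
      (σ * inner ℝ (m.predOf (r i) (t i) (m.past i ω)) u) := fun i =>
    (m.measurable_knightRem_errOf (r i) (t i) (hym i)).comp
      ((m.measurable_η i).prodMk (m.measurable_past i))
  have hfun : (fun ω => ∑ i ∈ s, knightRem (m.errOf (r i) (t i) (m.η i ω) (m.past i ω))
        (σ * inner ℝ (m.predOf (r i) (t i) (m.past i ω)) u)
      - σ ^ 2 / 2 * ∑ i ∈ s, ∫ z, m.densOf (r i) (t i) z
        * inner ℝ (m.predOf (r i) (t i) z) u ^ 2 ∂m.pastLaw)
      = (fun ω => ∑ i ∈ s,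
      (knightRem (m.errOf (r i) (t i) (m.η i ω) (m.past i ω))
        (σ * inner ℝ (m.predOf (r i) (t i) (m.past i ω)) u)
      - m.condKnight (r i) (t i) (fun z => σ * inner ℝ (m.predOf (r i) (t i) z) u) (m.past i ω)))
      + (fun ω => ∑ i ∈ s,
      (m.condKnight (r i) (t i) (fun z => σ * inner ℝ (m.predOf (r i) (t i) z) u) (m.past i ω)
      - σ ^ 2 / 2 * (m.densOf (r i) (t i) (m.past i ω)
        * inner ℝ (m.predOf (r i) (t i) (m.past i ω)) u ^ 2)))
      + (fun ω => σ ^ 2 / 2 * ((∑ i ∈ s, m.densOf (r i) (t i) (m.past i ω)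
        * inner ℝ (m.predOf (r i) (t i) (m.past i ω)) u ^ 2)
      - ∑ i ∈ s, ∫ z, m.densOf (r i) (t i) z
        * inner ℝ (m.predOf (r i) (t i) z) u ^ 2 ∂m.pastLaw)) := by
    funext ω
    simp only [Pi.add_apply, Finset.sum_sub_distrib, ← Finset.mul_sum]
    ring
  have m1 := (Finset.measurable_fun_sum s fun i _ => (hrm i).sub (hkm i)).aestronglyMeasurable
    (μ := P)
  have m2 := (Finset.measurable_fun_sum s fun i _ => (hkm i).sub (((hdm i).mul
    (((hpm i).inner_const (c := u)).pow_const 2)).const_mul (σ ^ 2 / 2))).aestronglyMeasurable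
    (μ := P)
  have m3 := (((Finset.measurable_fun_sum s fun i _ => ((hdm i).mul
    (((hpm i).inner_const (c := u)).pow_const 2))).sub_const (∑ i ∈ s, ∫ z, m.densOf (r i) (t i) z
        * inner ℝ (m.predOf (r i) (t i) z) u ^ 2 ∂m.pastLaw)).const_mul
        (σ ^ 2 / 2)).aestronglyMeasurable (μ := P)
  rw [hfun]
  refine (eLpNorm_add_le (m1.add m2) m3 le_rfl).trans ((add_le_add
    ((eLpNorm_add_le m1 m2 le_rfl).trans (add_le_add h1 h2)) h3).trans ?_)
  rw [← ENNReal.ofReal_add (by positivity) (by positivity),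
    ← ENNReal.ofReal_add (by positivity) (by positivity)]
  refine ENNReal.ofReal_le_ofReal ?_
  have h4 : σ ≤ √σ := by
    nth_rewrite 1 [← Real.mul_self_sqrt hσ.le]
    exact mul_le_of_le_one_right (by positivity) (Real.sqrt_le_one.2 hσ1)
  have h5 : 0 ≤ C * (M * ‖u‖) ^ 3 := by positivity
  have := mul_le_mul_of_nonneg_right h4 h5
  linarith

/-- The Lipschitz constants of Knight's remainders add up to a bounded quantity, as a small shift
matters only for the errors close to zero. -/
theorem eLpNorm_sum_norm_mul_indicator_le (hM : 0 ≤ M) (hC : 0 ≤ C) (hs : s.card ≤ N)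
    (hreg : ∀ i ∈ s, m.RegularAt τ ε₀ M C a (r i) (t i)) {b : ℝ} (hb : 0 < b)
    {σ : ℝ} (hσ : 0 ≤ σ) (hσ1 : σ ≤ 1) (hN : N * σ ^ 2 ≤ 1) :
    eLpNorm (fun ω => ∑ i ∈ s, σ * ‖m.predOf (r i) (t i) (m.past i ω)‖
      * if |m.errOf (r i) (t i) (m.η i ω) (m.past i ω)|
        ≤ σ * b * ‖m.predOf (r i) (t i) (m.past i ω)‖ then 1 else 0) 1 P
      ≤ ENNReal.ofReal (8 * M * b * M ^ 2 + 16 * C * b ^ 2 * M ^ 3) := by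
  have hpη := m.isProbabilityMeasure_map_η
  have hnm : ∀ i, Measurable fun z => ‖m.predOf (r i) (t i) z‖ := fun i =>
    (m.measurable_predOf (r i) (t i)).norm
  have hmom2 := fun i (hi : i ∈ s) => integral_norm_pow_le (hreg i hi).memLp.1 hM
    (hreg i hi).moment (k := 2) (by norm_num)
  have hmom3 := fun i (hi : i ∈ s) => integral_norm_pow_le (hreg i hi).memLp.1 hM
    (hreg i hi).moment (k := 3) (by norm_num)
  set f : ℕ → A × ((ℕ → A) × (ℕ → B)) → ℝ := fun i w => σ * ‖m.predOf (r i) (t i) w.2‖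
      * if |m.errOf (r i) (t i) w.1 w.2| ≤ σ * b * ‖m.predOf (r i) (t i) w.2‖ then 1 else 0 with hf
  have hfm : ∀ i, Measurable (f i) := fun i =>
    (((hnm i).comp measurable_snd).const_mul σ).mul (Measurable.ite (measurableSet_le
      (m.measurable_errOf (r i) (t i)).abs (((hnm i).comp measurable_snd).const_mul (σ * b)))
      measurable_const measurable_const)
  have hf0 : ∀ i w, 0 ≤ f i w := fun i w => by simp only [hf]; split_ifs <;> positivity
  have hfi : ∀ i ∈ s, Integrable (f i) ((P.map (m.η 0)).prod m.pastLaw) := fun i hi => by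
    have h1 : Integrable (fun z => ‖m.predOf (r i) (t i) z‖) m.pastLaw :=
      ((hreg i hi).memLp.integrable (by norm_num)).norm
    refine ((h1.const_mul σ).comp_snd (P.map (m.η 0))).mono' (hfm i).aestronglyMeasurable
      (Eventually.of_forall fun w => ?_)
    rw [Real.norm_eq_abs, abs_of_nonneg (hf0 i w)]
    simp only [hf]
    refine mul_le_of_le_one_right (by positivity) ?_
    split_ifs <;> simp
  set K := 8 * M * b * M ^ 2 + 16 * C * b ^ 2 * M ^ 3 with hK
  have hK0 : 0 ≤ K := by positivity
  refine (m.eLpNorm_one_sum_le (f := f) (c := σ ^ 2 * K) hs hfi fun i hi => ?_).trans ?_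
  · simp_rw [abs_of_nonneg (hf0 i _)]
    rw [integral_prod_symm _ (hfi i hi)]
    calc _ ≤ ∫ z, σ ^ 2 * (8 * M * b * ‖m.predOf (r i) (t i) z‖ ^ 2
          + 16 * C * b ^ 2 * ‖m.predOf (r i) (t i) z‖ ^ 3) ∂m.pastLaw := by
          refine integral_mono_ae (hfi i hi).integral_prod_right
            ((((hmom2 i hi).1.const_mul (8 * M * b)).add
            ((hmom3 i hi).1.const_mul (16 * C * b ^ 2))).const_mul (σ ^ 2)) ?_
          filter_upwards [(hreg i hi).expansion] with z hz
          set W := σ * b * ‖m.predOf (r i) (t i) z‖ with hW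
          have hW0 : 0 ≤ W := by positivity
          have h1 : ∫ e, f i (e, z) ∂(P.map (m.η 0)) ≤ ∫ e, b⁻¹ *
              (knightRem (m.errOf (r i) (t i) e z) (2 * W)
              + knightRem (m.errOf (r i) (t i) e z) (-(2 * W))) ∂(P.map (m.η 0)) := by
            refine integral_mono_of_nonneg (Eventually.of_forall fun e => hf0 i (e, z))
              (((m.integrable_knightRem_left _ _ _ z).add
              (m.integrable_knightRem_left _ _ _ z)).const_mul _) (Eventually.of_forall fun e => ?_)
            have := mul_indicator_le_knightRem (e := m.errOf (r i) (t i) e z) (w := W)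
            calc f i (e, z) = b⁻¹ * (W * if |m.errOf (r i) (t i) e z| ≤ W then 1 else 0) := by
                  simp only [hf, hW]; field_simp
              _ ≤ _ := mul_le_mul_of_nonneg_left this (by positivity)
          refine h1.trans ?_
          rw [integral_const_mul, integral_add (m.integrable_knightRem_left _ _ _ z)
            (m.integrable_knightRem_left _ _ _ z)]
          have h2 := hz.condKnight_le fun _ => 2 * W
          have h3 := hz.condKnight_le fun _ => -(2 * W)
          rw [abs_neg] at h3
          rw [abs_of_nonneg (by positivity)] at h2 h3
          unfold condKnight at h2 h3
          have hσ3 : σ ^ 3 ≤ σ ^ 2 := pow_le_pow_of_le_one hσ hσ1 (by norm_num)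
          calc _ ≤ b⁻¹ * ((M * (2 * W) ^ 2 + C * (2 * W) ^ 3)
                + (M * (2 * W) ^ 2 + C * (2 * W) ^ 3)) := by gcongr
            _ = σ ^ 2 * (8 * M * b * ‖m.predOf (r i) (t i) z‖ ^ 2)
                + σ ^ 3 * (16 * C * b ^ 2 * ‖m.predOf (r i) (t i) z‖ ^ 3) := by
                rw [hW]; field_simp; ring
            _ ≤ σ ^ 2 * (8 * M * b * ‖m.predOf (r i) (t i) z‖ ^ 2)
                + σ ^ 2 * (16 * C * b ^ 2 * ‖m.predOf (r i) (t i) z‖ ^ 3) := by gcongr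
            _ = _ := by ring
      _ ≤ _ := by
          rw [integral_const_mul, integral_add ((hmom2 i hi).1.const_mul (8 * M * b))
            ((hmom3 i hi).1.const_mul (16 * C * b ^ 2)), integral_const_mul, integral_const_mul]
          have h2 := (hmom2 i hi).2
          have h3 := (hmom3 i hi).2
          rw [hK]
          gcongr
  · refine ENNReal.ofReal_le_ofReal ?_
    calc N * (σ ^ 2 * K) = (N * σ ^ 2) * K := by ring
      _ ≤ 1 * K := by gcongr
      _ = K := one_mul K

end Sums

end PLSProcess

/-! ### Quadratic forms -/

theorem quadForm_sum {p : ℕ} {ι : Type*} (s : Finset ι) (S : ι → Matrix (Fin p) (Fin p) ℝ)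
    (v : EuclideanSpace ℝ (Fin p)) : quadForm (∑ i ∈ s, S i) v = ∑ i ∈ s, quadForm (S i) v := by
  unfold quadForm
  rw [map_sum, LinearMap.sum_apply, inner_sum]

theorem quadForm_smul {p : ℕ} (c : ℝ) (S : Matrix (Fin p) (Fin p) ℝ)
    (v : EuclideanSpace ℝ (Fin p)) : quadForm (c • S) v = c * quadForm S v := by
  unfold quadForm
  rw [map_smul, LinearMap.smul_apply, inner_smul_right]

theorem abs_quadForm_le {p : ℕ} (S : Matrix (Fin p) (Fin p) ℝ) (v : EuclideanSpace ℝ (Fin p)) :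
    |quadForm S v| ≤ (∑ j, ∑ l, |S j l|) * ‖v‖ ^ 2 := by
  rw [quadForm_eq_sum, Finset.sum_mul]
  refine (Finset.abs_sum_le_sum_abs _ _).trans (Finset.sum_le_sum fun j _ => ?_)
  rw [Finset.sum_mul]
  refine (Finset.abs_sum_le_sum_abs _ _).trans (Finset.sum_le_sum fun l _ => ?_)
  rw [abs_mul, abs_mul, sq]
  have h1 : |v j| ≤ ‖v‖ := PiLp.norm_apply_le v j
  have h2 : |v l| ≤ ‖v‖ := PiLp.norm_apply_le v l
  gcongr

theorem abs_checkDeriv_le {τ : ℝ} (hτ₀ : 0 < τ) (hτ₁ : τ < 1) (u : ℝ) : |checkDeriv τ u| ≤ 1 := by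
  unfold checkDeriv
  split_ifs <;> rw [abs_le] <;> constructor <;> linarith

namespace PLSProcess

variable {Ω A B : Type*} [MeasurableSpace Ω] [MeasurableSpace A] [MeasurableSpace B]
  {P : Measure Ω} {p R : ℕ}

/-! ### Observations at the break points -/

/-- The observations at rescaled times inside the open segments. -/
noncomputable def interiorIdx (m : PLSProcess Ω A B P p R) (n : ℕ) : Finset ℕ :=
  open Classical in
  (Finset.Icc 1 n).filter fun i : ℕ => (i : ℝ) / n ∈ m.openSeg (m.seg ((i : ℝ) / n))

/-- The observations at the break points. -/
noncomputable def breakIdx (m : PLSProcess Ω A B P p R) (n : ℕ) : Finset ℕ :=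
  open Classical in
  (Finset.Icc 1 n).filter fun i : ℕ => ¬ (i : ℝ) / n ∈ m.openSeg (m.seg ((i : ℝ) / n))

theorem sum_interiorIdx_add_sum_breakIdx (m : PLSProcess Ω A B P p R) (n : ℕ) {E : Type*}
    [AddCommMonoid E] (f : ℕ → E) :
    ∑ i ∈ m.interiorIdx n, f i + ∑ i ∈ m.breakIdx n, f i = ∑ i ∈ Finset.Icc 1 n, f i := by
  classical
  unfold interiorIdx breakIdx
  convert Finset.sum_filter_add_sum_filter_not (Finset.Icc 1 n)
    (fun i : ℕ => (i : ℝ) / n ∈ m.openSeg (m.seg ((i : ℝ) / n))) f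

theorem mem_interiorIdx (m : PLSProcess Ω A B P p R) {n i : ℕ} :
    i ∈ m.interiorIdx n ↔ (1 ≤ i ∧ i ≤ n) ∧ (i : ℝ) / n ∈ m.openSeg (m.seg ((i : ℝ) / n)) := by
  simp [interiorIdx]

theorem mem_breakIdx (m : PLSProcess Ω A B P p R) {n i : ℕ} (hi : i ∈ m.breakIdx n) :
    1 ≤ i ∧ i ≤ n ∧ (i : ℝ) / n = m.b (m.seg ((i : ℝ) / n)).succ := by
  classical
  simp only [breakIdx, Finset.mem_filter, Finset.mem_Icc] at hi
  obtain ⟨⟨h1, h2⟩, h3⟩ := hi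
  refine ⟨h1, h2, ?_⟩
  have hn : (0 : ℝ) < n := by exact_mod_cast (by omega : 0 < n)
  have h4 := m.seg_spec (t := (i : ℝ) / n) (div_pos (by exact_mod_cast h1) hn)
    ((div_le_one hn).2 (by exact_mod_cast h2))
  by_contra hne
  exact h3 ⟨h4.1, lt_of_le_of_ne h4.2 hne⟩

theorem card_interiorIdx_le (m : PLSProcess Ω A B P p R) (n : ℕ) : (m.interiorIdx n).card ≤ n := by
  classical
  exact (Finset.card_filter_le _ _).trans (by simp)

/-- A segment has at most one design point outside its interior, its right end point. -/
theorem card_breakIdx_le (m : PLSProcess Ω A B P p R) (n : ℕ) :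
    (m.breakIdx n).card ≤ R + 1 := by
  have h := Finset.card_le_card_of_injOn (s := m.breakIdx n) (t := Finset.univ)
    (fun i : ℕ => m.seg ((i : ℝ) / n)) (fun i _ => Finset.mem_univ _) (by
      intro i hi j hj hij
      obtain ⟨h1, h2, h3⟩ := m.mem_breakIdx hi
      obtain ⟨h4, h5, h6⟩ := m.mem_breakIdx hj
      have hn : (n : ℝ) ≠ 0 := by exact_mod_cast (by omega : n ≠ 0)
      simp only at hij
      rw [hij, ← h6] at h3
      exact_mod_cast (div_left_inj' hn).1 h3)
  simpa using h

theorem le_card_interiorIdx (m : PLSProcess Ω A B P p R) (n : ℕ) :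
    (n : ℝ) - (R + 1) ≤ (m.interiorIdx n).card := by
  have h := m.sum_interiorIdx_add_sum_breakIdx n fun _ => 1
  simp only [Finset.sum_const, smul_eq_mul, mul_one, Nat.card_Icc, Nat.add_sub_cancel] at h
  have h2 := m.card_breakIdx_le n
  have h3 : (n : ℝ) = (m.interiorIdx n).card + (m.breakIdx n).card := by exact_mod_cast h.symm
  have h4 : ((m.breakIdx n).card : ℝ) ≤ R + 1 := by exact_mod_cast h2
  linarith

/-! ### The curvature matrix -/

/-- The contribution `E(f_r(t, 0 | F_{-1}, G_0) x xᵀ)`, `x = H_r(t, F_{-1}, G_0)`, to `K_n`. -/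
noncomputable def curv (m : PLSProcess Ω A B P p R) (r : Fin (R + 1)) (t : ℝ) :
    Matrix (Fin p) (Fin p) ℝ :=
  Matrix.of fun j l =>
    ∫ z, m.densOf r t z * (m.predOf r t z j * m.predOf r t z l) ∂m.pastLaw

variable [IsProbabilityMeasure P]

theorem K_eq_sum_curv (m : PLSProcess Ω A B P p R) (n : ℕ) :
    m.K n = ∑ i ∈ Finset.Icc 1 n, m.curv (m.seg ((i : ℝ) / n)) ((i : ℝ) / n) := by
  ext j l
  simp only [K, Matrix.of_apply, Matrix.sum_apply, curv]
  refine Finset.sum_congr rfl fun i _ => ?_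
  have h1 := m.measurable_predOf (m.seg ((i : ℝ) / n)) ((i : ℝ) / n)
  have h2 := m.measurable_densOf (m.seg ((i : ℝ) / n)) ((i : ℝ) / n)
  rw [← m.integral_past i (by fun_prop)]
  rfl

omit [IsProbabilityMeasure P] in
theorem isHermitian_K (m : PLSProcess Ω A B P p R) (n : ℕ) : (m.K n).IsHermitian := by
  ext j l
  simp only [K, Matrix.conjTranspose_apply, Matrix.of_apply, star_trivial]
  refine Finset.sum_congr rfl fun i _ => integral_congr_ae (Eventually.of_forall fun ω => ?_)
  simp only [mul_comm (m.x n i ω l)]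

theorem RegularAt.quadForm_curv {m : PLSProcess Ω A B P p R} {τ ε₀ M C : ℝ} {a : ℕ → ℝ≥0∞}
    {r : Fin (R + 1)} {t : ℝ} (h : m.RegularAt τ ε₀ M C a r t) (hM : 0 ≤ M)
    (u : EuclideanSpace ℝ (Fin p)) :
    quadForm (m.curv r t) u
      = ∫ z, m.densOf r t z * inner ℝ (m.predOf r t z) u ^ 2 ∂m.pastLaw := by
  have h1 := m.measurable_predOf r t
  have h2 := m.measurable_densOf r t
  have hint : ∀ j l, Integrable
      (fun z => m.densOf r t z * (m.predOf r t z j * m.predOf r t z l)) m.pastLaw := by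
    intro j l
    refine ((integral_norm_pow_le h.memLp.1 hM h.moment (k := 2) (by norm_num)).1.const_mul M).mono'
      (by fun_prop) ?_
    filter_upwards [h.expansion] with z hz
    have h3 := hz.dens_le
    have h4 := m.densOf_nonneg r t z
    have h5 : |m.predOf r t z j| ≤ ‖m.predOf r t z‖ := PiLp.norm_apply_le (m.predOf r t z) j
    have h6 : |m.predOf r t z l| ≤ ‖m.predOf r t z‖ := PiLp.norm_apply_le (m.predOf r t z) l
    rw [Real.norm_eq_abs, abs_mul, abs_mul, abs_of_nonneg h4, sq]
    gcongr
  rw [quadForm_eq_sum]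
  simp_rw [inner_sq_eq_sum, Finset.mul_sum]
  have hint' : ∀ j l, Integrable (fun z => m.densOf r t z
      * (m.predOf r t z j * m.predOf r t z l * (u j * u l))) m.pastLaw := fun j l =>
    ((hint j l).mul_const (u j * u l)).congr (Eventually.of_forall fun z => by simp only; ring)
  rw [integral_finsetSum _ fun j _ => integrable_finsetSum _ fun l _ => hint' j l]
  refine Finset.sum_congr rfl fun j _ => ?_
  rw [integral_finsetSum _ fun l _ => hint' j l]
  refine Finset.sum_congr rfl fun l _ => ?_
  rw [curv, Matrix.of_apply, ← integral_mul_const]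
  exact integral_congr_ae (Eventually.of_forall fun z => by simp only; ring)

omit [IsProbabilityMeasure P] in
/-- The observations at the break points contribute a bounded amount to the curvature: there is one
matrix for each break point, whatever the sample size. -/
theorem exists_abs_sum_breakIdx_quadForm_le (m : PLSProcess Ω A B P p R) :
    ∃ κ : ℝ, 0 ≤ κ ∧ ∀ (n : ℕ) (u : EuclideanSpace ℝ (Fin p)),
      |∑ i ∈ m.breakIdx n, quadForm (m.curv (m.seg ((i : ℝ) / n)) ((i : ℝ) / n)) u| ≤ κ * ‖u‖ ^ 2 := by
  set c : Fin (R + 1) → ℝ := fun r => ∑ j, ∑ l, |m.curv r (m.b r.succ) j l| with hc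
  have hc0 : ∀ r, 0 ≤ c r := fun r => by positivity
  refine ⟨(R + 1 : ℕ) * ∑ r, c r, by positivity, fun n u => ?_⟩
  have h1 : ∀ i ∈ m.breakIdx n,
      |quadForm (m.curv (m.seg ((i : ℝ) / n)) ((i : ℝ) / n)) u| ≤ (∑ r, c r) * ‖u‖ ^ 2 := by
    intro i hi
    refine (abs_quadForm_le _ _).trans ?_
    have h2 : ∑ j, ∑ l, |m.curv (m.seg ((i : ℝ) / n)) ((i : ℝ) / n) j l|
        = c (m.seg ((i : ℝ) / n)) := by
      rw [hc]
      simp only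
      rw [← (m.mem_breakIdx hi).2.2]
    rw [h2]
    have := Finset.single_le_sum (f := c) (fun r _ => hc0 r)
      (Finset.mem_univ (m.seg ((i : ℝ) / n)))
    gcongr
  refine (Finset.abs_sum_le_sum_abs _ _).trans ((Finset.sum_le_sum h1).trans ?_)
  rw [Finset.sum_const, nsmul_eq_mul, mul_assoc]
  have := m.card_breakIdx_le n
  have h0 : 0 ≤ (∑ r, c r) * ‖u‖ ^ 2 := mul_nonneg (Finset.sum_nonneg fun r _ => hc0 r) (by positivity)
  gcongr

/-! ### The sample -/

/-- The summands at the break points are negligible if they are dominated by the predictors. -/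
theorem eLpNorm_sum_breakIdx_le (m : PLSProcess Ω A B P p R) {M : ℝ} (hM : 0 ≤ M) {n : ℕ}
    (hmom : ∀ i : ℕ, 1 ≤ i → i ≤ n →
      eLpNorm (m.predOf (m.seg ((i : ℝ) / n)) ((i : ℝ) / n)) 4 m.pastLaw ≤ ENNReal.ofReal M)
    {f : ℕ → A × ((ℕ → A) × (ℕ → B)) → ℝ} (hfm : ∀ i, Measurable (f i)) {c : ℝ} (hc : 0 ≤ c)
    (hf : ∀ i w, |f i w| ≤ c * ‖m.predOf (m.seg ((i : ℝ) / n)) ((i : ℝ) / n) w.2‖) :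
    eLpNorm (fun ω => ∑ i ∈ m.breakIdx n, f i (m.η i ω, m.past i ω)) 1 P
      ≤ ENNReal.ofReal ((R + 1 : ℕ) * (c * M)) := by
  have hpη := m.isProbabilityMeasure_map_η
  have hint : ∀ i ∈ m.breakIdx n,
      Integrable (fun z => ‖m.predOf (m.seg ((i : ℝ) / n)) ((i : ℝ) / n) z‖) m.pastLaw ∧
      ∫ z, ‖m.predOf (m.seg ((i : ℝ) / n)) ((i : ℝ) / n) z‖ ∂m.pastLaw ≤ M := by
    intro i hi
    obtain ⟨h1, h2, -⟩ := m.mem_breakIdx hi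
    have := integral_norm_pow_le (m.measurable_predOf (m.seg ((i : ℝ) / n))
      ((i : ℝ) / n)).aestronglyMeasurable hM (hmom i h1 h2) (k := 1) (by norm_num)
    simpa only [pow_one] using this
  have hfi : ∀ i ∈ m.breakIdx n, Integrable (f i) ((P.map (m.η 0)).prod m.pastLaw) := fun i hi =>
    (((hint i hi).1.const_mul c).comp_snd (P.map (m.η 0))).mono' (hfm i).aestronglyMeasurable
      (Eventually.of_forall fun w => hf i w)
  refine m.eLpNorm_one_sum_le (m.card_breakIdx_le n) hfi fun i hi => ?_
  refine (integral_mono (hfi i hi).abs (((hint i hi).1.const_mul c).comp_snd (P.map (m.η 0)))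
    (hf i)).trans ?_
  have e := integral_fun_snd (μ := P.map (m.η 0)) (ν := m.pastLaw)
    (fun z => c * ‖m.predOf (m.seg ((i : ℝ) / n)) ((i : ℝ) / n) z‖)
  rw [e, probReal_univ, one_smul, integral_const_mul]
  exact mul_le_mul_of_nonneg_left (hint i hi).2 hc

end PLSProcess

/-! ### The local objective function -/

theorem EuclideanSpace.norm_le_sum_abs {p : ℕ} (x : EuclideanSpace ℝ (Fin p)) :
    ‖x‖ ≤ ∑ j, |x j| := by
  rw [EuclideanSpace.norm_eq]
  simp_rw [Real.norm_eq_abs]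
  rw [Real.sqrt_le_left (by positivity)]
  exact Finset.sum_sq_le_sq_sum_of_nonneg fun j _ => abs_nonneg _

theorem inv_sqrt_natCast_le_one (n : ℕ) : (√(n : ℝ))⁻¹ ≤ 1 := by
  rcases Nat.eq_zero_or_pos n with rfl | h
  · simp
  · refine inv_le_one_of_one_le₀ ?_
    rw [Real.one_le_sqrt]
    exact_mod_cast h

theorem natCast_mul_inv_sqrt_sq_le (n : ℕ) : (n : ℝ) * (√(n : ℝ))⁻¹ ^ 2 ≤ 1 := by
  rw [inv_pow, Real.sq_sqrt (by positivity)]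
  exact mul_inv_le_one

namespace PLSProcess

variable {Ω A B : Type*} [MeasurableSpace Ω] [MeasurableSpace A] [MeasurableSpace B]
  {P : Measure Ω} {p R : ℕ}

/-- Uniform regularity of the triangular array of predictors and errors. The moment bound includes
the observations at the break points. -/
structure RegularDesign (m : PLSProcess Ω A B P p R) (τ ε₀ M C : ℝ) (a : ℕ → ℝ≥0∞) : Prop where
  pos : 0 < ε₀
  nonneg_M : 0 ≤ M
  nonneg_C : 0 ≤ C
  summable : ∑' k, a k ≠ ⊤
  moment : ∀ n i : ℕ, 1 ≤ i → i ≤ n →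
    eLpNorm (m.predOf (m.seg ((i : ℝ) / n)) ((i : ℝ) / n)) 4 m.pastLaw ≤ ENNReal.ofReal M
  regularAt : ∀ n, ∀ i ∈ m.interiorIdx n,
    m.RegularAt τ ε₀ M C a (m.seg ((i : ℝ) / n)) ((i : ℝ) / n)

/-- The sum of Knight's remainders at the local parameter `u = √n (β - β₀)`. -/
noncomputable def knightSum (m : PLSProcess Ω A B P p R) (n : ℕ) (ω : Ω)
    (u : EuclideanSpace ℝ (Fin p)) : ℝ :=
  ∑ i ∈ Finset.Icc 1 n, knightRem (m.ε n i ω) ((√n)⁻¹ * inner ℝ (m.x n i ω) u)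

/-- A Lipschitz constant of `knightSum` on the ball of radius `b`. -/
noncomputable def lipSum (m : PLSProcess Ω A B P p R) (n : ℕ) (b : ℝ) (ω : Ω) : ℝ :=
  ∑ i ∈ Finset.Icc 1 n, (√n)⁻¹ * ‖m.x n i ω‖
    * if |m.ε n i ω| ≤ (√n)⁻¹ * b * ‖m.x n i ω‖ then 1 else 0

theorem ε_eq (m : PLSProcess Ω A B P p R) (n i : ℕ) (ω : Ω) : m.ε n i ω
    = m.errOf (m.seg ((i : ℝ) / n)) ((i : ℝ) / n) (m.η i ω) (m.past i ω) := m.err_eq _ _ _ _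

theorem x_eq (m : PLSProcess Ω A B P p R) (n i : ℕ) (ω : Ω) : m.x n i ω
    = m.predOf (m.seg ((i : ℝ) / n)) ((i : ℝ) / n) (m.past i ω) := rfl

theorem measurable_x (m : PLSProcess Ω A B P p R) (n i : ℕ) :
    Measurable (m.x n i) := (m.measurable_predOf _ _).comp (m.measurable_past i)

theorem measurable_ε (m : PLSProcess Ω A B P p R) (n i : ℕ) :
    Measurable (m.ε n i) := by
  have : m.ε n i = fun ω =>
      m.errOf (m.seg ((i : ℝ) / n)) ((i : ℝ) / n) (m.η i ω) (m.past i ω) := by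
    funext ω; exact m.ε_eq n i ω
  rw [this]
  exact (m.measurable_errOf _ _).comp ((m.measurable_η i).prodMk (m.measurable_past i))

theorem measurable_knightSum (m : PLSProcess Ω A B P p R) (n : ℕ)
    (u : EuclideanSpace ℝ (Fin p)) : Measurable fun ω => m.knightSum n ω u :=
  Finset.measurable_fun_sum _ fun i _ => measurable_knightRem.comp
    ((m.measurable_ε n i).prodMk (((m.measurable_x n i).inner_const (c := u)).const_mul _))

theorem measurable_lipSum (m : PLSProcess Ω A B P p R) (n : ℕ) (b : ℝ) :
    Measurable fun ω => m.lipSum n b ω :=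
  Finset.measurable_fun_sum _ fun i _ => ((m.measurable_x n i).norm.const_mul _).mul
    (Measurable.ite (measurableSet_le (m.measurable_ε n i).abs
      ((m.measurable_x n i).norm.const_mul _)) measurable_const measurable_const)

theorem measurable_G (m : PLSProcess Ω A B P p R) (τ : ℝ) (n : ℕ) :
    Measurable (m.G τ n) := by
  unfold G
  exact Finset.measurable_fun_sum _ fun i _ =>
    ((measurable_checkDeriv τ).comp (m.measurable_ε n i)).smul (m.measurable_x n i)

theorem abs_knightSum_sub_le (m : PLSProcess Ω A B P p R) (n : ℕ) (ω : Ω) {b : ℝ}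
    {u u' : EuclideanSpace ℝ (Fin p)} (hu : ‖u‖ ≤ b) (hu' : ‖u'‖ ≤ b) :
    |m.knightSum n ω u - m.knightSum n ω u'| ≤ m.lipSum n b ω * ‖u - u'‖ := by
  unfold knightSum lipSum
  rw [← Finset.sum_sub_distrib, Finset.sum_mul]
  refine (Finset.abs_sum_le_sum_abs _ _).trans (Finset.sum_le_sum fun i _ => ?_)
  set x := m.x n i ω
  have hb : ∀ v : EuclideanSpace ℝ (Fin p), ‖v‖ ≤ b →
      |(√n)⁻¹ * inner ℝ x v| ≤ (√n)⁻¹ * b * ‖x‖ := fun v hv => by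
    rw [abs_mul, abs_of_nonneg (by positivity)]
    have := abs_real_inner_le_norm x v
    calc (√n)⁻¹ * |inner ℝ x v| ≤ (√n)⁻¹ * (‖x‖ * b) := by
          gcongr; exact this.trans (by gcongr)
      _ = _ := by ring
  refine (abs_knightRem_sub_le (hb u hu) (hb u' hu')).trans ?_
  have h1 : |(√n)⁻¹ * inner ℝ x u - (√n)⁻¹ * inner ℝ x u'| ≤ (√n)⁻¹ * ‖x‖ * ‖u - u'‖ := by
    rw [← mul_sub, ← inner_sub_right, abs_mul, abs_of_nonneg (by positivity : 0 ≤ (√(n : ℝ))⁻¹),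
      mul_assoc]
    gcongr
    exact abs_real_inner_le_norm _ _
  split_ifs
  · simpa using h1
  · simp

/-- Knight's identity. -/
theorem loss_sub_loss (m : PLSProcess Ω A B P p R) (τ : ℝ) (β₀ : EuclideanSpace ℝ (Fin p)) (n : ℕ)
    (ω : Ω) (u : EuclideanSpace ℝ (Fin p)) :
    m.loss τ β₀ n ω (β₀ + (√n)⁻¹ • u) - m.loss τ β₀ n ω β₀
      = m.knightSum n ω u - inner ℝ ((√n)⁻¹ • m.G τ n ω) u := by
  unfold loss knightSum G y
  rw [← Finset.sum_sub_distrib, Finset.smul_sum, sum_inner, ← Finset.sum_sub_distrib]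
  refine Finset.sum_congr rfl fun i _ => ?_
  have h := checkFun_sub τ (m.ε n i ω) ((√n)⁻¹ * inner ℝ (m.x n i ω) u)
  have e1 : inner ℝ (m.x n i ω) β₀ + m.ε n i ω - inner ℝ (m.x n i ω) (β₀ + (√n)⁻¹ • u)
      = m.ε n i ω - (√n)⁻¹ * inner ℝ (m.x n i ω) u := by
    rw [inner_add_right, real_inner_smul_right]; ring
  rw [e1, add_sub_cancel_left, h, real_inner_smul_left, real_inner_smul_left]
  ring

variable [IsProbabilityMeasure P]

theorem exists_regularDesign (m : PLSProcess Ω A B P p R) (hp : 0 < p) {τ : ℝ}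
    (hquant : m.CondQuantileZero τ) (h1 : m.C1) (h2 : m.C2) (h3 : m.C3) (h4 : m.C4) :
    ∃ (ε₀ M C : ℝ) (a : ℕ → ℝ≥0∞), m.RegularDesign τ ε₀ M C a := by
  obtain ⟨ε₀, M, C, a, h5, h6, h7, h8, h9, h10⟩ := m.exists_regularAt hp hquant h1 h2 h3 h4
  refine ⟨ε₀, M, C, a, h5, h6, h7, h8, h9, fun n i hi => ?_⟩
  obtain ⟨⟨h11, h12⟩, h13⟩ := m.mem_interiorIdx.1 hi
  exact h10 n i h11 h12 h13

namespace RegularDesign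

variable {m : PLSProcess Ω A B P p R} {τ ε₀ M C : ℝ} {a : ℕ → ℝ≥0∞}

/-- The components of the normalized score are bounded in mean. -/
theorem exists_eLpNorm_inner_score_le (h : m.RegularDesign τ ε₀ M C a) (hτ₀ : 0 < τ) (hτ₁ : τ < 1)
    (v : EuclideanSpace ℝ (Fin p)) :
    ∃ K : ℝ, 0 ≤ K ∧ ∀ n : ℕ,
      eLpNorm (fun ω => inner ℝ ((√n)⁻¹ • m.G τ n ω) v) 1 P ≤ ENNReal.ofReal K := by
  have hM := h.nonneg_M
  refine ⟨‖v‖ * (M + (1 + M) * (∑' k, a k).toReal) + (R + 1 : ℕ) * (‖v‖ * M), by positivity,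
    fun n => ?_⟩
  set f : ℕ → A × ((ℕ → A) × (ℕ → B)) → ℝ := fun i w =>
    (√n)⁻¹ * (inner ℝ (m.predOf (m.seg ((i : ℝ) / n)) ((i : ℝ) / n) w.2) v
      * checkDeriv τ (m.errOf (m.seg ((i : ℝ) / n)) ((i : ℝ) / n) w.1 w.2)) with hf
  have hfm : ∀ i, Measurable (f i) := fun i => by
    have h1 := m.measurable_predOf (m.seg ((i : ℝ) / n)) ((i : ℝ) / n)
    have h2 : Measurable fun z =>
      inner ℝ (m.predOf (m.seg ((i : ℝ) / n)) ((i : ℝ) / n) z) v := by fun_prop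
    exact ((h2.comp measurable_snd).mul ((measurable_checkDeriv τ).comp
      (m.measurable_errOf _ _))).const_mul _
  have hcomp : ∀ i : ℕ, Measurable fun ω => f i (m.η i ω, m.past i ω) := fun i =>
    (hfm i).comp ((m.measurable_η i).prodMk (m.measurable_past i))
  have e : (fun ω => inner ℝ ((√n)⁻¹ • m.G τ n ω) v)
      = (fun ω => ∑ i ∈ m.interiorIdx n, f i (m.η i ω, m.past i ω))
        + fun ω => ∑ i ∈ m.breakIdx n, f i (m.η i ω, m.past i ω) := by
    funext ω
    rw [Pi.add_apply, m.sum_interiorIdx_add_sum_breakIdx n fun i => f i (m.η i ω, m.past i ω)]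
    unfold G
    rw [Finset.smul_sum, sum_inner]
    refine Finset.sum_congr rfl fun i _ => ?_
    simp only [hf]
    rw [real_inner_smul_left, real_inner_smul_left, m.ε_eq, m.x_eq]
    ring
  have hbad := m.eLpNorm_sum_breakIdx_le hM (h.moment n) hfm (norm_nonneg v) fun i w => by
    simp only [hf]
    rw [abs_mul, abs_mul, abs_of_nonneg (by positivity)]
    have h1 := abs_checkDeriv_le hτ₀ hτ₁ (m.errOf (m.seg ((i : ℝ) / n)) ((i : ℝ) / n) w.1 w.2)
    have h2 := abs_real_inner_le_norm (m.predOf (m.seg ((i : ℝ) / n)) ((i : ℝ) / n) w.2) v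
    have h3 := inv_sqrt_natCast_le_one n
    set x := m.predOf (m.seg ((i : ℝ) / n)) ((i : ℝ) / n) w.2
    calc _ ≤ 1 * (‖x‖ * ‖v‖ * 1) := by gcongr
      _ = _ := by ring
  have hgood : eLpNorm (fun ω => ∑ i ∈ m.interiorIdx n, f i (m.η i ω, m.past i ω)) 1 P
      ≤ ENNReal.ofReal (‖v‖ * (M + (1 + M) * (∑' k, a k).toReal)) := by
    refine (eLpNorm_le_eLpNorm_of_exponent_le one_le_two
      (Finset.measurable_fun_sum _ fun i _ => hcomp i).aestronglyMeasurable).trans ?_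
    have h1 := m.eLpNorm_score_le hM hτ₀ hτ₁ h.summable (m.card_interiorIdx_le n)
      (h.regularAt n) v
    have e2 : (fun ω => ∑ i ∈ m.interiorIdx n, f i (m.η i ω, m.past i ω))
        = (√n)⁻¹ • fun ω => ∑ i ∈ m.interiorIdx n,
          inner ℝ (m.predOf (m.seg ((i : ℝ) / n)) ((i : ℝ) / n) (m.past i ω)) v
      * checkDeriv τ (m.errOf (m.seg ((i : ℝ) / n)) ((i : ℝ) / n) (m.η i ω) (m.past i ω)) := by
      funext ω
      rw [Pi.smul_apply, smul_eq_mul, Finset.mul_sum]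
    rw [e2, eLpNorm_const_smul, Real.enorm_eq_ofReal (by positivity)]
    refine (mul_le_mul_right h1 _).trans ?_
    rw [← ENNReal.ofReal_mul (by positivity)]
    refine ENNReal.ofReal_le_ofReal ?_
    rw [← mul_assoc]
    exact mul_le_of_le_one_left (by positivity) inv_mul_le_one
  rw [e]
  refine (eLpNorm_add_le (Finset.measurable_fun_sum _ fun i _ => hcomp i).aestronglyMeasurable
    (Finset.measurable_fun_sum _ fun i _ => hcomp i).aestronglyMeasurable le_rfl).trans
    ((add_le_add hgood hbad).trans ?_)
  rw [← ENNReal.ofReal_add (by positivity) (by positivity)]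

/-- The normalized score is bounded in mean. -/
theorem exists_eLpNorm_score_le (h : m.RegularDesign τ ε₀ M C a) (hτ₀ : 0 < τ) (hτ₁ : τ < 1) :
    ∃ K : ℝ, 0 ≤ K ∧ ∀ n : ℕ,
      eLpNorm (fun ω => (√n)⁻¹ • m.G τ n ω) 1 P ≤ ENNReal.ofReal K := by
  choose K hK0 hK using fun j : Fin p =>
    h.exists_eLpNorm_inner_score_le hτ₀ hτ₁ (EuclideanSpace.single j 1)
  refine ⟨∑ j, K j, Finset.sum_nonneg fun j _ => hK0 j, fun n => ?_⟩
  have hm : ∀ j : Fin p, Measurable fun ω =>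
      |inner ℝ ((√n)⁻¹ • m.G τ n ω) (EuclideanSpace.single j (1 : ℝ))| := fun j =>
    (((m.measurable_G τ n).const_smul ((√n)⁻¹ : ℝ)).inner_const
      (c := EuclideanSpace.single j (1 : ℝ))).abs
  calc _ ≤ eLpNorm (∑ j : Fin p, fun ω =>
        |inner ℝ ((√n)⁻¹ • m.G τ n ω) (EuclideanSpace.single j (1 : ℝ))|) 1 P := by
        refine eLpNorm_mono_real fun ω => ?_
        rw [Finset.sum_apply]
        refine (EuclideanSpace.norm_le_sum_abs _).trans (le_of_eq ?_)
        exact Finset.sum_congr rfl fun j _ => by simp [EuclideanSpace.inner_single_right]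
    _ ≤ ∑ j : Fin p, eLpNorm (fun ω =>
        |inner ℝ ((√n)⁻¹ • m.G τ n ω) (EuclideanSpace.single j (1 : ℝ))|) 1 P :=
        eLpNorm_sum_le (fun j _ => (hm j).aestronglyMeasurable) le_rfl
    _ ≤ ∑ j, ENNReal.ofReal (K j) := Finset.sum_le_sum fun j _ => by
        refine le_trans (le_of_eq ?_) (hK j n)
        exact eLpNorm_norm (fun ω => inner ℝ ((√n)⁻¹ • m.G τ n ω) (EuclideanSpace.single j (1 : ℝ)))
    _ = _ := (ENNReal.ofReal_sum_of_nonneg fun j _ => hK0 j).symm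

/-- The sum of Knight's remainders is asymptotically quadratic at each local parameter. -/
theorem exists_eLpNorm_knightSum_sub_le (h : m.RegularDesign τ ε₀ M C a)
    (u : EuclideanSpace ℝ (Fin p)) :
    ∃ K : ℝ, ∀ n : ℕ, 1 ≤ n →
      eLpNorm (fun ω => m.knightSum n ω u - quadForm ((n : ℝ)⁻¹ • m.K n) u / 2) 1 P
        ≤ ENNReal.ofReal (√(√n)⁻¹ * K) := by
  have hM := h.nonneg_M
  have hC := h.nonneg_C
  obtain ⟨κ, hκ, hbreak⟩ := m.exists_abs_sum_breakIdx_quadForm_le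
  refine ⟨(√(2 * (M * (M * ‖u‖) ^ 3 + C * (M * ‖u‖) ^ 4))
        + C * (M * ‖u‖) ^ 3 + (M * (M * ‖u‖) ^ 4
        + (1 + 2 * M * ‖u‖) * (∑' k, a k).toReal)) + (R + 1 : ℕ) * (‖u‖ * M) + κ * ‖u‖ ^ 2,
        fun n hn => ?_⟩
  have hn0 : (0 : ℝ) < n := by exact_mod_cast hn
  have hσ2 : (n : ℝ)⁻¹ = (√n)⁻¹ ^ 2 := by rw [inv_pow, Real.sq_sqrt hn0.le]
  have hσ1 := inv_sqrt_natCast_le_one n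
  have hσN := natCast_mul_inv_sqrt_sq_le n
  have hσ : 0 < (√(n : ℝ))⁻¹ := by positivity
  have hσs : (√(n : ℝ))⁻¹ ≤ √(√(n : ℝ))⁻¹ := by
    nth_rewrite 1 [← Real.mul_self_sqrt hσ.le]
    exact mul_le_of_le_one_right (by positivity) (Real.sqrt_le_one.2 hσ1)
  set σ : ℝ := (√(n : ℝ))⁻¹ with hσdef
  set f : ℕ → A × ((ℕ → A) × (ℕ → B)) → ℝ := fun i w =>
    knightRem (m.errOf (m.seg ((i : ℝ) / n)) ((i : ℝ) / n) w.1 w.2)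
      (σ * inner ℝ (m.predOf (m.seg ((i : ℝ) / n)) ((i : ℝ) / n) w.2) u) with hf
  have hfm : ∀ i, Measurable (f i) := fun i => by
    have h1 := m.measurable_predOf (m.seg ((i : ℝ) / n)) ((i : ℝ) / n)
    exact m.measurable_knightRem_errOf (v := fun z =>
      σ * inner ℝ (m.predOf (m.seg ((i : ℝ) / n)) ((i : ℝ) / n) z) u) _ _ (by fun_prop)
  have hcomp : ∀ i : ℕ, Measurable fun ω => f i (m.η i ω, m.past i ω) := fun i =>
    (hfm i).comp ((m.measurable_η i).prodMk (m.measurable_past i))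
  have hgood := m.eLpNorm_sum_knightRem_sub_le hM hC h.summable (m.card_interiorIdx_le n)
    (h.regularAt n) u hσ hσ1 hσN
  have hbad := m.eLpNorm_sum_breakIdx_le hM (h.moment n) hfm (c := σ * ‖u‖) (by positivity)
    fun i w => by
      simp only [hf]
      rw [abs_of_nonneg (knightRem_nonneg _ _)]
      refine (knightRem_le _ _).trans ?_
      rw [abs_mul, abs_of_nonneg hσ.le]
      have h2 := abs_real_inner_le_norm (m.predOf (m.seg ((i : ℝ) / n)) ((i : ℝ) / n) w.2) u
      calc _ ≤ σ * (‖m.predOf (m.seg ((i : ℝ) / n)) ((i : ℝ) / n) w.2‖ * ‖u‖) := by gcongr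
        _ = _ := by ring
  set c : ℝ := σ ^ 2 / 2
    * ∑ i ∈ m.breakIdx n, quadForm (m.curv (m.seg ((i : ℝ) / n)) ((i : ℝ) / n)) u with hc
  have hcle : |c| ≤ √σ * (κ * ‖u‖ ^ 2) := by
    rw [hc, abs_mul, abs_of_nonneg (by positivity)]
    have h1 := hbreak n u
    have h2 : σ ^ 2 / 2 ≤ √σ := by
      have : σ ^ 2 ≤ σ := by nlinarith
      linarith
    gcongr
  have hconst : eLpNorm (fun _ : Ω => c) 1 P ≤ ENNReal.ofReal (√σ * (κ * ‖u‖ ^ 2)) := by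
    rw [eLpNorm_const _ one_ne_zero (NeZero.ne P), measure_univ, ENNReal.one_rpow, mul_one,
      Real.enorm_eq_ofReal_abs]
    exact ENNReal.ofReal_le_ofReal hcle
  have hQ : quadForm ((n : ℝ)⁻¹ • m.K n) u / 2 = σ ^ 2 / 2 * (∑ i ∈ m.interiorIdx n,
      ∫ z, m.densOf (m.seg ((i : ℝ) / n)) ((i : ℝ) / n) z
        * inner ℝ (m.predOf (m.seg ((i : ℝ) / n)) ((i : ℝ) / n) z) u ^ 2 ∂m.pastLaw) + c := by
    rw [quadForm_smul, m.K_eq_sum_curv, quadForm_sum, ← m.sum_interiorIdx_add_sum_breakIdx n,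
      Finset.sum_congr rfl fun i hi => (h.regularAt n i hi).quadForm_curv hM u, hσ2, hc]
    ring
  have e : (fun ω => m.knightSum n ω u - quadForm ((n : ℝ)⁻¹ • m.K n) u / 2)
      = ((fun ω => ∑ i ∈ m.interiorIdx n, f i (m.η i ω, m.past i ω)
      - σ ^ 2 / 2 * ∑ i ∈ m.interiorIdx n, ∫ z, m.densOf (m.seg ((i : ℝ) / n)) ((i : ℝ) / n) z
        * inner ℝ (m.predOf (m.seg ((i : ℝ) / n)) ((i : ℝ) / n) z) u ^ 2 ∂m.pastLaw)
      + fun ω => ∑ i ∈ m.breakIdx n, f i (m.η i ω, m.past i ω)) - fun _ => c := by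
    funext ω
    have e1 : m.knightSum n ω u = ∑ i ∈ Finset.Icc 1 n, f i (m.η i ω, m.past i ω) := by
      unfold knightSum
      refine Finset.sum_congr rfl fun i _ => ?_
      rw [m.ε_eq, m.x_eq]
    rw [e1, hQ, ← m.sum_interiorIdx_add_sum_breakIdx n]
    simp only [Pi.sub_apply, Pi.add_apply]
    ring
  have m1 := ((Finset.measurable_fun_sum (m.interiorIdx n) fun i _ => hcomp i).sub_const
    (σ ^ 2 / 2 * ∑ i ∈ m.interiorIdx n, ∫ z, m.densOf (m.seg ((i : ℝ) / n)) ((i : ℝ) / n) z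
        * inner ℝ (m.predOf (m.seg ((i : ℝ) / n)) ((i : ℝ) / n) z) u ^ 2
          ∂m.pastLaw)).aestronglyMeasurable (μ := P)
  have m2 := (Finset.measurable_fun_sum (m.breakIdx n) fun i _ => hcomp i).aestronglyMeasurable
    (μ := P)
  rw [e]
  refine (eLpNorm_sub_le (m1.add m2) aestronglyMeasurable_const le_rfl).trans ((add_le_add
    ((eLpNorm_add_le m1 m2 le_rfl).trans (add_le_add hgood hbad)) hconst).trans ?_)
  rw [← ENNReal.ofReal_add (by positivity) (by positivity),
    ← ENNReal.ofReal_add (by positivity) (by positivity)]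
  refine ENNReal.ofReal_le_ofReal ?_
  have h0 : (R + 1 : ℕ) * (σ * ‖u‖ * M) ≤ √σ * ((R + 1 : ℕ) * (‖u‖ * M)) := by
    calc (R + 1 : ℕ) * (σ * ‖u‖ * M) = σ * ((R + 1 : ℕ) * (‖u‖ * M)) := by ring
      _ ≤ _ := by gcongr
  linarith

/-- The Lipschitz constants of the sums of Knight's remainders are bounded in mean. -/
theorem exists_eLpNorm_lipSum_le (h : m.RegularDesign τ ε₀ M C a) {b : ℝ} (hb : 0 < b) :
    ∃ K : ℝ, ∀ n : ℕ, eLpNorm (fun ω => m.lipSum n b ω) 1 P ≤ ENNReal.ofReal K := by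
  have hM := h.nonneg_M
  have hC := h.nonneg_C
  refine ⟨(8 * M * b * M ^ 2 + 16 * C * b ^ 2 * M ^ 3) + (R + 1 : ℕ) * (1 * M), fun n => ?_⟩
  have hσ1 := inv_sqrt_natCast_le_one n
  have hσN := natCast_mul_inv_sqrt_sq_le n
  have hσ : 0 ≤ (√(n : ℝ))⁻¹ := by positivity
  set f : ℕ → A × ((ℕ → A) × (ℕ → B)) → ℝ := fun i w =>
    (√n)⁻¹ * ‖m.predOf (m.seg ((i : ℝ) / n)) ((i : ℝ) / n) w.2‖
      * if |m.errOf (m.seg ((i : ℝ) / n)) ((i : ℝ) / n) w.1 w.2|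
        ≤ (√n)⁻¹ * b * ‖m.predOf (m.seg ((i : ℝ) / n)) ((i : ℝ) / n) w.2‖ then 1 else 0 with hf
  have hfm : ∀ i, Measurable (f i) := fun i => by
    have h1 : Measurable fun w : A × ((ℕ → A) × (ℕ → B)) =>
        ‖m.predOf (m.seg ((i : ℝ) / n)) ((i : ℝ) / n) w.2‖ :=
      (m.measurable_predOf _ _).norm.comp measurable_snd
    exact (h1.const_mul _).mul (Measurable.ite (measurableSet_le
      (m.measurable_errOf _ _).abs (h1.const_mul _)) measurable_const measurable_const)
  have hcomp : ∀ i : ℕ, Measurable fun ω => f i (m.η i ω, m.past i ω) := fun i =>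
    (hfm i).comp ((m.measurable_η i).prodMk (m.measurable_past i))
  have hgood := m.eLpNorm_sum_norm_mul_indicator_le hM hC (m.card_interiorIdx_le n)
    (h.regularAt n) hb hσ hσ1 hσN
  have hbad := m.eLpNorm_sum_breakIdx_le hM (h.moment n) hfm (c := 1) zero_le_one fun i w => by
    simp only [hf]
    rw [abs_of_nonneg (by split_ifs <;> positivity)]
    refine (mul_le_of_le_one_right (by positivity) (by split_ifs <;> simp)).trans ?_
    gcongr
  have e : (fun ω => m.lipSum n b ω)
      = (fun ω => ∑ i ∈ m.interiorIdx n, f i (m.η i ω, m.past i ω))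
      + fun ω => ∑ i ∈ m.breakIdx n, f i (m.η i ω, m.past i ω) := by
    funext ω
    rw [Pi.add_apply, m.sum_interiorIdx_add_sum_breakIdx n fun i => f i (m.η i ω, m.past i ω)]
    unfold lipSum
    refine Finset.sum_congr rfl fun i _ => ?_
    rw [m.ε_eq, m.x_eq]
  rw [e]
  refine (eLpNorm_add_le (Finset.measurable_fun_sum _ fun i _ => hcomp i).aestronglyMeasurable
    (Finset.measurable_fun_sum _ fun i _ => hcomp i).aestronglyMeasurable le_rfl).trans
    ((add_le_add hgood hbad).trans ?_)
  rw [← ENNReal.ofReal_add (by positivity) (by positivity)]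

/-- The normalized curvature matrices are uniformly positive definite and bounded. -/
theorem exists_quadForm_K_bounds (h : m.RegularDesign τ ε₀ M C a) :
    ∃ (lo hi : ℝ) (n₀ : ℕ), 0 < lo ∧ 0 < hi ∧ 1 ≤ n₀ ∧
      ∀ n : ℕ, n₀ ≤ n → ∀ u : EuclideanSpace ℝ (Fin p),
      lo * ‖u‖ ^ 2 ≤ quadForm ((n : ℝ)⁻¹ • m.K n) u ∧
        quadForm ((n : ℝ)⁻¹ • m.K n) u ≤ hi * ‖u‖ ^ 2 := by
  have hM := h.nonneg_M
  have hε := h.pos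
  obtain ⟨κ, hκ, hbreak⟩ := m.exists_abs_sum_breakIdx_quadForm_le
  obtain ⟨n₁, hn₁⟩ := exists_nat_ge (2 * (ε₀ ^ 2 * (R + 1) + κ) / ε₀ ^ 2)
  refine ⟨ε₀ ^ 2 / 2, M ^ 3 + κ + 1, n₁ + 1, by positivity, by positivity, by omega,
    fun n hn u => ?_⟩
  have hn0 : (1 : ℝ) ≤ n := by exact_mod_cast (by omega : 1 ≤ n)
  have hn1 : 2 * (ε₀ ^ 2 * (R + 1) + κ) ≤ ε₀ ^ 2 * n := by
    have h1 : (n₁ : ℝ) ≤ n := by exact_mod_cast (by omega : n₁ ≤ n)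
    rw [div_le_iff₀ (by positivity)] at hn₁
    nlinarith [sq_nonneg ε₀]
  have hQ : quadForm ((n : ℝ)⁻¹ • m.K n) u = (n : ℝ)⁻¹ * ((∑ i ∈ m.interiorIdx n,
      ∫ z, m.densOf (m.seg ((i : ℝ) / n)) ((i : ℝ) / n) z
        * inner ℝ (m.predOf (m.seg ((i : ℝ) / n)) ((i : ℝ) / n) z) u ^ 2 ∂m.pastLaw)
      + ∑ i ∈ m.breakIdx n, quadForm (m.curv (m.seg ((i : ℝ) / n)) ((i : ℝ) / n)) u) := by
    rw [quadForm_smul, m.K_eq_sum_curv, quadForm_sum, ← m.sum_interiorIdx_add_sum_breakIdx n,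
      Finset.sum_congr rfl fun i hi => (h.regularAt n i hi).quadForm_curv hM u]
  have hb := abs_le.1 (hbreak n u)
  have hlow := Finset.card_nsmul_le_sum (m.interiorIdx n) _ _ fun i hi =>
    ((h.regularAt n i hi).integral_densOf_mul_sq hε.le hM u).2.1
  have hupp := Finset.sum_le_card_nsmul (m.interiorIdx n) _ _ fun i hi =>
    ((h.regularAt n i hi).integral_densOf_mul_sq hε.le hM u).2.2
  rw [nsmul_eq_mul] at hlow hupp
  have hc1 := m.le_card_interiorIdx n
  have hc2 : ((m.interiorIdx n).card : ℝ) ≤ n := by exact_mod_cast m.card_interiorIdx_le n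
  set S := ∑ i ∈ m.interiorIdx n, ∫ z, m.densOf (m.seg ((i : ℝ) / n)) ((i : ℝ) / n) z
        * inner ℝ (m.predOf (m.seg ((i : ℝ) / n)) ((i : ℝ) / n) z) u ^ 2 ∂m.pastLaw
  set T := ∑ i ∈ m.breakIdx n, quadForm (m.curv (m.seg ((i : ℝ) / n)) ((i : ℝ) / n)) u
  have hu : 0 ≤ ‖u‖ ^ 2 := by positivity
  rw [hQ]
  constructor
  · rw [le_inv_mul_iff₀ (by linarith)]
    have h1 : ((n : ℝ) - (R + 1)) * (ε₀ ^ 2 * ‖u‖ ^ 2) ≤ S :=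
      (mul_le_mul_of_nonneg_right hc1 (by positivity)).trans hlow
    have h2 := mul_le_mul_of_nonneg_right hn1 hu
    nlinarith [hb.1]
  · rw [inv_mul_le_iff₀ (by linarith)]
    have h1 : S ≤ n * (M * (M * ‖u‖) ^ 2) :=
      hupp.trans (mul_le_mul_of_nonneg_right hc2 (by positivity))
    have h2 : κ * ‖u‖ ^ 2 ≤ n * (κ * ‖u‖ ^ 2) := le_mul_of_one_le_left (by positivity) hn0
    have h3 : 0 ≤ (n : ℝ) * ‖u‖ ^ 2 := by positivity
    calc S + T ≤ n * (M * (M * ‖u‖) ^ 2) + n * (κ * ‖u‖ ^ 2) + n * ‖u‖ ^ 2 := by linarith [hb.2]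
      _ = _ := by ring

end RegularDesign

end PLSProcess

/-! ### Minimizers of nearly quadratic convex functions -/

section Minimizers

variable {p : ℕ} {S : Matrix (Fin p) (Fin p) ℝ} {C : Set (EuclideanSpace ℝ (Fin p))}
  {x z v a a' : EuclideanSpace ℝ (Fin p)} {lo hi : ℝ}

theorem quadForm_smul_vec (c : ℝ) (v : EuclideanSpace ℝ (Fin p)) :
    quadForm S (c • v) = c ^ 2 * quadForm S v := by
  unfold quadForm
  rw [map_smul, real_inner_smul_left, real_inner_smul_right]; ring

theorem continuous_quadForm (S : Matrix (Fin p) (Fin p) ℝ) : Continuous (quadForm S) := by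
  have : quadForm S = fun v => ∑ j, ∑ l, S j l * (v j * v l) := funext fun v => quadForm_eq_sum S v
  rw [this]; fun_prop

/-- Strong minimality of a metric projection. -/
theorem quadForm_add_half_le (hC : Convex ℝ C) (ha : a ∈ C)
    (hmin : IsMinOn (fun β => quadForm S (β - x)) C a) {u : EuclideanSpace ℝ (Fin p)} (hu : u ∈ C) :
    quadForm S (a - x) + quadForm S (u - a) / 2 ≤ quadForm S (u - x) := by
  have hmid : (1 / 2 : ℝ) • a + (1 / 2 : ℝ) • u ∈ C :=
    hC ha hu (by norm_num) (by norm_num) (by norm_num)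
  have h1 : quadForm S (a - x) ≤ quadForm S ((1 / 2 : ℝ) • a + (1 / 2 : ℝ) • u - x) := hmin hmid
  have e1 : (1 / 2 : ℝ) • a + (1 / 2 : ℝ) • u - x = (1 / 2 : ℝ) • ((a - x) + (u - x)) := by module
  have e2 : u - a = (u - x) - (a - x) := by abel
  rw [e1, quadForm_smul_vec] at h1
  rw [e2]
  generalize a - x = s at *
  generalize u - x = t at *
  have h2 : quadForm S (s + t) + quadForm S (t - s) = 2 * quadForm S s + 2 * quadForm S t := by
    unfold quadForm
    simp only [map_add, map_sub, inner_add_left, inner_add_right, inner_sub_left, inner_sub_right]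
    ring
  linarith

theorem exists_isMinOn_quadForm (hC : IsClosed C) (h0 : a ∈ C) (hlo : 0 < lo)
    (hS : ∀ u, lo * ‖u‖ ^ 2 ≤ quadForm S u) (x : EuclideanSpace ℝ (Fin p)) :
    ∃ b ∈ C, IsMinOn (fun β => quadForm S (β - x)) C b := by
  have hcont : Continuous fun β => quadForm S (β - x) :=
    (continuous_quadForm S).comp (continuous_id.sub continuous_const)
  refine hcont.continuousOn.exists_isMinOn' hC h0 ?_
  have hmem := (isCompact_closedBall x (1 + quadForm S (a - x) / lo)).compl_mem_cocompact
  refine mem_inf_of_left ?_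
  filter_upwards [hmem] with β hβ
  rw [Set.mem_compl_iff, Metric.mem_closedBall, not_le, dist_eq_norm] at hβ
  have hq : 0 ≤ quadForm S (a - x) := (by positivity : 0 ≤ lo * ‖a - x‖ ^ 2).trans (hS _)
  have h2 : 0 ≤ quadForm S (a - x) / lo := by positivity
  have h1 : quadForm S (a - x) / lo ≤ ‖β - x‖ ^ 2 := by nlinarith
  rw [div_le_iff₀ hlo] at h1
  linarith [hS (β - x)]

/-- Metric projections are Lipschitz continuous. -/
theorem norm_sub_le_of_isMinOn_quadForm (hC : Convex ℝ C) (hlo : 0 < lo) (hhi : 0 < hi)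
    (hS : ∀ u, lo * ‖u‖ ^ 2 ≤ quadForm S u ∧ quadForm S u ≤ hi * ‖u‖ ^ 2)
    (ha : a ∈ C) (hmin : IsMinOn (fun β => quadForm S (β - z)) C a)
    (ha' : a' ∈ C) (hmin' : IsMinOn (fun β => quadForm S (β - v)) C a') :
    ‖a' - a‖ ≤ 2 * √(hi / lo) * ‖v - z‖ := by
  have h1 := quadForm_add_half_le hC ha hmin ha'
  have h2 := quadForm_add_half_le hC ha' hmin' ha
  have h3 : 0 ≤ quadForm S ((a' - a) - (2 : ℝ) • (v - z)) :=
    (by positivity : 0 ≤ lo * ‖(a' - a) - (2 : ℝ) • (v - z)‖ ^ 2).trans (hS _).1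
  have key : quadForm S (a' - z) - quadForm S (a' - v) + quadForm S (a - v) - quadForm S (a - z)
      + quadForm S ((a' - a) - (2 : ℝ) • (v - z)) / 2
      = quadForm S (a' - a) / 2 + 2 * quadForm S (v - z) := by
    unfold quadForm
    simp only [map_smul, map_sub, inner_sub_left, inner_sub_right, real_inner_smul_left,
      real_inner_smul_right]
    ring
  have h4 : quadForm S (a - a') = quadForm S (a' - a) := by
    have := quadForm_smul_vec (S := S) (-1) (a' - a)
    rw [neg_one_smul, neg_sub] at this
    rw [this]; ring
  have h5 : lo * ‖a' - a‖ ^ 2 ≤ 4 * (hi * ‖v - z‖ ^ 2) := by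
    linarith [(hS (a' - a)).1, (hS (v - z)).2]
  refine abs_le_of_sq_le_sq' ?_ (by positivity) |>.2
  rw [mul_pow, mul_pow, Real.sq_sqrt (by positivity)]
  have : ‖a' - a‖ ^ 2 ≤ 4 * (hi * ‖v - z‖ ^ 2) / lo := by
    rw [le_div_iff₀ hlo]; linarith
  refine this.trans (le_of_eq ?_)
  field_simp
  ring

theorem norm_le_of_isMinOn_quadForm (hC : Convex ℝ C) (h0 : (0 : EuclideanSpace ℝ (Fin p)) ∈ C)
    (hlo : 0 < lo) (hhi : 0 < hi)
    (hS : ∀ u, lo * ‖u‖ ^ 2 ≤ quadForm S u ∧ quadForm S u ≤ hi * ‖u‖ ^ 2)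
    (ha : a ∈ C) (hmin : IsMinOn (fun β => quadForm S (β - z)) C a) :
    ‖a‖ ≤ 2 * √(hi / lo) * ‖z‖ := by
  have h := norm_sub_le_of_isMinOn_quadForm (v := 0) hC hlo hhi hS ha hmin h0 (fun u hu => by
    have h1 : 0 ≤ lo * ‖u - 0‖ ^ 2 := by positivity
    have h2 := (hS (0 - 0)).2
    simp only [sub_zero, norm_zero] at h2
    simp only [Set.mem_ofPred_eq, sub_zero]
    rw [sub_zero] at h1
    linarith [(hS u).1])
  simpa using h

/-- If a convex function is uniformly close to a quadratic function near the constrained minimizer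
of the latter, then its own constrained minimizer is close by. -/
theorem norm_sub_le_of_isMinOn {L : EuclideanSpace ℝ (Fin p) → ℝ} (hL : ConvexOn ℝ Set.univ L)
    (hC : Convex ℝ C) (hS : ∀ u, lo * ‖u‖ ^ 2 ≤ quadForm S u)
    (ha : a ∈ C) (hmin : IsMinOn (fun β => quadForm S (β - x)) C a)
    {b : EuclideanSpace ℝ (Fin p)} (hb : b ∈ C) (hbmin : IsMinOn L C b) {ρ δ k : ℝ} (hρ : 0 < ρ)
    (hδ : 8 * δ < lo * ρ ^ 2)
    (hclose : ∀ u, ‖u - a‖ ≤ ρ → |L u - quadForm S (u - x) / 2 - k| ≤ δ) : ‖b - a‖ ≤ ρ := by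
  by_contra hcon
  rw [not_le] at hcon
  have hpos : 0 < ‖b - a‖ := hρ.trans hcon
  set s := ρ / ‖b - a‖ with hs
  have hs0 : 0 < s := by positivity
  have hs1 : s < 1 := (div_lt_one hpos).2 hcon
  -- move from `a` towards `b` until the boundary of the ball is reached
  set u := (1 - s) • a + s • b with hu
  have huC : u ∈ C := hC ha hb (by linarith) hs0.le (by ring)
  have hua : u - a = s • (b - a) := by rw [hu]; module
  have hnorm : ‖u - a‖ = ρ := by
    rw [hua, norm_smul, Real.norm_eq_abs, abs_of_pos hs0, hs]; field_simp
  have h1 : L u ≤ (1 - s) * L a + s * L b :=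
    hL.2 (Set.mem_univ a) (Set.mem_univ b) (by linarith) hs0.le (by ring)
  have h2 : L b ≤ L a := hbmin ha
  have h3 := quadForm_add_half_le hC ha hmin huC
  have h4 := (abs_le.1 (hclose u hnorm.le)).1
  have h5 := (abs_le.1 (hclose a (by simpa using hρ.le))).2
  have h6 := hS (u - a)
  rw [hnorm] at h6
  nlinarith

theorem quadForm_sub_eq (hS : S.IsHermitian) {u W : EuclideanSpace ℝ (Fin p)}
    (hz : Matrix.toEuclideanLin S z = W) :
    quadForm S (u - z) = quadForm S u - 2 * inner ℝ W u + quadForm S z := by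
  have hsym := Matrix.isSymmetric_toEuclideanLin_iff.2 hS
  have h1 : inner ℝ z (Matrix.toEuclideanLin S u) = inner ℝ W u := by
    rw [← hz]; exact (hsym z u).symm
  unfold quadForm
  rw [map_sub, inner_sub_left, inner_sub_right, inner_sub_right, h1, hz, real_inner_comm W u]
  ring

theorem norm_le_of_toEuclideanLin_eq (hlo : 0 < lo) (hS : ∀ u, lo * ‖u‖ ^ 2 ≤ quadForm S u)
    {W : EuclideanSpace ℝ (Fin p)} (hz : Matrix.toEuclideanLin S z = W) : ‖z‖ ≤ ‖W‖ / lo := by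
  rcases eq_or_ne z 0 with h0 | h0
  · rw [h0, norm_zero]; positivity
  have h1 := hS z
  unfold quadForm at h1
  rw [hz] at h1
  have h2 := real_inner_le_norm z W
  have h3 : 0 < ‖z‖ := norm_pos_iff.2 h0
  rw [le_div_iff₀ hlo]
  nlinarith

/-- Quadratic forms are Lipschitz continuous on balls. -/
theorem abs_quadForm_sub_le (hS : ∀ u, 0 ≤ quadForm S u ∧ quadForm S u ≤ hi * ‖u‖ ^ 2)
    {b : ℝ} {u u' : EuclideanSpace ℝ (Fin p)} (hu : ‖u‖ ≤ b) (hu' : ‖u'‖ ≤ b) (hhi : 0 ≤ hi) :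
    |quadForm S u - quadForm S u'| ≤ hi * (b + 1) ^ 2 * ‖u - u'‖ := by
  rcases eq_or_ne u u' with rfl | hne
  · simp
  set d := u - u' with hd
  have hd0 : 0 < ‖d‖ := norm_pos_iff.2 (sub_ne_zero.2 hne)
  have hd2 : ‖d‖ ≤ 2 * b := (norm_sub_le _ _).trans (by linarith)
  have hb : 0 ≤ b := (norm_nonneg u).trans hu
  set c := inner ℝ u' (Matrix.toEuclideanLin S d) + inner ℝ d (Matrix.toEuclideanLin S u') with hc
  have e0 : quadForm S u = quadForm S u' + c + quadForm S d := by
    have : u = u' + d := by rw [hd]; abel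
    rw [this, hc]
    unfold quadForm
    simp only [map_add, inner_add_left, inner_add_right]
    ring
  have e : ∀ θ : ℝ, quadForm S (θ • u' + d) = θ ^ 2 * quadForm S u' + θ * c + quadForm S d := by
    intro θ
    rw [hc]
    unfold quadForm
    simp only [map_add, map_smul, inner_add_left, inner_add_right, real_inner_smul_left,
      real_inner_smul_right]
    ring
  have h1 := (hS (‖d‖ • u' + d)).1
  have h2 := (hS (-‖d‖ • u' + d)).1
  rw [e] at h1 h2
  have h3 : quadForm S u' ≤ hi * b ^ 2 := (hS u').2.trans (by gcongr)
  have h4 := (hS d).2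
  have h5 := (hS d).1
  have h6 : |c| ≤ hi * b ^ 2 * ‖d‖ + hi * ‖d‖ := by
    have h7 : ‖d‖ ^ 2 * quadForm S u' ≤ ‖d‖ ^ 2 * (hi * b ^ 2) := by gcongr
    rw [abs_le]
    constructor
    · refine le_of_mul_le_mul_left ?_ hd0
      linarith
    · refine le_of_mul_le_mul_left ?_ hd0
      linarith
  rw [e0]
  have h8 : hi * ‖d‖ ^ 2 ≤ hi * (2 * b) * ‖d‖ := by
    have := mul_le_mul_of_nonneg_left hd2 (mul_nonneg hhi hd0.le)
    linarith
  rw [abs_le] at h6 ⊢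
  constructor <;> linarith [h6.1, h6.2]

end Minimizers

/-! ### Uniform convergence on compact sets of local parameters -/

theorem measure_norm_ge_le_of_eLpNorm_one_le {α E : Type*} [MeasurableSpace α] {μ : Measure α}
    [NormedAddCommGroup E] {f : α → E} (hf : AEStronglyMeasurable f μ) {K c : ℝ}
    (h : eLpNorm f 1 μ ≤ ENNReal.ofReal K) (hc : 0 < c) :
    μ {x | c ≤ ‖f x‖} ≤ ENNReal.ofReal (K / c) := by
  rw [eLpNorm_one_eq_lintegral_enorm] at h
  have h1 := (mul_meas_ge_le_lintegral₀ hf.enorm (ENNReal.ofReal c)).trans h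
  have e : {x | ENNReal.ofReal c ≤ ‖f x‖ₑ} = {x | c ≤ ‖f x‖} := by
    ext x
    simp only [Set.mem_ofPred_eq]
    rw [← ofReal_norm, ENNReal.ofReal_le_ofReal_iff (norm_nonneg _)]
  rw [e] at h1
  rw [ENNReal.ofReal_div_of_pos hc, ENNReal.le_div_iff_mul_le (by simp [hc]) (by simp), mul_comm]
  exact h1

theorem exists_pos_ofReal_le {ε : ℝ≥0∞} (hε : 0 < ε) : ∃ e : ℝ, 0 < e ∧ ENNReal.ofReal e ≤ ε := by
  obtain ⟨e, h3, h4⟩ := ENNReal.lt_iff_exists_nnreal_btwn.1 hε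
  exact ⟨e, by exact_mod_cast h3, by rw [ENNReal.ofReal_coe_nnreal]; exact h4.le⟩

theorem tendsto_sqrt_inv_sqrt_natCast : Tendsto (fun n : ℕ => √(√(n : ℝ))⁻¹) atTop (𝓝 0) := by
  have h1 : Tendsto (fun n : ℕ => √(n : ℝ)) atTop atTop :=
    Real.tendsto_sqrt_atTop.comp tendsto_natCast_atTop_atTop
  have h2 := (Real.continuous_sqrt.tendsto 0).comp (tendsto_inv_atTop_zero.comp h1)
  rw [Real.sqrt_zero] at h2
  exact h2

namespace PLSProcess

variable {Ω A B : Type*} [MeasurableSpace Ω] [MeasurableSpace A] [MeasurableSpace B]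
  {P : Measure Ω} {p R : ℕ}

theorem convexOn_loss (m : PLSProcess Ω A B P p R) (τ : ℝ) (β₀ : EuclideanSpace ℝ (Fin p)) (n : ℕ)
    (ω : Ω) (σ : ℝ) : ConvexOn ℝ Set.univ fun u => m.loss τ β₀ n ω (β₀ + σ • u) := by
  refine ⟨convex_univ, fun u _ v _ s t hs ht hst => ?_⟩
  unfold loss
  rw [Finset.smul_sum, Finset.smul_sum, ← Finset.sum_add_distrib]
  refine Finset.sum_le_sum fun i _ => ?_
  have e : m.y β₀ n i ω - inner ℝ (m.x n i ω) (β₀ + σ • (s • u + t • v))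
      = s • (m.y β₀ n i ω - inner ℝ (m.x n i ω) (β₀ + σ • u))
        + t • (m.y β₀ n i ω - inner ℝ (m.x n i ω) (β₀ + σ • v)) := by
    have ht' : t = 1 - s := by linarith
    subst ht'
    simp only [inner_add_right, real_inner_smul_right, smul_eq_mul]
    ring
  rw [e]
  exact (convexOn_checkFun τ).2 (Set.mem_univ _) (Set.mem_univ _) hs ht hst

namespace RegularDesign

variable [IsProbabilityMeasure P] {m : PLSProcess Ω A B P p R} {τ ε₀ M C : ℝ} {a : ℕ → ℝ≥0∞}

/-- Pointwise convergence upgrades to uniform convergence on balls, as the functions are Lipschitz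
continuous with stochastically bounded constants. -/
theorem tendsto_measure_exists_knightSum (h : m.RegularDesign τ ε₀ M C a) {b δ : ℝ} (hb : 0 < b)
    (hδ : 0 < δ) :
    Tendsto (fun n : ℕ => P {ω | ∃ u : EuclideanSpace ℝ (Fin p), ‖u‖ ≤ b ∧
      δ < |m.knightSum n ω u - quadForm ((n : ℝ)⁻¹ • m.K n) u / 2|}) atTop (𝓝 0) := by
  obtain ⟨lo, hi, n₀, hlo, hhi, hn₀, hK⟩ := h.exists_quadForm_K_bounds
  obtain ⟨KL, hKL⟩ := h.exists_eLpNorm_lipSum_le hb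
  rw [ENNReal.tendsto_nhds_zero]
  intro ε hε
  obtain ⟨e, he0, heε⟩ := exists_pos_ofReal_le (ENNReal.half_pos hε.ne')
  -- a level that the Lipschitz constant exceeds with small probability, and a finite net
  set D := |KL| / e + 1 with hD
  have hD0 : 0 < D := by positivity
  set ℓ := D + hi * (b + 1) ^ 2 with hℓ
  have hℓ0 : 0 < ℓ := by positivity
  obtain ⟨t, htb, htfin, hcover⟩ := (isCompact_closedBall (0 : EuclideanSpace ℝ (Fin p))
    b).finite_cover_balls (e := δ / (2 * ℓ)) (by positivity)
  choose KP hKP using h.exists_eLpNorm_knightSum_sub_le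
  have hsum : Tendsto (fun n : ℕ => ∑ f ∈ htfin.toFinset,
      ENNReal.ofReal (√(√(n : ℝ))⁻¹ * KP f / (δ / 2))) atTop (𝓝 0) := by
    have h0 : ∀ f ∈ htfin.toFinset, Tendsto (fun n : ℕ =>
        ENNReal.ofReal (√(√(n : ℝ))⁻¹ * KP f / (δ / 2))) atTop (𝓝 0) := fun f _ => by
      have h1 : Tendsto (fun n : ℕ => √(√(n : ℝ))⁻¹ * KP f / (δ / 2)) atTop (𝓝 0) := by
        have := (tendsto_sqrt_inv_sqrt_natCast.mul_const (KP f)).div_const (δ / 2)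
        simpa using this
      have := (ENNReal.continuous_ofReal.tendsto 0).comp h1
      rw [ENNReal.ofReal_zero] at this
      exact this
    have h1 := tendsto_finsetSum _ h0
    rwa [Finset.sum_const_zero] at h1
  have hev := (ENNReal.tendsto_nhds_zero.1 hsum) (ε / 2) (by simpa using hε.ne')
  filter_upwards [hev, eventually_ge_atTop n₀] with n hn hnn₀
  have hlip : P {ω | D ≤ ‖m.lipSum n b ω‖} ≤ ε / 2 := by
    refine (measure_norm_ge_le_of_eLpNorm_one_le
      (m.measurable_lipSum n b).aestronglyMeasurable (hKL n) hD0).trans ?_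
    refine (ENNReal.ofReal_le_ofReal ?_).trans heε
    rw [div_le_iff₀ hD0, hD, mul_add, mul_div_cancel₀ _ he0.ne']
    linarith [le_abs_self KL]
  have hpt : ∀ f : EuclideanSpace ℝ (Fin p),
      P {ω | δ / 2 ≤ ‖m.knightSum n ω f - quadForm ((n : ℝ)⁻¹ • m.K n) f / 2‖}
        ≤ ENNReal.ofReal (√(√(n : ℝ))⁻¹ * KP f / (δ / 2)) := fun f =>
    measure_norm_ge_le_of_eLpNorm_one_le
      ((m.measurable_knightSum n f).sub_const _).aestronglyMeasurable (hKP f n (by omega))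
      (by positivity)
  have hsub : {ω | ∃ u : EuclideanSpace ℝ (Fin p), ‖u‖ ≤ b ∧
      δ < |m.knightSum n ω u - quadForm ((n : ℝ)⁻¹ • m.K n) u / 2|}
      ⊆ {ω | D ≤ ‖m.lipSum n b ω‖} ∪ ⋃ f ∈ htfin.toFinset,
        {ω | δ / 2 ≤ ‖m.knightSum n ω f - quadForm ((n : ℝ)⁻¹ • m.K n) f / 2‖} := by
    rintro ω ⟨u, hu, hlt⟩
    by_contra hcon
    simp only [Set.mem_union, Set.mem_iUnion, Set.mem_ofPred_eq, not_or, not_exists, not_le,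
      Set.Finite.mem_toFinset] at hcon
    obtain ⟨h1, h2⟩ := hcon
    have hu' := hcover (by simpa using hu : u ∈ Metric.closedBall 0 b)
    simp only [Set.mem_iUnion, Metric.mem_ball, dist_eq_norm] at hu'
    obtain ⟨f, hft, huf⟩ := hu'
    have hfb : ‖f‖ ≤ b := by simpa using htb hft
    have h3 := h2 f hft
    have h4 := m.abs_knightSum_sub_le n ω hu hfb
    have h5 := abs_quadForm_sub_le (S := (n : ℝ)⁻¹ • m.K n) (fun v =>
      ⟨(by positivity : 0 ≤ lo * ‖v‖ ^ 2).trans (hK n hnn₀ v).1, (hK n hnn₀ v).2⟩) hu hfb hhi.le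
    have h6 : m.lipSum n b ω ≤ D := (le_abs_self _).trans (by simpa using h1.le)
    have h7 : m.lipSum n b ω * ‖u - f‖ ≤ D * ‖u - f‖ := by gcongr
    have h8 : ℓ * ‖u - f‖ ≤ δ / 2 := by
      calc ℓ * ‖u - f‖ ≤ ℓ * (δ / (2 * ℓ)) := by gcongr
        _ = δ / 2 := by field_simp
    have h9 : 0 ≤ hi * (b + 1) ^ 2 * ‖u - f‖ := by positivity
    rw [Real.norm_eq_abs] at h3
    have h10 : |m.knightSum n ω u - quadForm ((n : ℝ)⁻¹ • m.K n) u / 2|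
        ≤ |m.knightSum n ω f - quadForm ((n : ℝ)⁻¹ • m.K n) f / 2| + ℓ * ‖u - f‖ := by
      rw [abs_le] at h4 h5
      have h11 := abs_le.1 (le_refl |m.knightSum n ω f - quadForm ((n : ℝ)⁻¹ • m.K n) f / 2|)
      rw [abs_le, hℓ]
      constructor <;> linarith [h4.1, h4.2, h5.1, h5.2, h11.1, h11.2]
    linarith
  calc _ ≤ P {ω | D ≤ ‖m.lipSum n b ω‖} + ∑ f ∈ htfin.toFinset,
        P {ω | δ / 2 ≤ ‖m.knightSum n ω f - quadForm ((n : ℝ)⁻¹ • m.K n) f / 2‖} :=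
        (measure_mono hsub).trans ((measure_union_le _ _).trans
          (add_le_add le_rfl (measure_biUnion_finset_le _ _)))
    _ ≤ ε / 2 + ε / 2 := add_le_add hlip ((Finset.sum_le_sum fun f _ => hpt f).trans hn)
    _ = ε := ENNReal.add_halves ε

theorem posDef_K (h : m.RegularDesign τ ε₀ M C a) : ∀ᶠ n in atTop, (m.K n).PosDef := by
  obtain ⟨lo, hi, n₀, hlo, hhi, hn₀, hK⟩ := h.exists_quadForm_K_bounds
  filter_upwards [eventually_ge_atTop n₀] with n hn
  refine Matrix.PosDef.of_dotProduct_mulVec_pos (m.isHermitian_K n) fun x hx => ?_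
  have h1 := (hK n hn (WithLp.toLp 2 x)).1
  have hn0 : (0 : ℝ) < n := by exact_mod_cast (by omega : 0 < n)
  rw [quadForm_smul, quadForm_eq_dotProduct] at h1
  have h2 : 0 < lo * ‖WithLp.toLp 2 x‖ ^ 2 := by
    have : WithLp.toLp 2 x ≠ 0 := fun h0 => hx (by simpa using h0)
    have := norm_pos_iff.2 this
    positivity
  have h3 := h2.trans_le h1
  exact pos_of_mul_pos_right h3 (by positivity)

end RegularDesign

/-! ### The estimators -/

theorem convex_constraintSet (p q : ℕ) : Convex ℝ (constraintSet p q) := by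
  intro x hx y hy s t hs ht _ j hj
  have h1 := hx j hj
  have h2 := hy j hj
  simp only [PiLp.add_apply, PiLp.smul_apply, smul_eq_mul]
  positivity

theorem isClosed_constraintSet (p q : ℕ) : IsClosed (constraintSet p q) := by
  have : constraintSet p q = ⋂ (j : Fin p) (_ : (j : ℕ) < q), {β | 0 ≤ β j} := by
    ext β; simp [constraintSet]
  rw [this]
  exact isClosed_iInter fun j => isClosed_iInter fun _ => isClosed_le continuous_const (by fun_prop)

theorem metricProj_spec {p : ℕ} {Q : Set (EuclideanSpace ℝ (Fin p))} (hQ : IsClosed Q)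
    {β₀ : EuclideanSpace ℝ (Fin p)} (h0 : β₀ ∈ Q) {S : Matrix (Fin p) (Fin p) ℝ} {lo : ℝ}
    (hlo : 0 < lo) (hS : ∀ u, lo * ‖u‖ ^ 2 ≤ quadForm S u) (x : EuclideanSpace ℝ (Fin p)) :
    metricProj Q S x ∈ Q ∧ IsMinOn (fun β => quadForm S (β - x)) Q (metricProj Q S x) :=
  Classical.epsilon_spec (exists_isMinOn_quadForm hQ h0 hlo hS x)

/-- The comparison of the estimators, the linear term and the projection for a fixed sample. All
quantities are expressed in the local parameter `u = √n (β - β₀)`, with `σ = 1 / √n`. -/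
theorem estimators_close (m : PLSProcess Ω A B P p R) {τ : ℝ} {q : ℕ}
    {β₀ : EuclideanSpace ℝ (Fin p)} (hβ₀ : β₀ ∈ constraintSet p q) {n : ℕ} (hn : 1 ≤ n) {ω : Ω}
    {lo hi : ℝ} (hlo : 0 < lo) (hhi : 0 < hi)
    (hS : ∀ u : EuclideanSpace ℝ (Fin p), lo * ‖u‖ ^ 2 ≤ quadForm ((n : ℝ)⁻¹ • m.K n) u ∧
        quadForm ((n : ℝ)⁻¹ • m.K n) u ≤ hi * ‖u‖ ^ 2)
    (hdet : IsUnit (m.K n).det)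
    {βt βh : EuclideanSpace ℝ (Fin p)} (hβt : IsMinOn (m.loss τ β₀ n ω) Set.univ βt)
    (hβh : βh ∈ constraintSet p q) (hβh' : IsMinOn (m.loss τ β₀ n ω) (constraintSet p q) βh)
    {w b ρ δ : ℝ} (hW : ‖(√n)⁻¹ • m.G τ n ω‖ ≤ w) (hρ : 0 < ρ) (hδ : 8 * δ < lo * ρ ^ 2)
    (hb : w / lo + ρ ≤ b) (hb' : 2 * √(hi / lo) * (w / lo) + ρ ≤ b)
    (hclose : ∀ u : EuclideanSpace ℝ (Fin p), ‖u‖ ≤ b →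
      |m.knightSum n ω u - quadForm ((n : ℝ)⁻¹ • m.K n) u / 2| ≤ δ) :
    √n * ‖βt - β₀‖ ≤ b ∧ √n * ‖βh - β₀‖ ≤ b ∧
      √n * ‖βt - β₀ - Matrix.toEuclideanLin (m.K n)⁻¹ (m.G τ n ω)‖ ≤ ρ ∧
      √n * ‖βh - metricProj (constraintSet p q) ((n : ℝ)⁻¹ • m.K n) βt‖
        ≤ (1 + 2 * √(hi / lo)) * ρ := by
  have hn0 : (0 : ℝ) < n := by exact_mod_cast hn
  have hs0 : 0 < √(n : ℝ) := Real.sqrt_pos.2 hn0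
  set S := (n : ℝ)⁻¹ • m.K n with hSdef
  have hSh : S.IsHermitian := (m.isHermitian_K n).smul (by simp [IsSelfAdjoint])
  set W := (√n)⁻¹ • m.G τ n ω with hWdef
  set z := √n • Matrix.toEuclideanLin (m.K n)⁻¹ (m.G τ n ω) with hzdef
  have hz : Matrix.toEuclideanLin S z = W := by
    rw [hzdef, hSdef, hWdef, map_smul, map_smul, LinearMap.smul_apply, smul_smul]
    have e1 : Matrix.toEuclideanLin (m.K n) (Matrix.toEuclideanLin (m.K n)⁻¹ (m.G τ n ω))
        = m.G τ n ω := by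
      simp only [Matrix.toLpLin_apply, Matrix.mulVec_mulVec, Matrix.mul_nonsing_inv _ hdet,
        Matrix.one_mulVec]
    rw [e1]
    congr 1
    nth_rewrite 2 [← Real.mul_self_sqrt hn0.le]
    field_simp
  have hSlo := fun u => (hS u).1
  have hzw : ‖z‖ ≤ w / lo := (norm_le_of_toEuclideanLin_eq hlo hSlo hz).trans (by gcongr)
  -- the objective function in the local parameter
  set L : EuclideanSpace ℝ (Fin p) → ℝ := fun u => m.loss τ β₀ n ω (β₀ + (√n)⁻¹ • u) with hL
  have hLc : ConvexOn ℝ Set.univ L := m.convexOn_loss τ β₀ n ω _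
  have hLq : ∀ u, ‖u‖ ≤ b →
      |L u - quadForm S (u - z) / 2 - (m.loss τ β₀ n ω β₀ - quadForm S z / 2)| ≤ δ := by
    intro u hu
    have h1 := m.loss_sub_loss τ β₀ n ω u
    have h2 := hclose u hu
    rw [quadForm_sub_eq hSh hz]
    refine le_trans (le_of_eq ?_) h2
    congr 1
    simp only [hL]
    linarith
  have hloc : ∀ β : EuclideanSpace ℝ (Fin p), β₀ + (√n)⁻¹ • (√n • (β - β₀)) = β := fun β => by
    rw [smul_smul, inv_mul_cancel₀ hs0.ne', one_smul]; abel
  -- the unconstrained estimator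
  have hbt : IsMinOn L Set.univ (√n • (βt - β₀)) := by
    intro u _
    have := hβt (Set.mem_univ (β₀ + (√n)⁻¹ • u))
    simp only [Set.mem_ofPred_eq] at this ⊢
    simpa only [hL, hloc] using this
  have hzmin : IsMinOn (fun β => quadForm S (β - z)) Set.univ z := by
    intro u _
    have h1 := (hS (z - z)).2
    have h2 := (hS (u - z)).1
    have h3 : 0 ≤ lo * ‖u - z‖ ^ 2 := by positivity
    rw [sub_self, norm_zero] at h1
    simp only [Set.mem_ofPred_eq, sub_self]
    linarith
  have hA : ‖√n • (βt - β₀) - z‖ ≤ ρ :=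
    norm_sub_le_of_isMinOn hLc convex_univ hSlo (Set.mem_univ z) hzmin (Set.mem_univ _) hbt hρ hδ
      fun u hu => hLq u (by
        have := norm_add_le z (u - z)
        rw [add_sub_cancel] at this
        linarith)
  -- the constrained estimator
  set C : Set (EuclideanSpace ℝ (Fin p)) := {u | β₀ + (√n)⁻¹ • u ∈ constraintSet p q} with hC
  have hCc : Convex ℝ C := by
    have := (convex_constraintSet p q).affine_preimage
      ((√n)⁻¹ • AffineMap.id ℝ (EuclideanSpace ℝ (Fin p)) + AffineMap.const ℝ _ β₀)
    refine (Set.ext fun u => ?_ : C = _) ▸ this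
    simp [hC, add_comm]
  have hCcl : IsClosed C := (isClosed_constraintSet p q).preimage (by fun_prop)
  have hC0 : (0 : EuclideanSpace ℝ (Fin p)) ∈ C := by simpa [hC] using hβ₀
  obtain ⟨az, haz, hazmin⟩ := exists_isMinOn_quadForm hCcl hC0 hlo hSlo z
  have hazn : ‖az‖ ≤ 2 * √(hi / lo) * (w / lo) :=
    (norm_le_of_isMinOn_quadForm hCc hC0 hlo hhi hS haz hazmin).trans (by gcongr)
  have hbhC : √n • (βh - β₀) ∈ C := by
    rw [hC, Set.mem_ofPred_eq, hloc]; exact hβh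
  have hbh : IsMinOn L C (√n • (βh - β₀)) := by
    intro u hu
    have := hβh' hu
    simp only [Set.mem_ofPred_eq] at this ⊢
    simpa only [hL, hloc] using this
  have hB : ‖√n • (βh - β₀) - az‖ ≤ ρ :=
    norm_sub_le_of_isMinOn hLc hCc hSlo haz hazmin hbhC hbh hρ hδ
      fun u hu => hLq u (by
        have := norm_add_le az (u - az)
        rw [add_sub_cancel] at this
        linarith)
  -- the projection of the unconstrained estimator
  set γ := metricProj (constraintSet p q) S βt with hγ
  obtain ⟨hγQ, hγmin⟩ := metricProj_spec (isClosed_constraintSet p q) hβ₀ hlo hSlo βt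
  rw [← hγ] at hγQ hγmin
  have hγC : √n • (γ - β₀) ∈ C := by
    rw [hC, Set.mem_ofPred_eq, hloc]; exact hγQ
  have hscale : ∀ β : EuclideanSpace ℝ (Fin p),
      quadForm S (√n • (β - β₀) - √n • (βt - β₀)) = n * quadForm S (β - βt) := fun β => by
    rw [← smul_sub, quadForm_smul_vec, Real.sq_sqrt hn0.le, sub_sub_sub_cancel_right]
  have hγmin' : IsMinOn (fun u => quadForm S (u - √n • (βt - β₀))) C (√n • (γ - β₀)) := by
    intro u hu
    have h1 : quadForm S (γ - βt) ≤ quadForm S (β₀ + (√n)⁻¹ • u - βt) := hγmin hu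
    have e : u = √n • ((β₀ + (√n)⁻¹ • u) - β₀) := by
      rw [add_sub_cancel_left, smul_smul, mul_inv_cancel₀ hs0.ne', one_smul]
    simp only [Set.mem_ofPred_eq]
    rw [e, hscale, hscale]
    gcongr
  have hD := norm_sub_le_of_isMinOn_quadForm hCc hlo hhi hS haz hazmin hγC hγmin'
  have hnorm : ∀ v : EuclideanSpace ℝ (Fin p), √n * ‖v‖ = ‖√n • v‖ := fun v => by
    rw [norm_smul, Real.norm_eq_abs, abs_of_pos hs0]
  simp only [hnorm]
  refine ⟨?_, ?_, ?_, ?_⟩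
  · have := norm_add_le z (√n • (βt - β₀) - z)
    rw [add_sub_cancel] at this
    linarith
  · have := norm_add_le az (√n • (βh - β₀) - az)
    rw [add_sub_cancel] at this
    linarith
  · rw [smul_sub]; exact hA
  · have e : √n • (βh - γ) = (√n • (βh - β₀) - az) - (√n • (γ - β₀) - az) := by module
    rw [e]
    have h1 : 2 * √(hi / lo) * ‖√n • (βt - β₀) - z‖ ≤ 2 * √(hi / lo) * ρ := by gcongr
    have := norm_sub_le (√n • (βh - β₀) - az) (√n • (γ - β₀) - az)
    linarith

end PLSProcess

/-! ### Rates of convergence -/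

theorem isLittleOp_of_sqrt_mul {Ω E : Type*} [MeasurableSpace Ω] [NormedAddCommGroup E]
    {P : Measure Ω} {X : ℕ → Ω → E} {c : ℕ → ℝ}
    (h : ∀ ε : ℝ≥0∞, 0 < ε → ∀ δ : ℝ, 0 < δ →
      ∀ᶠ n : ℕ in atTop, P {ω | δ * c n < √n * ‖X n ω‖} ≤ ε) :
    IsLittleOp P X fun n => (n : ℝ) ^ (-(1 / 2) : ℝ) * c n := by
  intro δ hδ
  rw [ENNReal.tendsto_nhds_zero]
  intro ε hε
  filter_upwards [h ε hε δ hδ, eventually_ge_atTop 1] with n hn hn1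
  have hn0 : (0 : ℝ) < n := by exact_mod_cast hn1
  refine (measure_mono fun ω hω => ?_).trans hn
  simp only [Set.mem_ofPred_eq] at hω ⊢
  rw [Real.rpow_neg hn0.le, ← Real.sqrt_eq_rpow] at hω
  have hs0 : 0 < √(n : ℝ) := Real.sqrt_pos.2 hn0
  calc δ * c n = √n * (δ * ((√n)⁻¹ * c n)) := by field_simp
    _ < √n * ‖X n ω‖ := by gcongr

namespace PLSProcess

variable {Ω A B : Type*} [MeasurableSpace Ω] [MeasurableSpace A] [MeasurableSpace B]
  {P : Measure Ω} {p R : ℕ}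

/-- With probability close to one, the estimators are within a bounded multiple of `1 / √n` of the
true parameter, and the approximations of the estimators hold with an error that is a small multiple
of `1 / √n`. -/
theorem RegularDesign.exists_eventually_estimators_close [IsProbabilityMeasure P]
    {m : PLSProcess Ω A B P p R} {τ ε₀ M C : ℝ} {a : ℕ → ℝ≥0∞} (h : m.RegularDesign τ ε₀ M C a)
    (hτ₀ : 0 < τ) (hτ₁ : τ < 1) {q : ℕ} {β₀ : EuclideanSpace ℝ (Fin p)}
    (hβ₀ : β₀ ∈ constraintSet p q) {βt βh : ℕ → Ω → EuclideanSpace ℝ (Fin p)}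
    (hβt : ∀ n, ∀ᵐ ω ∂P, IsMinOn (m.loss τ β₀ n ω) Set.univ (βt n ω))
    (hβh : ∀ n, ∀ᵐ ω ∂P, βh n ω ∈ constraintSet p q ∧
      IsMinOn (m.loss τ β₀ n ω) (constraintSet p q) (βh n ω))
    {ε : ℝ≥0∞} (hε : 0 < ε) :
    ∃ b : ℝ, ∀ ρ : ℝ, 0 < ρ → ∀ᶠ n : ℕ in atTop, P {ω | ¬ (√n * ‖βt n ω - β₀‖ ≤ b ∧
      √n * ‖βh n ω - β₀‖ ≤ b ∧
      √n * ‖βt n ω - β₀ - Matrix.toEuclideanLin (m.K n)⁻¹ (m.G τ n ω)‖ ≤ ρ ∧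
      √n * ‖βh n ω - metricProj (constraintSet p q) ((n : ℝ)⁻¹ • m.K n) (βt n ω)‖ ≤ ρ)} ≤ ε := by
  obtain ⟨lo, hi, n₀, hlo, hhi, hn₀, hK⟩ := h.exists_quadForm_K_bounds
  obtain ⟨KW, hKW0, hKW⟩ := h.exists_eLpNorm_score_le hτ₀ hτ₁
  obtain ⟨e, he0, heε⟩ := exists_pos_ofReal_le (ENNReal.half_pos hε.ne')
  set w := KW / e + 1 with hw
  have hw0 : 0 < w := by positivity
  set s := 2 * √(hi / lo) with hs
  have hs0 : 0 ≤ s := by positivity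
  set b := w / lo + s * (w / lo) + 1 with hb
  have hb0 : 0 < b := by positivity
  refine ⟨b, fun ρ hρ => ?_⟩
  set ρ' := min ρ 1 / (1 + s) with hρ'
  have hρ0 : 0 < ρ' := by positivity
  have hρs : (1 + s) * ρ' ≤ ρ := by
    rw [hρ', mul_div_cancel₀ _ (by positivity)]; exact min_le_left _ _
  have hρle : ρ' ≤ min ρ 1 := div_le_self (by positivity) (by linarith)
  have hunif := ENNReal.tendsto_nhds_zero.1 (h.tendsto_measure_exists_knightSum hb0
    (δ := lo * ρ' ^ 2 / 16) (by positivity)) (ε / 2) (ENNReal.half_pos hε.ne')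
  filter_upwards [hunif, eventually_ge_atTop n₀, h.posDef_K] with n hn hnn₀ hpd
  have hW : P {ω | w ≤ ‖(√n)⁻¹ • m.G τ n ω‖} ≤ ε / 2 := by
    refine (measure_norm_ge_le_of_eLpNorm_one_le
      ((m.measurable_G τ n).const_smul ((√n)⁻¹ : ℝ)).aestronglyMeasurable (hKW n) hw0).trans ?_
    refine (ENNReal.ofReal_le_ofReal ?_).trans heε
    rw [div_le_iff₀ hw0, hw, mul_add, mul_div_cancel₀ _ he0.ne']
    linarith
  have hsub : {ω | ¬ (√n * ‖βt n ω - β₀‖ ≤ b ∧ √n * ‖βh n ω - β₀‖ ≤ b ∧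
      √n * ‖βt n ω - β₀ - Matrix.toEuclideanLin (m.K n)⁻¹ (m.G τ n ω)‖ ≤ ρ ∧
      √n * ‖βh n ω - metricProj (constraintSet p q) ((n : ℝ)⁻¹ • m.K n) (βt n ω)‖ ≤ ρ)}
      ≤ᵐ[P] ({ω | w ≤ ‖(√n)⁻¹ • m.G τ n ω‖} ∪
        {ω | ∃ u : EuclideanSpace ℝ (Fin p), ‖u‖ ≤ b ∧ lo * ρ' ^ 2 / 16
          < |m.knightSum n ω u - quadForm ((n : ℝ)⁻¹ • m.K n) u / 2|} : Set Ω) := by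
    filter_upwards [hβt n, hβh n] with ω h1 h2 hω
    by_contra hcon
    refine hω ?_
    have hcon' : ω ∉ ({ω | w ≤ ‖(√n)⁻¹ • m.G τ n ω‖} ∪
        {ω | ∃ u : EuclideanSpace ℝ (Fin p), ‖u‖ ≤ b ∧ lo * ρ' ^ 2 / 16
          < |m.knightSum n ω u - quadForm ((n : ℝ)⁻¹ • m.K n) u / 2|} : Set Ω) := hcon
    simp only [Set.mem_union, Set.mem_ofPred_eq, not_or, not_le, not_exists, not_and,
      not_lt] at hcon'
    have hwl : 0 < w / lo := by positivity
    have hsw : 0 ≤ s * (w / lo) := by positivity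
    have hρ1 : ρ' ≤ 1 := hρle.trans (min_le_right _ _)
    obtain ⟨c1, c2, c3, c4⟩ := m.estimators_close hβ₀ (by omega : 1 ≤ n) hlo hhi (hK n hnn₀)
      ((Matrix.isUnit_iff_isUnit_det _).1 hpd.isUnit) h1 h2.1 h2.2 hcon'.1.le hρ0
      (δ := lo * ρ' ^ 2 / 16) (by nlinarith [mul_pos hlo (pow_pos hρ0 2)])
      (by linarith : w / lo + ρ' ≤ b) (by linarith) hcon'.2
    exact ⟨c1, c2, c3.trans (hρle.trans (min_le_left _ _)), c4.trans hρs⟩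
  calc _ ≤ P {ω | w ≤ ‖(√n)⁻¹ • m.G τ n ω‖}
        + P {ω | ∃ u : EuclideanSpace ℝ (Fin p), ‖u‖ ≤ b ∧ lo * ρ' ^ 2 / 16
          < |m.knightSum n ω u - quadForm ((n : ℝ)⁻¹ • m.K n) u / 2|} :=
        (measure_mono_ae hsub).trans (measure_union_le _ _)
    _ ≤ ε / 2 + ε / 2 := add_le_add hW hn
    _ = ε := ENNReal.add_halves ε

end PLSProcess

theorem propositionA1 {Ω A B : Type*} [MeasurableSpace Ω] [MeasurableSpace A] [MeasurableSpace B]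
    (P : Measure Ω) [IsProbabilityMeasure P] (p q R : ℕ) (hq : 1 ≤ q) (hqp : q ≤ p)
    (τ : ℝ) (hτ₀ : 0 < τ) (hτ₁ : τ < 1)
    (m : PLSProcess Ω A B P p R)
    (β₀ : EuclideanSpace ℝ (Fin p)) (hβ₀ : β₀ ∈ constraintSet p q)
    (hquant : m.CondQuantileZero τ)
    (h1 : m.C1) (h2 : m.C2) (h3 : m.C3) (h4 : m.C4) (h5 : m.C5 τ)
    -- the unconstrained estimator
    (βt : ℕ → Ω → EuclideanSpace ℝ (Fin p))
    (hβt : ∀ n, ∀ᵐ ω ∂P, IsMinOn (m.loss τ β₀ n ω) Set.univ (βt n ω))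
    -- the constrained estimator
    (βh : ℕ → Ω → EuclideanSpace ℝ (Fin p))
    (hβh : ∀ n, ∀ᵐ ω ∂P, βh n ω ∈ constraintSet p q ∧
      IsMinOn (m.loss τ β₀ n ω) (constraintSet p q) (βh n ω)) :
    -- consistency with rate
    IsLittleOp P (fun n ω => βt n ω - β₀) (fun n => (n : ℝ) ^ (-(1 / 2) : ℝ) * Real.log n) ∧
    IsLittleOp P (fun n ω => βh n ω - β₀) (fun n => (n : ℝ) ^ (-(1 / 2) : ℝ) * Real.log n) ∧
    -- `K_n` is positive definite for large `n`, so that its inverse and the projection make sense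
    (∀ᶠ n in atTop, (m.K n).PosDef) ∧
    -- Bahadur representation
    IsLittleOp P (fun n ω => (βt n ω - β₀) - Matrix.toEuclideanLin (m.K n)⁻¹ (m.G τ n ω))
      (fun n => (n : ℝ) ^ (-(1 / 2) : ℝ)) ∧
    -- equivalence with the metric projection of the unconstrained estimator
    IsLittleOp P
      (fun n ω => βh n ω - metricProj (constraintSet p q) ((n : ℝ)⁻¹ • m.K n) (βt n ω))
      (fun n => (n : ℝ) ^ (-(1 / 2) : ℝ)) := by
  obtain ⟨ε₀, M, C, a, hD⟩ := m.exists_regularDesign (by omega : 0 < p) hquant h1 h2 h3 h4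
  have hlog : ∀ b δ : ℝ, 0 < δ → ∀ᶠ n : ℕ in atTop, b ≤ δ * Real.log n := fun b δ hδ =>
    ((Real.tendsto_log_atTop.comp tendsto_natCast_atTop_atTop).const_mul_atTop
      hδ).eventually_ge_atTop b
  have hone : (fun n : ℕ => (n : ℝ) ^ (-(1 / 2) : ℝ)) = fun n : ℕ => (n : ℝ) ^ (-(1 / 2) : ℝ) * 1 :=
    funext fun n => (mul_one _).symm
  rw [hone]
  refine ⟨isLittleOp_of_sqrt_mul fun ε hε δ hδ => ?_, isLittleOp_of_sqrt_mul fun ε hε δ hδ => ?_,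
    hD.posDef_K, isLittleOp_of_sqrt_mul fun ε hε δ hδ => ?_,
    isLittleOp_of_sqrt_mul fun ε hε δ hδ => ?_⟩ <;>
  obtain ⟨b, hb⟩ := hD.exists_eventually_estimators_close hτ₀ hτ₁ hβ₀ hβt hβh hε
  · filter_upwards [hb 1 one_pos, hlog b δ hδ] with n hn hbn
    exact (measure_mono fun ω hω hcon => absurd (hcon.1.trans hbn) (not_le.2 hω)).trans hn
  · filter_upwards [hb 1 one_pos, hlog b δ hδ] with n hn hbn
    exact (measure_mono fun ω hω hcon => absurd (hcon.2.1.trans hbn) (not_le.2 hω)).trans hn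
  · filter_upwards [hb δ hδ] with n hn
    refine (measure_mono fun ω hω hcon => absurd hcon.2.2.1 (not_le.2 ?_)).trans hn
    simpa using hω
  · filter_upwards [hb δ hδ] with n hn
    refine (measure_mono fun ω hω hcon => absurd hcon.2.2.2 (not_le.2 ?_)).trans hn
    simpa using hω
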